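/- **Setting.** Let $G$ be a finite group and let $A,B\subseteq G\setminus\{1\}$ be generating sets with $A=A^{-1}$, $B=B^{-1}$ and $gag^{-1}\neq b$ for all $a\in A$, $b\in B$, $g\in G$. Let $X=\mathrm{Cay}(A,G,B)$ be the double (left-right) Cayley complex: a graded poset with one empty face $\emptyset$ (of dimension $-1$), vertices $\{g\}$ ($g\in G$), edges $\{g,ag\}$ and $\{g,gb\}$, and squares $\{g,ag,gb,agb\}$ ($a\in A$, $b\in B$), where a square is given together with its four edges $\{g,ag\},\{gb,agb\},\{g,gb\},\{ag,agb\}$. Let $w$ be the natural weight function: $w(x)$ is the probability of obtaining the face $x$ by choosing a square uniformly at random and then a face of that square of dimension $\dim x$ uniformly at random. Let $\mathbb F$ be a finite field and give $X$ an $\mathbb F$-orientation $[\,:\,]$ with $[v:\emptyset]=1$ for every vertex $v$. Let $C_A\subseteq\mathbb F^A$ and $C_B\subseteq\mathbb F^B$ be linear codes; let $\Sigma=C_A\otimes C_B$ be the space of $A\times B$-matrices over $\mathbb F$ all of whose columns lie in $C_A$ and all of whose rows lie in $C_B$; write $r_a(m)$ and $c_b(m)$ for the rows and columns of a matrix $m$.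 The sheaf $\mathcal F$ on $X$ has $\mathcal F(\emptyset)=0$, $\mathcal F(\{g\})=\Sigma$, $\mathcal F(\{g,ag\})=C_B$, $\mathcal F(\{g,gb\})=C_A$, $\mathcal F(\{g,ag,gb,agb\})=\mathbb F$; its restriction maps are $r_a$ from $\{g\}$ to $\{g,ag\}$, $c_b$ from $\{g\}$ to $\{g,gb\}$, $m\mapsto m_{a,b}$ from $\{g\}$ to $\{g,ag,gb,agb\}$, and the $b$-th (respectively $a$-th) coordinate from $\{g,ag\}$ (respectively $\{g,gb\}$) to $\{g,ag,gb,agb\}$. Let $(df)(e)=\sum_{v\in e}[e:v]\,\mathrm{res}_{e\leftarrow v}f(v)$ be the coboundary map on $0$-cochains and let $Z^0=\ker d$ be the $0$-cocycle code, viewed as a code inside $C^0(X,\mathcal F)=\Sigma^{G}$. For a code $C\subseteq\Sigma^n$, $\mathrm{dist}$ is the normalized Hamming distance, $\delta(C)$ is the minimum of $\mathrm{dist}(f,g)$ over distinct $f,g\in C$, and $r(C)=\log_{|\Sigma^n|}|C|$. The code $C_A\otimes C_B$ is *$\kappa$-agreement testable* if for every matrix $m_1$ with all columns in $C_A$ and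 every matrix $m_2$ with all rows in $C_B$ there is $m\in C_A\otimes C_B$ with $$\kappa\Big[\tfrac{\#\{a:\,r_a(m_2)\ne r_a(m)\}}{2|A|}+\tfrac{\#\{b:\,c_b(m_1)\ne c_b(m)\}}{2|B|}\Big]\le\tfrac{\#\{(a,b):\,(m_1)_{a,b}\neq(m_2)_{a,b}\}}{|A||B|}.$$ $\mathrm{Cay}(A,G)$ and $\mathrm{Cay}(G,B)$ are the graphs on $G$ with edges $\{g,ag\}$ and $\{g,gb\}$, respectively; a graph is a *$\lambda$-expander* if all eigenvalues of its normalized adjacency operator on the functions of (weighted) mean zero lie in $[-1,\lambda]$. The *natural tester* of $Z^0$ chooses an edge $e$ of $X$ uniformly at random, reads $f$ at the two ends of $e$ and accepts $f\in\Sigma^G$ if and only if $(df)(e)=0$; it has soundness $\mu$ if it rejects every $f\in\Sigma^G$ with probability at least $\mu\,\mathrm{dist}(f,Z^0)$. The *correction algorithm* with parameter $q\ge 0$ takes $f\in\Sigma^G$ and, as long as there are a vertex $u$ and a cochain $h$ supported at $u$ with $\|df+dh\|_w<\|df\|_w-q\,w(u)$, where $\|\cdot\|_w$ is the $w$-weight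 of the support, it chooses such $u$ and $h$ and replaces $f$ by $f+h$; when there are none, it returns $f$. **Theorem.** Let $0<\varepsilon\le1$ and suppose that $\delta(C_A)\ge\varepsilon$, $\delta(C_B)\geq\varepsilon$, $C_A\otimes C_B$ is $\varepsilon$-agreement testable, and $\mathrm{Cay}(A,G)$ and $\mathrm{Cay}(G,B)$ are $\frac{\varepsilon^2}{2500}$-expanders. Put $\eta=\dfrac{1}{250000\,\varepsilon^{-3}+4800\max\{|A|,|B|\}\,\varepsilon^{-1}}$. Then: 1. $\delta(Z^0)\ge 0.9996\,\varepsilon$. 2. $r(Z^0)\ge\dfrac{4r(C_A)r(C_B)-3}{4r(C_A)r(C_B)}$. 3. The natural tester is a $2$-query tester of $Z^0$ and has soundness $\dfrac{1}{\max\{\frac{|A|}{|B|},\frac{|B|}{|A|}\}\,\big[250000\,\varepsilon^{-3}+4800\max\{|A|,|B|\}\,\varepsilon^{-1}\big]}$. 4. The correction algorithm with $q=\frac{\varepsilon}{100}$ corrects all words that are $\eta$-close to $Z^0$: if $\mathrm{dist}(f,Z^0)<\eta$, then there is a unique $c\in Z^0$ with $\mathrm{dist}(f,c)<\eta$, and on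 input $f$ the algorithm stops and returns $c$, whatever choices it makes. 5. This algorithm can be carried out in linear time: there are a random access machine program (with unit-cost instructions: loading constants, copying, increment, decrement, array access, comparison, bounded jump tables) and a constant $K$, both depending only on $\varepsilon,|A|,|B|,|\mathbb F|$, such that for all $G,A,B,C_A,C_B$ as above, given the adjacency tables of $X$, the inversion tables of $A$ and $B$, the list of the matrices in $\Sigma$ and a word $f\in\Sigma^G$, the program halts after at most $K|G|$ steps with a possible output of the correction algorithm (with $q=\frac{\varepsilon}{100}$) on input $f$. (If $C_A=0$ or $C_B=0$, a minimum over the empty set is understood as $+\infty$, and item 2 is void.) -/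

import Mathlib

/-! # Codes, sheaves on graded posets, the double Cayley complex, and a random access machine -/

universe u v

noncomputable section

namespace SheafCode

open scoped Classical

/-! ## Error correcting codes

A code with (possibly varying) finite alphabets `α i`, `i : ι`, is a set of words in `∀ i, α i`. -/

section Codes

variable {ι : Type*} [Fintype ι] {α : ι → Type*}

/-- Normalized Hamming distance. -/
def ndist (f g : ∀ i, α i) : ℝ := (hammingDist f g : ℝ) / Fintype.card ι

/-- The relative distance `δ(C)` of a code: the infimum of the normalized distances of two distinct
code words (`⊤` if there are no two distinct code words). -/
def relDist (C : Set (∀ i, α i)) : EReal :=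
  ⨅ f ∈ C, ⨅ g ∈ C, ⨅ _ : f ≠ g, ((ndist f g : ℝ) : EReal)

/-- The rate `r(C) = log_{|Σ^n|} |C|` of a code. -/
def rate (C : Set (∀ i, α i)) : ℝ :=
  Real.logb (Nat.card (∀ i, α i)) (Nat.card C)

/-- The distance `dist(f, C)` of a word to a code. -/
def distTo (f : ∀ i, α i) (C : Set (∀ i, α i)) : ℝ := ⨅ g : C, ndist f g

end Codes

/-- A (non-adaptive) tester for words in `∀ i, α i`: it draws a seed uniformly at random from a
finite set, reads the letters in the positions `query ω` and accepts or rejects on their basis. -/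
structure Tester {ι : Type u} (α : ι → Type v) where
  /-- The random seeds. -/
  Seed : Type u
  fintypeSeed : Fintype Seed
  /-- The positions that are read. -/
  query : Seed → Finset ι
  /-- The verdict. -/
  accept : Seed → (∀ i, α i) → Prop
  /-- The verdict depends only on the letters that are read. -/
  accept_congr : ∀ ω f g, (∀ i ∈ query ω, f i = g i) → (accept ω f ↔ accept ω g)

namespace Tester

variable {ι : Type u} {α : ι → Type v}

/-- The probability that the tester rejects the word `f`. -/
def rejectProb (T : Tester α) (f : ∀ i, α i) : ℝ :=
  (Nat.card {ω : T.Seed // ¬ T.accept ω f} : ℝ) / Nat.card T.Seed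

/-- `T` is a `q`-query tester for `C`: at most `q` letters are read, and all words of `C` are
accepted with probability one. -/
def IsTesterFor (T : Tester α) (q : ℕ) (C : Set (∀ i, α i)) : Prop :=
  (∀ ω, (T.query ω).card ≤ q) ∧ ∀ f ∈ C, ∀ ω, T.accept ω f

/-- `T` has soundness `μ` as a tester for `C`. -/
def HasSoundness [Fintype ι] (T : Tester α) (C : Set (∀ i, α i)) (μ : ℝ) : Prop :=
  ∀ f, μ * distTo f C ≤ T.rejectProb f

end Tester

/-! ## Expander graphs -/

section Graphs

variable {V : Type*} [Fintype V]

/-- The natural weight of an edge of a graph. -/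
def natEdgeWeight (Γ : SimpleGraph V) : ℝ := 1 / Nat.card Γ.edgeSet

/-- The natural weight of a vertex of a graph. -/
def natVertexWeight (Γ : SimpleGraph V) (v : V) : ℝ :=
  (Nat.card {e : Γ.edgeSet // v ∈ e.1} : ℝ) / (2 * Nat.card Γ.edgeSet)

/-- The weighted adjacency operator of a graph with its natural weight function. -/
def adjOp (Γ : SimpleGraph V) (f : V → ℝ) (v : V) : ℝ :=
  ∑ u, if Γ.Adj v u then natEdgeWeight Γ / (2 * natVertexWeight Γ v) * f u else 0

/-- `Γ`, with its natural weight function, is a `lam`-expander: all eigenvalues of the weighted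
adjacency operator on the space of functions of weighted mean zero lie in `[-1, lam]`. -/
def IsExpander (Γ : SimpleGraph V) (lam : ℝ) : Prop :=
  ∀ (μ : ℝ) (f : V → ℝ), f ≠ 0 → ∑ v, natVertexWeight Γ v * f v = 0 →
    (∀ v, adjOp Γ f v = μ * f v) → μ ∈ Set.Icc (-1) lam

end Graphs

/-- The left Cayley graph `Cay(A, G)`, with edges `{g, ag}`. -/
def leftCayley {G : Type*} [Group G] (A : Set G) : SimpleGraph G :=
  SimpleGraph.fromRel fun g h => ∃ a ∈ A, h = a * g

/-- The right Cayley graph `Cay(G, B)`, with edges `{g, gb}`. -/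
def rightCayley {G : Type*} [Group G] (B : Set G) : SimpleGraph G :=
  SimpleGraph.fromRel fun g h => ∃ b ∈ B, h = g * b

/-! ## Tensor codes -/

section Tensor

variable {F ι κ : Type*} [Field F]

/-- The tensor code `C₁ ⊗ C₂`: all matrices whose columns lie in `C₁` and whose rows lie
in `C₂`. -/
def tensorCode (C₁ : Submodule F (ι → F)) (C₂ : Submodule F (κ → F)) :
    Submodule F (Matrix ι κ F) where
  carrier := {m | (∀ j, (fun i => m i j) ∈ C₁) ∧ ∀ i, (fun j => m i j) ∈ C₂}
  add_mem' := fun h h' =>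
    ⟨fun j => C₁.add_mem (h.1 j) (h'.1 j), fun i => C₂.add_mem (h.2 i) (h'.2 i)⟩
  zero_mem' := ⟨fun _ => C₁.zero_mem, fun _ => C₂.zero_mem⟩
  smul_mem' := fun c _ h =>
    ⟨fun j => C₁.smul_mem c (h.1 j), fun i => C₂.smul_mem c (h.2 i)⟩

/-- `r_i`, the `i`-th row. -/
def rowMap (C₁ : Submodule F (ι → F)) (C₂ : Submodule F (κ → F)) (i : ι) :
    tensorCode C₁ C₂ →ₗ[F] C₂ where
  toFun m := ⟨fun j => m.1 i j, m.2.2 i⟩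
  map_add' _ _ := rfl
  map_smul' _ _ := rfl

/-- `c_j`, the `j`-th column. -/
def colMap (C₁ : Submodule F (ι → F)) (C₂ : Submodule F (κ → F)) (j : κ) :
    tensorCode C₁ C₂ →ₗ[F] C₁ where
  toFun m := ⟨fun i => m.1 i j, m.2.1 j⟩
  map_add' _ _ := rfl
  map_smul' _ _ := rfl

/-- The `(i, j)`-entry. -/
def entryMap (C₁ : Submodule F (ι → F)) (C₂ : Submodule F (κ → F)) (i : ι) (j : κ) :
    tensorCode C₁ C₂ →ₗ[F] F where
  toFun m := m.1 i j
  map_add' _ _ := rfl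
  map_smul' _ _ := rfl

/-- The `i`-th coordinate on a linear code. -/
def coordMap (C : Submodule F (ι → F)) (i : ι) : C →ₗ[F] F :=
  (LinearMap.proj i).comp C.subtype

/-- The tensor code `C₁ ⊗ C₂` is `κ'`-agreement testable: for every matrix `m₁` with columns in `C₁`
and every matrix `m₂` with rows in `C₂` there is a word `m` of the tensor code such that `κ'` times
the average of the fraction of rows in which `m₂` and `m` differ and the fraction of columns in
which `m₁` and `m` differ is at most the fraction of entries in which `m₁` and `m₂` differ. -/
def IsAgreementTestable [Fintype ι] [Fintype κ]
    (C₁ : Submodule F (ι → F)) (C₂ : Submodule F (κ → F)) (κ' : ℝ) : Prop :=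
  ∀ m₁ m₂ : Matrix ι κ F, (∀ j, (fun i => m₁ i j) ∈ C₁) → (∀ i, (fun j => m₂ i j) ∈ C₂) →
    ∃ m ∈ tensorCode C₁ C₂,
      κ' * ((Nat.card {i : ι // ∃ j, m₂ i j ≠ m i j} : ℝ) / (2 * Fintype.card ι)
          + (Nat.card {j : κ // ∃ i, m₁ i j ≠ m i j} : ℝ) / (2 * Fintype.card κ))
        ≤ (Nat.card {x : ι × κ // m₁ x.1 x.2 ≠ m₂ x.1 x.2} : ℝ)
            / (Fintype.card ι * Fintype.card κ)

end Tensor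

/-! ## Sheaves on graded posets -/

/-- The `i`-faces `X(i)` of a graded poset `X` (the dimension of a face is its grade). -/
abbrev Faces (X : Type u) [PartialOrder X] [GradeOrder ℤ X] (i : ℤ) : Type u :=
  {x : X // grade ℤ x = i}

/-- An `R`-sheaf on a poset. -/
structure PosetSheaf (R : Type v) [CommRing R] (X : Type u) [PartialOrder X] where
  obj : X → Type v
  [addCommGroup : ∀ x, AddCommGroup (obj x)]
  [module : ∀ x, Module R (obj x)]
  res : ∀ {x y : X}, x < y → obj x →ₗ[R] obj y
  res_comp : ∀ {x y z : X} (hxy : x < y) (hyz : y < z) (s : obj x),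
    res hyz (res hxy s) = res (hxy.trans hyz) s

attribute [instance] PosetSheaf.addCommGroup PosetSheaf.module

/-- An `R`-orientation `[y : x] = sign y x` of a graded poset; only the values for `x ⋖ y` are
meaningful. -/
structure PosetOrientation (R : Type v) [CommRing R] (X : Type u) [PartialOrder X] [GradeOrder ℤ X]
    [Fintype X] where
  sign : X → X → R
  isUnit_sign : ∀ {x y : X}, x ⋖ y → IsUnit (sign y x)
  sum_eq_zero : ∀ x z : X, x ≤ z → grade ℤ z = grade ℤ x + 2 →
    ∑ y : X, (if x < y ∧ y < z then sign z y * sign y x else 0) = 0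

section Cohomology

variable {R : Type v} [CommRing R] {X : Type u} [PartialOrder X] [GradeOrder ℤ X] [Fintype X]

/-- The space `C^i(X, 𝓕)` of `i`-cochains. -/
abbrev Cochain (𝓕 : PosetSheaf R X) (i : ℤ) : Type (max u v) :=
  ∀ x : Faces X i, 𝓕.obj x.1

/-- The `i`-th coboundary map. -/
def coboundary (o : PosetOrientation R X) (𝓕 : PosetSheaf R X) (i : ℤ) :
    Cochain 𝓕 i →ₗ[R] Cochain 𝓕 (i + 1) where
  toFun f y := ∑ x : Faces X i, if h : x.1 < y.1 then o.sign y.1 x.1 • 𝓕.res h (f x) else 0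
  map_add' f g := by
    funext y
    simp only [Pi.add_apply, ← Finset.sum_add_distrib]
    refine Finset.sum_congr rfl fun x _ => ?_
    split_ifs <;> simp
  map_smul' c f := by
    funext y
    simp only [Pi.smul_apply, RingHom.id_apply, Finset.smul_sum]
    refine Finset.sum_congr rfl fun x _ => ?_
    split_ifs <;> simp [smul_comm c]

/-- The space `Z^i(X, 𝓕)` of `i`-cocycles. -/
def cocycles (o : PosetOrientation R X) (𝓕 : PosetSheaf R X) (i : ℤ) : Submodule R (Cochain 𝓕 i) :=
  LinearMap.ker (coboundary o 𝓕 i)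

/-- The `i`-cocycle code: `Z^i(X, 𝓕)` as a code inside `C^i(X, 𝓕)`. -/
def cocycleCode (o : PosetOrientation R X) (𝓕 : PosetSheaf R X) (i : ℤ) : Set (Cochain 𝓕 i) :=
  cocycles o 𝓕 i

/-- The natural tester of the `i`-cocycle code: choose an `(i + 1)`-face `y` uniformly at random,
read `f x` for all `i`-faces `x` of `y`, and accept if `(d f) y = 0`. -/
def naturalTester (o : PosetOrientation R X) (𝓕 : PosetSheaf R X) (i : ℤ) :
    Tester fun x : Faces X i => 𝓕.obj x.1 where
  Seed := Faces X (i + 1)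
  fintypeSeed := inferInstance
  query y := Finset.univ.filter fun x => x.1 < y.1
  accept y f := coboundary o 𝓕 i f y = 0
  accept_congr := by
    intro y f g h
    have : coboundary o 𝓕 i f y = coboundary o 𝓕 i g y := by
      refine Finset.sum_congr rfl fun x _ => ?_
      split_ifs with hx
      · rw [h x (by simpa using hx)]
      · rfl
    rw [this]

/-- The natural weight function of a poset that is pure of dimension `d`: the weight of `x` is the
probability of obtaining `x` by choosing a `d`-face `y` and then a face of `y` of the same dimension
as `x`, both uniformly at random. -/
def natWeight (X : Type u) [PartialOrder X] [GradeOrder ℤ X] [Fintype X] (d : ℤ) (x : X) : ℝ :=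
  1 / (Fintype.card (Faces X d) : ℝ) *
    ∑ y : Faces X d, if x ≤ y.1 then
      1 / (Nat.card {x' : X // grade ℤ x' = grade ℤ x ∧ x' ≤ y.1} : ℝ) else 0

/-- The weighted norm `‖f‖_w = w(supp f)` of a cochain. -/
def wnorm (w : X → ℝ) {𝓕 : PosetSheaf R X} {i : ℤ} (f : Cochain 𝓕 i) : ℝ :=
  ∑ x : Faces X i, if f x ≠ 0 then w x.1 else 0

/-- One iteration of the correction algorithm with parameter `q`, from `f` to `f'`: for some face
`u` of dimension `0, …, k` and some `k`-cochain `h` supported on the faces containing `u` (that is,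
the extension by zero of a cochain on the link of `u`) such that
`‖d f + d h‖ < ‖d f‖ - q w(u)`, the cochain `f` is replaced with `f' = f + h`. -/
def CorrectionStep (w : X → ℝ) (o : PosetOrientation R X) (𝓕 : PosetSheaf R X) (k : ℤ) (q : ℝ)
    (f f' : Cochain 𝓕 k) : Prop :=
  ∃ (u : X) (h : Cochain 𝓕 k), 0 ≤ grade ℤ u ∧ grade ℤ u ≤ k ∧
    (∀ x : Faces X k, ¬ u ≤ x.1 → h x = 0) ∧
    wnorm w (coboundary o 𝓕 k f + coboundary o 𝓕 k h)
      < wnorm w (coboundary o 𝓕 k f) - q * w u ∧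
    f' = f + h

/-- The correction algorithm with input `f` and parameter `q` can return `f'`: from `f` one gets
to `f'` by iterations of the algorithm, and no further iteration is possible. -/
def CorrectionReturns (w : X → ℝ) (o : PosetOrientation R X) (𝓕 : PosetSheaf R X) (k : ℤ) (q : ℝ)
    (f f' : Cochain 𝓕 k) : Prop :=
  Relation.ReflTransGen (CorrectionStep w o 𝓕 k q) f f' ∧
    ∀ f'', ¬ CorrectionStep w o 𝓕 k q f' f''

/-- The correction algorithm with parameter `q` decodes all words that are `η`-close to the
`k`-cocycle code: on input `f` with `dist(f, Z^k) < η`, it stops after finitely many iterations,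
whatever choices it makes, and returns the unique word `c` of `Z^k` with `dist(f, c) < η`. -/
def CorrectionDecodes (w : X → ℝ) (o : PosetOrientation R X) (𝓕 : PosetSheaf R X) (k : ℤ) (q η : ℝ) :
    Prop :=
  ∀ f : Cochain 𝓕 k, distTo f (cocycleCode o 𝓕 k) < η →
    Acc (fun f₂ f₁ => CorrectionStep w o 𝓕 k q f₁ f₂) f ∧
    ∃ c ∈ cocycleCode o 𝓕 k, ndist f c < η ∧
      (∀ c' ∈ cocycleCode o 𝓕 k, ndist f c' < η → c' = c) ∧
      ∀ f', CorrectionReturns w o 𝓕 k q f f' → f' = c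

end Cohomology

/-! ## The double Cayley complex -/

/-- Two symmetric generating sets of a group, none of them containing `1`, such that no element of
the first one is conjugate to an element of the second one. -/
structure CayleyPair (G : Type u) [Group G] where
  A : Finset G
  B : Finset G
  inv_mem_A : ∀ a ∈ A, a⁻¹ ∈ A
  inv_mem_B : ∀ b ∈ B, b⁻¹ ∈ B
  one_notMem_A : (1 : G) ∉ A
  one_notMem_B : (1 : G) ∉ B
  closure_A : Subgroup.closure (A : Set G) = ⊤
  closure_B : Subgroup.closure (B : Set G) = ⊤
  conj_ne : ∀ a ∈ A, ∀ b ∈ B, ∀ g : G, g * a * g⁻¹ ≠ b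

section Complex

variable {G : Type u} [Group G]

/-- The edges `{g, ag}`. -/
def EdgeA (P : CayleyPair G) : Type u := {e : Sym2 G // ∃ g, ∃ a ∈ P.A, e = s(g, a * g)}

/-- The edges `{g, gb}`. -/
def EdgeB (P : CayleyPair G) : Type u := {e : Sym2 G // ∃ g, ∃ b ∈ P.B, e = s(g, g * b)}

/-- The pair of opposite edges `{g, ag}`, `{gb, agb}` together with the pair of opposite edges
`{g, gb}`, `{ag, agb}`. -/
def squareOf (g a b : G) : Sym2 (Sym2 G) × Sym2 (Sym2 G) :=
  (s(s(g, a * g), s(g * b, a * g * b)), s(s(g, g * b), s(a * g, a * g * b)))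

/-- The squares with vertices `g, ag, gb, agb`. A square is given by its four edges. -/
def Square (P : CayleyPair G) : Type u :=
  {s : Sym2 (Sym2 G) × Sym2 (Sym2 G) // ∃ g, ∃ a ∈ P.A, ∃ b ∈ P.B, s = squareOf g a b}

/-- The faces of the double Cayley complex `Cay(A, G, B)`. -/
inductive Face (P : CayleyPair G) : Type u
  | empty : Face P
  | vertex (g : G) : Face P
  | edgeA (e : EdgeA P) : Face P
  | edgeB (e : EdgeB P) : Face P
  | square (s : Square P) : Face P

namespace Face

variable {P : CayleyPair G}

/-- The incidence relation of faces. -/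
def le : Face P → Face P → Prop
  | empty, _ => True
  | vertex g, vertex h => g = h
  | vertex g, edgeA e => g ∈ e.1
  | vertex g, edgeB e => g ∈ e.1
  | vertex g, square s => ∃ e ∈ s.1.1, g ∈ e
  | edgeA e, edgeA e' => e = e'
  | edgeA e, square s => e.1 ∈ s.1.1
  | edgeB e, edgeB e' => e = e'
  | edgeB e, square s => e.1 ∈ s.1.2
  | square s, square s' => s = s'
  | _, _ => False

/-- The dimension of a face. -/
def dim : Face P → ℤ
  | empty => -1
  | vertex _ => 0
  | edgeA _ => 1
  | edgeB _ => 1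
  | square _ => 2

theorem mem_sq_iff {s : Square P} {g : G} :
    (∃ e ∈ s.1.1, g ∈ e) ↔ ∃ e ∈ s.1.2, g ∈ e := by
  obtain ⟨s, h, a, ha, b, hb, rfl⟩ := s
  simp only [squareOf, Sym2.mem_iff, exists_eq_or_imp, exists_eq_left]
  tauto

instance : PartialOrder (Face P) where
  le := le
  le_refl x := by cases x <;> simp [le]
  le_trans x y z hxy hyz := by
    cases x <;> cases y <;> cases z <;> simp only [le] at hxy hyz ⊢ <;>
      first
        | exact hxy.elim
        | exact hyz.elim
        | (subst hxy; exact hyz)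
        | (subst hyz; exact hxy)
        | exact ⟨_, hyz, hxy⟩
        | exact mem_sq_iff.2 ⟨_, hyz, hxy⟩
  le_antisymm x y hxy hyx := by
    cases x <;> cases y <;> simp only [le] at hxy hyx <;> simp_all

theorem lt_iff {x y : Face P} : x < y ↔ le x y ∧ dim x < dim y := by
  rw [lt_iff_le_and_ne]
  refine and_congr_right fun h => ?_
  change le x y at h
  cases x <;> cases y <;> simp only [le] at h <;> simp_all [dim]

instance : GradeOrder ℤ (Face P) where
  grade := dim
  grade_strictMono _ _ h := (lt_iff.1 h).2
  covBy_grade x y h := by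
    have h1 := lt_iff.1 h.1
    have key : ∀ z : Face P, le x z → le z y → ¬ (dim x < dim z ∧ dim z < dim y) :=
      fun z hxz hzy hd => h.2 (lt_iff.2 ⟨hxz, hd.1⟩) (lt_iff.2 ⟨hzy, hd.2⟩)
    rw [Order.covBy_iff_add_one_eq]
    cases x <;> cases y <;> simp only [le, dim] at h1 ⊢ <;> try omega
    case empty.edgeA e =>
      obtain ⟨e, g, a, ha, rfl⟩ := e
      exact (key (vertex g) trivial (by simp [le]) (by simp [dim])).elim
    case empty.edgeB e =>
      obtain ⟨e, g, b, hb, rfl⟩ := e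
      exact (key (vertex g) trivial (by simp [le]) (by simp [dim])).elim
    case empty.square s =>
      obtain ⟨s, g, a, ha, b, hb, rfl⟩ := s
      exact (key (vertex g) trivial (by simp [le, squareOf]) (by simp [dim])).elim
    case vertex.square v s =>
      obtain ⟨e, he, hv⟩ := h1.1
      have he' : ∃ g, ∃ a ∈ P.A, e = s(g, a * g) := by
        obtain ⟨s, g, a, ha, b, hb, rfl⟩ := s
        simp only [squareOf, Sym2.mem_iff] at he
        rcases he with rfl | rfl
        · exact ⟨g, a, ha, rfl⟩
        · exact ⟨g * b, a, ha, by rw [mul_assoc]⟩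
      exact (key (edgeA ⟨e, he'⟩) hv he (by simp [dim])).elim

instance [Fintype G] : Finite (EdgeA P) := Subtype.finite
instance [Fintype G] : Finite (EdgeB P) := Subtype.finite
instance [Fintype G] : Finite (Square P) := Subtype.finite

instance [Fintype G] : Fintype (Face P) :=
  @Fintype.ofFinite _ <| Finite.of_injective
    (fun x : Face P => match x with
      | empty => (Sum.inl (Sum.inl ()) : (Unit ⊕ G) ⊕ (EdgeA P ⊕ EdgeB P) ⊕ Square P)
      | vertex g => Sum.inl (Sum.inr g)
      | edgeA e => Sum.inr (Sum.inl (Sum.inl e))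
      | edgeB e => Sum.inr (Sum.inl (Sum.inr e))
      | square s => Sum.inr (Sum.inr s))
    (by intro x y h; cases x <;> cases y <;> simp_all)

end Face

/-! Labels: an edge `e` at `g` has the form `{g, ag}` or `{g, gb}` for unique `a`, `b`, and a square
at `g` has the form `{g, ag, gb, agb}` for unique `a`, `b`. -/

section Labels

variable {P : CayleyPair G}

theorem EdgeA.exists_label (e : EdgeA P) {g : G} (hg : g ∈ e.1) :
    ∃ a : P.A, e.1 = s(g, a * g) := by
  obtain ⟨e, h, a, ha, rfl⟩ := e
  rcases Sym2.mem_iff.1 hg with rfl | rfl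
  · exact ⟨⟨a, ha⟩, rfl⟩
  · exact ⟨⟨a⁻¹, P.inv_mem_A a ha⟩, by simp [Sym2.eq_swap]⟩

theorem EdgeB.exists_label (e : EdgeB P) {g : G} (hg : g ∈ e.1) :
    ∃ b : P.B, e.1 = s(g, g * b) := by
  obtain ⟨e, h, b, hb, rfl⟩ := e
  rcases Sym2.mem_iff.1 hg with rfl | rfl
  · exact ⟨⟨b, hb⟩, rfl⟩
  · exact ⟨⟨b⁻¹, P.inv_mem_B b hb⟩, by simp [Sym2.eq_swap]⟩

theorem squareOf_A (g a b : G) : squareOf (a * g) a⁻¹ b = squareOf g a b := by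
  simp only [squareOf, inv_mul_cancel_left]
  rw [Sym2.eq_swap (a := a * g) (b := g), Sym2.eq_swap (a := a * g * b) (b := g * b),
    Sym2.eq_swap (a := s(a * g, a * g * b))]

theorem squareOf_B (g a b : G) : squareOf (g * b) a b⁻¹ = squareOf g a b := by
  simp only [squareOf, mul_assoc, mul_inv_cancel, mul_one]
  rw [Sym2.eq_swap (a := s(g * b, _)), Sym2.eq_swap (a := g * b) (b := g),
    Sym2.eq_swap (a := a * (g * b)) (b := a * g)]

theorem Square.exists_label (s : Square P) {g : G} (hg : ∃ e ∈ s.1.1, g ∈ e) :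
    ∃ x : P.A × P.B, s.1 = squareOf g x.1 x.2 := by
  obtain ⟨s, h, a, ha, b, hb, rfl⟩ := s
  simp only [squareOf, Sym2.mem_iff, exists_eq_or_imp, exists_eq_left] at hg
  have ha' := P.inv_mem_A a ha
  have hb' := P.inv_mem_B b hb
  rcases hg with (rfl | rfl) | (rfl | rfl)
  · exact ⟨(⟨a, ha⟩, ⟨b, hb⟩), rfl⟩
  · exact ⟨(⟨a⁻¹, ha'⟩, ⟨b, hb⟩), (squareOf_A h a b).symm⟩
  · exact ⟨(⟨a, ha⟩, ⟨b⁻¹, hb'⟩), (squareOf_B h a b).symm⟩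
  · refine ⟨(⟨a⁻¹, ha'⟩, ⟨b⁻¹, hb'⟩), ?_⟩
    change squareOf h a b = squareOf (a * h * b) a⁻¹ b⁻¹
    rw [squareOf_B, squareOf_A]

/-- The `a` with `e = {g, ag}`. -/
def EdgeA.label (e : EdgeA P) {g : G} (hg : g ∈ e.1) : P.A := (e.exists_label hg).choose

/-- The `b` with `e = {g, gb}`. -/
def EdgeB.label (e : EdgeB P) {g : G} (hg : g ∈ e.1) : P.B := (e.exists_label hg).choose

/-- The `(a, b)` with `s = {g, ag, gb, agb}`. -/
def Square.label (s : Square P) {g : G} (hg : ∃ e ∈ s.1.1, g ∈ e) : P.A × P.B :=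
  (s.exists_label hg).choose

theorem EdgeA.label_spec (e : EdgeA P) {g : G} (hg : g ∈ e.1) : e.1 = s(g, e.label hg * g) :=
  (e.exists_label hg).choose_spec

theorem EdgeB.label_spec (e : EdgeB P) {g : G} (hg : g ∈ e.1) : e.1 = s(g, g * e.label hg) :=
  (e.exists_label hg).choose_spec

theorem Square.label_spec (s : Square P) {g : G} (hg : ∃ e ∈ s.1.1, g ∈ e) :
    s.1 = squareOf g (s.label hg).1 (s.label hg).2 :=
  (s.exists_label hg).choose_spec

theorem A_ne (P : CayleyPair G) (a : P.A) (g : G) : (a : G) * g ≠ g := fun h =>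
  P.one_notMem_A (by have := a.2; rwa [mul_eq_right.1 h] at this)

theorem B_ne (P : CayleyPair G) (b : P.B) (g : G) : g * (b : G) ≠ g := fun h =>
  P.one_notMem_B (by have := b.2; rwa [mul_eq_left.1 h] at this)

theorem AB_ne (P : CayleyPair G) (a : P.A) (b : P.B) (g : G) : (a : G) * g ≠ g * (b : G) := fun h =>
  P.conj_ne a a.2 b b.2 g⁻¹ (by simp [mul_assoc, h])

theorem AB_ne' (P : CayleyPair G) (a : P.A) (b : P.B) (g : G) : (a : G) * g * (b : G) ≠ g :=
  fun h => AB_ne P a ⟨_, P.inv_mem_B b b.2⟩ g (by simp [eq_mul_inv_iff_mul_eq, h])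

/-- The edge `{g, ag}` of the square `{g, ag, gb, agb}`. -/
theorem edgeA_of_square {g : G} {a : P.A} {b : P.B} {e : Sym2 G}
    (he : e ∈ (squareOf g (a : G) (b : G)).1) (hg : g ∈ e) : e = s(g, a * g) := by
  rcases Sym2.mem_iff.1 he with rfl | rfl
  · rfl
  · rcases Sym2.mem_iff.1 hg with h | h
    · exact (B_ne P b g h.symm).elim
    · exact (AB_ne' P a b g h.symm).elim

/-- The edge `{g, gb}` of the square `{g, ag, gb, agb}`. -/
theorem edgeB_of_square {g : G} {a : P.A} {b : P.B} {e : Sym2 G}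
    (he : e ∈ (squareOf g (a : G) (b : G)).2) (hg : g ∈ e) : e = s(g, g * b) := by
  rcases Sym2.mem_iff.1 he with rfl | rfl
  · rfl
  · rcases Sym2.mem_iff.1 hg with h | h
    · exact (A_ne P a g h.symm).elim
    · exact (AB_ne' P a b g h.symm).elim

theorem EdgeA.exists_square_label (e : EdgeA P) (s : Square P) (h : e.1 ∈ s.1.1) :
    ∃ b : P.B, ∃ g ∈ e.1, s(g, g * (b : G)) ∈ s.1.2 := by
  obtain ⟨s, g, a, ha, b, hb, rfl⟩ := s
  rcases Sym2.mem_iff.1 h with h | h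
  · exact ⟨⟨b, hb⟩, g, by simp [h], by simp [squareOf]⟩
  · exact ⟨⟨b⁻¹, P.inv_mem_B b hb⟩, g * b, by simp [h], by simp [squareOf, Sym2.eq_swap]⟩

theorem EdgeB.exists_square_label (e : EdgeB P) (s : Square P) (h : e.1 ∈ s.1.2) :
    ∃ a : P.A, ∃ g ∈ e.1, s(g, (a : G) * g) ∈ s.1.1 := by
  obtain ⟨s, g, a, ha, b, hb, rfl⟩ := s
  rcases Sym2.mem_iff.1 h with h | h
  · exact ⟨⟨a, ha⟩, g, by simp [h], by simp [squareOf]⟩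
  · exact ⟨⟨a⁻¹, P.inv_mem_A a ha⟩, a * g, by simp [h], by simp [squareOf, Sym2.eq_swap]⟩

/-- The `b` such that `s = {g, ag, gb, agb}` and `e = {g, ag}` for some `g`, `a`. -/
def EdgeA.squareLabel (e : EdgeA P) (s : Square P) (h : e.1 ∈ s.1.1) : P.B :=
  (e.exists_square_label s h).choose

/-- The `a` such that `s = {g, ag, gb, agb}` and `e = {g, gb}` for some `g`, `b`. -/
def EdgeB.squareLabel (e : EdgeB P) (s : Square P) (h : e.1 ∈ s.1.2) : P.A :=
  (e.exists_square_label s h).choose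

theorem label_of_edgeA (e : EdgeA P) (s : Square P) (h : e.1 ∈ s.1.1) {g : G} (hg : g ∈ e.1)
    (hs : ∃ e ∈ s.1.1, g ∈ e) : s.label hs = (e.label hg, e.squareLabel s h) := by
  have hs' := s.label_spec hs
  have he := e.label_spec hg
  obtain ⟨k, hk, hk'⟩ := (e.exists_square_label s h).choose_spec
  change s(k, k * (e.squareLabel s h : G)) ∈ s.1.2 at hk'
  generalize s.label hs = x at hs' ⊢
  generalize e.label hg = a at he ⊢
  generalize e.squareLabel s h = b at hk' ⊢
  obtain ⟨a', b'⟩ := x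
  rw [hs'] at h hk'
  have e1 := edgeA_of_square h hg
  have ea : a' = a := by
    rw [he] at e1
    exact Subtype.ext (mul_right_cancel (Sym2.congr_right.1 e1)).symm
  subst ea
  have eb : b' = b := by
    rw [he] at hk
    rcases Sym2.mem_iff.1 hk with rfl | rfl
    · have := edgeB_of_square hk' (Sym2.mem_mk_left _ _)
      exact Subtype.ext (mul_left_cancel (Sym2.congr_right.1 this)).symm
    · rw [← squareOf_A] at hk'
      have := edgeB_of_square (P := P) (a := ⟨_, P.inv_mem_A a' a'.2⟩) hk' (Sym2.mem_mk_left _ _)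
      exact Subtype.ext (mul_left_cancel (Sym2.congr_right.1 this)).symm
  rw [eb]

theorem label_of_edgeB (e : EdgeB P) (s : Square P) (h : e.1 ∈ s.1.2) {g : G} (hg : g ∈ e.1)
    (hs : ∃ e ∈ s.1.1, g ∈ e) : s.label hs = (e.squareLabel s h, e.label hg) := by
  have hs' := s.label_spec hs
  have he := e.label_spec hg
  obtain ⟨k, hk, hk'⟩ := (e.exists_square_label s h).choose_spec
  change s(k, (e.squareLabel s h : G) * k) ∈ s.1.1 at hk'
  generalize s.label hs = x at hs' ⊢
  generalize e.label hg = b at he ⊢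
  generalize e.squareLabel s h = a at hk' ⊢
  obtain ⟨a', b'⟩ := x
  rw [hs'] at h hk'
  have e1 := edgeB_of_square h hg
  have eb : b' = b := by
    rw [he] at e1
    exact Subtype.ext (mul_left_cancel (Sym2.congr_right.1 e1)).symm
  subst eb
  have ea : a' = a := by
    rw [he] at hk
    rcases Sym2.mem_iff.1 hk with rfl | rfl
    · have := edgeA_of_square hk' (Sym2.mem_mk_left _ _)
      exact Subtype.ext (mul_right_cancel (Sym2.congr_right.1 this)).symm
    · rw [← squareOf_B] at hk'
      have := edgeA_of_square (P := P) (b := ⟨_, P.inv_mem_B b' b'.2⟩) hk' (Sym2.mem_mk_left _ _)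
      exact Subtype.ext (mul_right_cancel (Sym2.congr_right.1 this)).symm
  rw [ea]

end Labels

/-! The double Cayley complex has an orientation with `[v : ∅] = 1` for all vertices `v`. -/

section ExistsOrientation

variable {P : CayleyPair G} (R : Type v) [CommRing R]

/-- A direction of an edge: one end gets the sign `-1` and the other one the sign `1`. -/
def edgeSign {V : Type*} (e : Sym2 V) (g : V) : R := if g = (Quot.out e).1 then -1 else 1

theorem edgeSign_cases {V : Type*} (e : Sym2 V) (g : V) : edgeSign R e g = 1 ∨ edgeSign R e g = -1 := by
  unfold edgeSign
  split_ifs <;> simp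

theorem edgeSign_mul_self {V : Type*} (e : Sym2 V) (g : V) : edgeSign R e g * edgeSign R e g = 1 := by
  rcases edgeSign_cases R e g with h | h <;> simp [h]

theorem edgeSign_add {V : Type*} {g h : V} (hgh : h ≠ g) : edgeSign R s(g, h) g + edgeSign R s(g, h) h = 0 := by
  have hout : s((Quot.out s(g, h)).1, (Quot.out s(g, h)).2) = s(g, h) := Quot.out_eq _
  unfold edgeSign
  generalize Quot.out s(g, h) = x at hout ⊢
  rcases Sym2.eq_iff.1 hout with ⟨h1, h2⟩ | ⟨h1, h2⟩
  · simp [h1, hgh]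
  · simp [h1, hgh.symm]

theorem edgeSign_mul {V : Type*} {g h : V} (hgh : h ≠ g) :
    edgeSign R s(g, h) g * edgeSign R s(g, h) h = -1 := by
  have h1 := eq_neg_of_add_eq_zero_left (edgeSign_add R hgh)
  rw [h1, neg_mul, edgeSign_mul_self]

/-- The signs of an orientation of the double Cayley complex: every edge is directed, and every
square `{g, ag, gb, agb}` is given the spin `g → ag → agb → gb → g`. -/
def faceSign : Face P → Face P → R
  | .edgeA e, .vertex v => edgeSign R e.1 v
  | .edgeB e, .vertex v => edgeSign R e.1 v
  | .square s, .edgeA e =>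
    if e.1 = s(s.2.choose, s.2.choose_spec.choose * s.2.choose) then
      edgeSign R e.1 (s.2.choose_spec.choose * s.2.choose)
    else edgeSign R e.1 (s.2.choose * s.2.choose_spec.choose_spec.2.choose)
  | .square s, .edgeB e =>
    if e.1 = s(s.2.choose, s.2.choose * s.2.choose_spec.choose_spec.2.choose) then
      edgeSign R e.1 s.2.choose
    else edgeSign R e.1
      (s.2.choose_spec.choose * s.2.choose * s.2.choose_spec.choose_spec.2.choose)
  | _, _ => 1

theorem exists_faceSign_square (s : Square P) : ∃ (g : G) (a : P.A) (b : P.B),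
    s.1 = squareOf g (a : G) (b : G) ∧
    (∀ e : EdgeA P, faceSign R (.square s) (.edgeA e) =
      if e.1 = s(g, a * g) then edgeSign R e.1 (a * g) else edgeSign R e.1 (g * b)) ∧
    (∀ e : EdgeB P, faceSign R (.square s) (.edgeB e) =
      if e.1 = s(g, g * b) then edgeSign R e.1 g else edgeSign R e.1 (a * g * b)) :=
  ⟨s.2.choose, ⟨s.2.choose_spec.choose, s.2.choose_spec.choose_spec.1⟩,
    ⟨s.2.choose_spec.choose_spec.2.choose, s.2.choose_spec.choose_spec.2.choose_spec.1⟩,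
    s.2.choose_spec.choose_spec.2.choose_spec.2, fun _ => rfl, fun _ => rfl⟩

theorem faceSign_isUnit (x y : Face P) : IsUnit (faceSign R y x) := by
  have h : faceSign R y x = 1 ∨ faceSign R y x = -1 := by
    cases y <;> cases x <;> simp only [faceSign, true_or]
    case edgeA.vertex => exact edgeSign_cases R _ _
    case edgeB.vertex => exact edgeSign_cases R _ _
    all_goals split_ifs <;> exact edgeSign_cases R _ _
  rcases h with h | h <;> simp [h]

theorem faceSign_sum_edge [Fintype G] (z : Face P) {g h : G} (hgh : h ≠ g)
    (hz : ∀ v, Face.le (.vertex v) z ↔ v = g ∨ v = h) (hd : z.dim = 1)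
    (hs : ∀ v, faceSign R z (.vertex v) = edgeSign R s(g, h) v) :
    ∑ y : Face P, (if .empty < y ∧ y < z then faceSign R z y * faceSign R y .empty else 0) = 0 := by
  rw [Fintype.sum_eq_add (Face.vertex g) (Face.vertex h)]
  · have h1 : (Face.empty : Face P) < .vertex g := Face.lt_iff.2 ⟨trivial, by simp [Face.dim]⟩
    have h2 : (Face.empty : Face P) < .vertex h := Face.lt_iff.2 ⟨trivial, by simp [Face.dim]⟩
    have h3 : Face.vertex g < z := Face.lt_iff.2 ⟨(hz g).2 (.inl rfl), by rw [hd]; exact zero_lt_one⟩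
    have h4 : Face.vertex h < z := Face.lt_iff.2 ⟨(hz h).2 (.inr rfl), by rw [hd]; exact zero_lt_one⟩
    rw [if_pos ⟨h1, h3⟩, if_pos ⟨h2, h4⟩, hs, hs]
    simpa [faceSign] using edgeSign_add R hgh
  · simpa using hgh.symm
  · intro y hy
    refine if_neg fun hlt => ?_
    have h1 := (Face.lt_iff.1 hlt.1).2
    have h2 := Face.lt_iff.1 hlt.2
    rw [hd] at h2
    cases y <;> simp only [Face.dim] at h1 h2 <;> try omega
    rcases (hz _).1 h2.1 with rfl | rfl
    · exact hy.1 rfl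
    · exact hy.2 rfl

theorem faceSign_sum_square [Fintype G] (s : Square P) (v : G)
    (hv : Face.le (.vertex v) (.square s)) :
    ∑ y : Face P, (if .vertex v < y ∧ y < .square s then
      faceSign R (.square s) y * faceSign R y (.vertex v) else 0) = 0 := by
  have key : ∀ (e : EdgeA P) (f : EdgeB P), v ∈ e.1 → v ∈ f.1 → e.1 ∈ s.1.1 → f.1 ∈ s.1.2 →
      (∑ y : Face P, (if .vertex v < y ∧ y < .square s then
        faceSign R (.square s) y * faceSign R y (.vertex v) else 0)) =
      faceSign R (.square s) (.edgeA e) * edgeSign R e.1 v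
        + faceSign R (.square s) (.edgeB f) * edgeSign R f.1 v := by
    intro e f he hf hes hfs
    rw [Fintype.sum_eq_add (Face.edgeA e) (Face.edgeB f)]
    · have h1 : Face.vertex v < .edgeA e := Face.lt_iff.2 ⟨he, by simp [Face.dim]⟩
      have h2 : Face.vertex v < .edgeB f := Face.lt_iff.2 ⟨hf, by simp [Face.dim]⟩
      have h3 : Face.edgeA e < .square s := Face.lt_iff.2 ⟨hes, by simp [Face.dim]⟩
      have h4 : Face.edgeB f < .square s := Face.lt_iff.2 ⟨hfs, by simp [Face.dim]⟩
      rw [if_pos ⟨h1, h3⟩, if_pos ⟨h2, h4⟩]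
      rfl
    · simp
    · intro y hy
      refine if_neg fun hlt => ?_
      have h1 := Face.lt_iff.1 hlt.1
      have h2 := Face.lt_iff.1 hlt.2
      have hl := s.label_spec hv
      cases y <;> simp only [Face.dim] at h1 h2 <;> try omega
      case edgeA e' =>
        have q := h2.1
        change e'.1 ∈ s.1.1 at q
        rw [hl] at q hes
        exact hy.1 (congrArg _ (Subtype.ext
          ((edgeA_of_square q h1.1).trans (edgeA_of_square hes he).symm)))
      case edgeB e' =>
        have q := h2.1
        change e'.1 ∈ s.1.2 at q
        rw [hl] at q hfs
        exact hy.2 (congrArg _ (Subtype.ext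
          ((edgeB_of_square q h1.1).trans (edgeB_of_square hfs hf).symm)))
  obtain ⟨g, a, b, hs, hA, hB⟩ := exists_faceSign_square R s
  have n1 := A_ne P a g
  have n2 := B_ne P b g
  have n3 := AB_ne P a b g
  have n4 := AB_ne' P a b g
  have n5 : (a : G) * g * b ≠ a * g := B_ne P b (a * g)
  have n6 : (a : G) * g * b ≠ g * b := by rw [mul_assoc]; exact A_ne P a (g * b)
  have m1 : s(g, (a : G) * g) ∈ s.1.1 := by simp [hs, squareOf]
  have m2 : s(g * (b : G), (a : G) * g * b) ∈ s.1.1 := by simp [hs, squareOf]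
  have m3 : s(g, g * (b : G)) ∈ s.1.2 := by simp [hs, squareOf]
  have m4 : s((a : G) * g, (a : G) * g * b) ∈ s.1.2 := by simp [hs, squareOf]
  let e1 : EdgeA P := ⟨s(g, a * g), g, a, a.2, rfl⟩
  let e2 : EdgeA P := ⟨s(g * b, a * g * b), g * b, a, a.2, by rw [mul_assoc]⟩
  let f1 : EdgeB P := ⟨s(g, g * b), g, b, b.2, rfl⟩
  let f2 : EdgeB P := ⟨s(a * g, a * g * b), a * g, b, b.2, rfl⟩
  have hA1 : faceSign R (.square s) (.edgeA e1) = edgeSign R s(g, a * g) (a * g) := by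
    rw [hA, if_pos rfl]
  have hA2 : faceSign R (.square s) (.edgeA e2) = edgeSign R s(g * b, a * g * b) (g * b) := by
    rw [hA, if_neg]
    intro h
    rcases Sym2.eq_iff.1 h with h | h
    · exact n2 h.1
    · exact n4 h.2
  have hB1 : faceSign R (.square s) (.edgeB f1) = edgeSign R s(g, g * b) g := by
    rw [hB, if_pos rfl]
  have hB2 : faceSign R (.square s) (.edgeB f2)
      = edgeSign R s(a * g, a * g * b) (a * g * b) := by
    rw [hB, if_neg]
    intro h
    rcases Sym2.eq_iff.1 h with h | h
    · exact n1 h.1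
    · exact n4 h.2
  have hv' : ∃ e ∈ s.1.1, v ∈ e := hv
  rw [hs] at hv'
  simp only [squareOf, Sym2.mem_iff, exists_eq_or_imp, exists_eq_left] at hv'
  rcases hv' with (rfl | rfl) | (rfl | rfl)
  · rw [key e1 f1 (by simp [e1]) (by simp [f1]) m1 m3, hA1, hB1]
    change edgeSign R s(v, a * v) (a * v) * edgeSign R s(v, a * v) v
      + edgeSign R s(v, v * b) v * edgeSign R s(v, v * b) v = 0
    rw [mul_comm, edgeSign_mul R n1, edgeSign_mul_self, neg_add_cancel]
  · rw [key e1 f2 (by simp [e1]) (by simp [f2]) m1 m4, hA1, hB2]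
    change edgeSign R s(g, a * g) (a * g) * edgeSign R s(g, a * g) (a * g)
      + edgeSign R s(a * g, a * g * b) (a * g * b) * edgeSign R s(a * g, a * g * b) (a * g) = 0
    rw [edgeSign_mul_self, mul_comm, edgeSign_mul R n5, add_neg_cancel]
  · rw [key e2 f1 (by simp [e2]) (by simp [f1]) m2 m3, hA2, hB1]
    change edgeSign R s(g * b, a * g * b) (g * b) * edgeSign R s(g * b, a * g * b) (g * b)
      + edgeSign R s(g, g * b) g * edgeSign R s(g, g * b) (g * b) = 0
    rw [edgeSign_mul_self, edgeSign_mul R n2, add_neg_cancel]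
  · rw [key e2 f2 (by simp [e2]) (by simp [f2]) m2 m4, hA2, hB2]
    change edgeSign R s(g * b, a * g * b) (g * b) * edgeSign R s(g * b, a * g * b) (a * g * b)
      + edgeSign R s(a * g, a * g * b) (a * g * b)
        * edgeSign R s(a * g, a * g * b) (a * g * b) = 0
    rw [edgeSign_mul_self, edgeSign_mul R n6, neg_add_cancel]

variable (P) in
theorem exists_orientation [Fintype G] :
    ∃ o : PosetOrientation R (Face P), ∀ g, o.sign (.vertex g) .empty = 1 := by
  refine ⟨⟨faceSign R, fun _ => faceSign_isUnit R _ _, fun x z hxz hd => ?_⟩, fun _ => rfl⟩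
  change z.dim = x.dim + 2 at hd
  cases x <;> cases z <;> simp only [Face.dim] at hd <;> try omega
  case empty.edgeA e =>
    obtain ⟨e, g, a, ha, rfl⟩ := e
    exact faceSign_sum_edge R _ (A_ne P ⟨a, ha⟩ g) (fun v => Sym2.mem_iff) rfl (fun v => rfl)
  case empty.edgeB e =>
    obtain ⟨e, g, b, hb, rfl⟩ := e
    exact faceSign_sum_edge R _ (B_ne P ⟨b, hb⟩ g) (fun v => Sym2.mem_iff) rfl (fun v => rfl)
  case vertex.square v s => exact faceSign_sum_square R s v hxz

end ExistsOrientation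

/-! ## The sheaf -/

section TensorSheaf

variable {F : Type u} [Field F] (P : CayleyPair G)
  (CA : Submodule F (P.A → F)) (CB : Submodule F (P.B → F))

/-- The spaces of the tensor code sheaf. -/
def tensorObj : Face P → Type u
  | .empty => (⊥ : Submodule F F)
  | .vertex _ => tensorCode CA CB
  | .edgeA _ => CB
  | .edgeB _ => CA
  | .square _ => F

instance : ∀ x, AddCommGroup (tensorObj P CA CB x)
  | .empty => inferInstanceAs (AddCommGroup (⊥ : Submodule F F))
  | .vertex _ => inferInstanceAs (AddCommGroup (tensorCode CA CB))
  | .edgeA _ => inferInstanceAs (AddCommGroup CB)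
  | .edgeB _ => inferInstanceAs (AddCommGroup CA)
  | .square _ => inferInstanceAs (AddCommGroup F)

instance : ∀ x, Module F (tensorObj P CA CB x)
  | .empty => inferInstanceAs (Module F (⊥ : Submodule F F))
  | .vertex _ => inferInstanceAs (Module F (tensorCode CA CB))
  | .edgeA _ => inferInstanceAs (Module F CB)
  | .edgeB _ => inferInstanceAs (Module F CA)
  | .square _ => inferInstanceAs (Module F F)

/-- The restriction maps of the tensor code sheaf: for `v = {g}`, `e = {g, ag}` or `e = {g, gb}`, and
`s = {g, ag, gb, agb}`, the map from `v` to `e` is `r_a` or `c_b`, respectively, the map from `e` to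
`s` takes the `b`-th or `a`-th coordinate, and the map from `v` to `s` takes the `(a, b)`-entry. -/
def tensorRes : ∀ x y : Face P, x < y → tensorObj P CA CB x →ₗ[F] tensorObj P CA CB y
  | .empty, _, _ => 0
  | .vertex _, .edgeA e, h => rowMap CA CB (e.label (Face.lt_iff.1 h).1)
  | .vertex _, .edgeB e, h => colMap CA CB (e.label (Face.lt_iff.1 h).1)
  | .vertex _, .square s, h =>
    entryMap CA CB (s.label (Face.lt_iff.1 h).1).1 (s.label (Face.lt_iff.1 h).1).2
  | .edgeA e, .square s, h => coordMap CB (e.squareLabel s (Face.lt_iff.1 h).1)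
  | .edgeB e, .square s, h => coordMap CA (e.squareLabel s (Face.lt_iff.1 h).1)
  | _, _, _ => 0

theorem tensorRes_comp (x y z : Face P) (hxy : x < y) (hyz : y < z) (t : tensorObj P CA CB x) :
    tensorRes P CA CB y z hyz (tensorRes P CA CB x y hxy t)
      = tensorRes P CA CB x z (hxy.trans hyz) t := by
  have h1 := Face.lt_iff.1 hxy
  have h2 := Face.lt_iff.1 hyz
  have h3 := Face.lt_iff.1 (hxy.trans hyz)
  cases x
  case empty =>
    have h0 : ∀ (w : Face P) (h : Face.empty < w), tensorRes P CA CB Face.empty w h = 0 := by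
      intro w h
      cases w <;> rfl
    rw [h0, h0, LinearMap.zero_apply, LinearMap.zero_apply, map_zero]
  case vertex g =>
    cases y
    case edgeA e =>
      cases z
      case square s =>
        have h := label_of_edgeA e s h2.1 h1.1 h3.1
        change t.1 _ _ = t.1 _ _
        rw [h]
      all_goals exact absurd h2.2 (by simp [Face.dim])
    case edgeB e =>
      cases z
      case square s =>
        have h := label_of_edgeB e s h2.1 h1.1 h3.1
        change t.1 _ _ = t.1 _ _
        rw [h]
      all_goals exact absurd h2.2 (by simp [Face.dim])
    case square s => cases z <;> exact absurd h2.2 (by simp [Face.dim])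
    all_goals exact absurd h1.2 (by simp [Face.dim])
  case edgeA e =>
    cases y
    case square s => cases z <;> exact absurd h2.2 (by simp [Face.dim])
    all_goals exact absurd h1.2 (by simp [Face.dim])
  case edgeB e =>
    cases y
    case square s => cases z <;> exact absurd h2.2 (by simp [Face.dim])
    all_goals exact absurd h1.2 (by simp [Face.dim])
  case square s => cases y <;> exact absurd h1.2 (by simp [Face.dim])

/-- The tensor code sheaf on `Cay(A, G, B)`. -/
def tensorSheaf : PosetSheaf F (Face P) where
  obj := tensorObj P CA CB
  res {x y} h := tensorRes P CA CB x y h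
  res_comp hxy hyz t := tensorRes_comp P CA CB _ _ _ hxy hyz t

end TensorSheaf

/-- The natural weight function of the (two-dimensional) double Cayley complex. -/
def cayleyWeight [Fintype G] (P : CayleyPair G) : Face P → ℝ := natWeight (Face P) 2

end Complex

/-! ## A random access machine

A successor random access machine: a program with finitely many lines operates on registers and
arrays that hold natural numbers. It can load constants, copy, increment and decrement registers,
access an array at an index held by a register, and compare registers; each instruction costs one
unit of time. In particular, a program that runs for `t` steps only ever sees numbers that exceed
the numbers in its input and in its text by at most `t`. -/

namespace RAM

/-- The names of the arrays: `size`, `word`, `nbrA i`, `nbrB j`, `invA`, `invB`, `letter i j` are used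
for the input, `word` also for the output, and the arrays `work k` are free for use. -/
inductive Arr : Type
  | size
  | word
  | nbrA (i : ℕ)
  | nbrB (j : ℕ)
  | invA
  | invB
  | letter (i j : ℕ)
  | work (k : ℕ)

/-- The instructions of a program whose lines are labelled by `L`. -/
inductive Instr (L : Type) : Type
  /-- `r := c` -/
  | const (r c : ℕ) (next : L)
  /-- `r := s` -/
  | copy (r s : ℕ) (next : L)
  /-- `r := r + 1` -/
  | incr (r : ℕ) (next : L)
  /-- `r := r - 1` (truncated at zero) -/
  | decr (r : ℕ) (next : L)
  /-- `r := a[s]` -/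
  | load (r : ℕ) (a : Arr) (s : ℕ) (next : L)
  /-- `a[s] := r` -/
  | store (a : Arr) (s r : ℕ) (next : L)
  /-- if `r < s` go to `yes`, otherwise go to `no` -/
  | ifLt (r s : ℕ) (yes no : L)
  /-- a jump table: if the content of `r` is `c < m`, go to `target c`, otherwise go to `default` -/
  | jump (r m : ℕ) (target : Fin m → L) (default : L)
  /-- stop -/
  | halt

/-- A program: finitely many lines, each of them holding an instruction. -/
structure Program where
  Line : Type
  finite : Finite Line
  start : Line
  code : Line → Instr Line

/-- A configuration: the current line and the contents of the registers and of the arrays. -/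
structure Config (L : Type) where
  line : L
  reg : ℕ → ℕ
  mem : Arr → ℕ → ℕ

open scoped Classical in
/-- Execution of one instruction. -/
def step (P : Program) (c : Config P.Line) : Config P.Line :=
  match P.code c.line with
  | .const r k next => ⟨next, Function.update c.reg r k, c.mem⟩
  | .copy r s next => ⟨next, Function.update c.reg r (c.reg s), c.mem⟩
  | .incr r next => ⟨next, Function.update c.reg r (c.reg r + 1), c.mem⟩
  | .decr r next => ⟨next, Function.update c.reg r (c.reg r - 1), c.mem⟩
  | .load r a s next => ⟨next, Function.update c.reg r (c.mem a (c.reg s)), c.mem⟩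
  | .store a s r next =>
    ⟨next, c.reg, Function.update c.mem a (Function.update (c.mem a) (c.reg s) (c.reg r))⟩
  | .ifLt r s yes no => ⟨if c.reg r < c.reg s then yes else no, c.reg, c.mem⟩
  | .jump r m target default =>
    ⟨if h : c.reg r < m then target ⟨c.reg r, h⟩ else default, c.reg, c.mem⟩
  | .halt => c

/-- Started on arrays with contents `input`, all registers being zero, the program `P` halts after at
most `T` steps with array contents `output`. -/
def HaltsWithin (P : Program) (input : Arr → ℕ → ℕ) (T : ℕ) (output : Arr → ℕ → ℕ) : Prop :=
  ∃ t ≤ T, ∃ c : Config P.Line,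
    (step P)^[t] ⟨P.start, fun _ => 0, input⟩ = c ∧ P.code c.line = .halt ∧ c.mem = output

end RAM

/-- An array with `n` given entries, filled up with zeros. -/
def table {n : ℕ} (t : Fin n → ℕ) (k : ℕ) : ℕ := if h : k < n then t ⟨k, h⟩ else 0

section Encoding

variable {G F : Type u} [Group G] [Fintype G] [Field F] [Fintype F] (P : CayleyPair G)
  (CA : Submodule F (P.A → F)) (CB : Submodule F (P.B → F))

/-- A word `f ∈ Σ^G`, `Σ = C_A ⊗ C_B`, read off from a `0`-cochain of the tensor code sheaf. -/
def letterAt (f : Cochain (tensorSheaf P CA CB) 0) (g : G) : tensorCode CA CB :=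
  f ⟨Face.vertex g, rfl⟩

/-- Numberings of the group elements, of `A` and `B`, of the field elements and of the alphabet. -/
structure Numbering where
  group : G ≃ Fin (Fintype.card G)
  setA : P.A ≃ Fin P.A.card
  setB : P.B ≃ Fin P.B.card
  field : F ≃ Fin (Fintype.card F)
  letter : tensorCode CA CB ≃ Fin (Nat.card (tensorCode CA CB))

/-- The input of a machine, relative to a numbering: the number of group elements and the number of
letters, the adjacency tables `v ↦ a_i v` and `v ↦ v b_j` of the complex, the tables of inverses in
`A` and in `B`, the matrix entries of the letters, and a word. -/
def inputOf (N : Numbering P CA CB) (f : Cochain (tensorSheaf P CA CB) 0) :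
    RAM.Arr → ℕ → ℕ
  | .size => fun k =>
      if k = 0 then Fintype.card G else if k = 1 then Nat.card (tensorCode CA CB) else 0
  | .word => table fun v => N.letter (letterAt P CA CB f (N.group.symm v))
  | .nbrA i => table fun v =>
      if hi : i < P.A.card then N.group (N.setA.symm ⟨i, hi⟩ * N.group.symm v) else 0
  | .nbrB j => table fun v =>
      if hj : j < P.B.card then N.group (N.group.symm v * N.setB.symm ⟨j, hj⟩) else 0
  | .invA => table fun i =>
      N.setA ⟨(N.setA.symm i : G)⁻¹, P.inv_mem_A _ (N.setA.symm i).2⟩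
  | .invB => table fun j =>
      N.setB ⟨(N.setB.symm j : G)⁻¹, P.inv_mem_B _ (N.setB.symm j).2⟩
  | .letter i j => table fun c =>
      if h : i < P.A.card ∧ j < P.B.card then
        N.field ((N.letter.symm c).1 (N.setA.symm ⟨i, h.1⟩) (N.setB.symm ⟨j, h.2⟩)) else 0
  | .work _ => fun _ => 0

/-- The machine `M` carries out the correction algorithm with parameter `q` in at most `T` steps: for
every numbering of the data and every word `f`, started on the tables of the complex and of the
alphabet and on `f`, it halts within `T` steps, and the array `word` then holds a word `f'` which the
correction algorithm can return on input `f`. -/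
def RunsCorrection (M : RAM.Program) (T : ℕ) (o : PosetOrientation F (Face P)) (q : ℝ) : Prop :=
  ∀ (N : Numbering P CA CB) (f : Cochain (tensorSheaf P CA CB) 0),
    ∃ (f' : Cochain (tensorSheaf P CA CB) 0) (output : RAM.Arr → ℕ → ℕ),
      CorrectionReturns (cayleyWeight P) o (tensorSheaf P CA CB) 0 q f f' ∧
      RAM.HaltsWithin M (inputOf P CA CB N f) T output ∧
      ∀ g, output .word (N.group g) = N.letter (letterAt P CA CB f' g)

end Encoding

end SheafCode

end

open SheafCode

noncomputable section

namespace SheafCode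

open scoped Classical

/-! ## Graphs given by an inverse-closed family of moves -/

/-- A family of moves `v ↦ move i v` without fixed points, closed under taking inverses. -/
structure Steps (V I : Type*) where
  move : I → V → V
  rev : I → I
  rev_rev : ∀ i, rev (rev i) = i
  move_rev : ∀ i v, move (rev i) (move i v) = v
  move_ne : ∀ i v, move i v ≠ v

namespace Steps

variable {V I : Type*} (S : Steps V I)

theorem move_rev' (i : I) (v : V) : S.move i (S.move (S.rev i) v) = v := by
  have := S.move_rev (S.rev i) v
  rwa [S.rev_rev] at this

/-- The reversal of a pair `(v, i)`, thought of as a directed edge. -/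
def flip : V × I ≃ V × I where
  toFun x := (S.move x.2 x.1, S.rev x.2)
  invFun x := (S.move x.2 x.1, S.rev x.2)
  left_inv x := by simp [S.move_rev, S.rev_rev]
  right_inv x := by simp [S.move_rev, S.rev_rev]

/-- A move as a permutation. -/
def perm (i : I) : V ≃ V where
  toFun := S.move i
  invFun := S.move (S.rev i)
  left_inv := S.move_rev i
  right_inv := S.move_rev' i

variable [Fintype V]

theorem sum_move {M : Type*} [AddCommMonoid M] (i : I) (φ : V → M) :
    ∑ v, φ (S.move i v) = ∑ v, φ v :=
  Equiv.sum_comp (S.perm i) φ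

variable [Fintype I]

theorem sum_flip {M : Type*} [AddCommMonoid M] (φ : V → I → M) :
    ∑ v, ∑ i, φ (S.move i v) (S.rev i) = ∑ v, ∑ i, φ v i := by
  rw [← Fintype.sum_prod_type', ← Fintype.sum_prod_type']
  exact Equiv.sum_comp S.flip (fun x => φ x.1 x.2)

theorem sum_sum_move {M : Type*} [AddCommMonoid M] (φ : V → M) :
    ∑ v, ∑ i, φ (S.move i v) = ∑ _i : I, ∑ v, φ v := by
  rw [Finset.sum_comm]
  exact Finset.sum_congr rfl fun i _ => S.sum_move i φ

/-- The effect of changing an assignment at one vertex on the number of violated edges. -/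
theorem sum_update {A : Type*} {R : I → A → A → Prop} (hR : ∀ i x y, R i x y ↔ R (S.rev i) y x)
    (f : V → A) (u : V) (m : A) :
    (∑ v, ∑ i, if R i (Function.update f u m v) (Function.update f u m (S.move i v))
        then (1 : ℝ) else 0)
      = (∑ v, ∑ i, if R i (f v) (f (S.move i v)) then (1 : ℝ) else 0)
        + 2 * ((∑ i, if R i m (f (S.move i u)) then (1 : ℝ) else 0)
          - ∑ i, if R i (f u) (f (S.move i u)) then (1 : ℝ) else 0) := by
  set Δ : I → ℝ := fun i => (if R i m (f (S.move i u)) then (1 : ℝ) else 0)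
    - if R i (f u) (f (S.move i u)) then (1 : ℝ) else 0 with hΔ
  have key : ∀ v i, (if R i (Function.update f u m v) (Function.update f u m (S.move i v))
        then (1 : ℝ) else 0)
      = (if R i (f v) (f (S.move i v)) then (1 : ℝ) else 0)
        + ((if v = u then Δ i else 0) + if S.move i v = u then Δ (S.rev i) else 0) := by
    intro v i
    by_cases h1 : v = u
    · subst h1
      have h2 := S.move_ne i v
      simp [hΔ, h2]
    · by_cases h2 : S.move i v = u
      · have h3 : S.move (S.rev i) u = v := by rw [← h2, S.move_rev]
        simp only [h1, h2, hΔ, h3, if_true, if_false, Function.update_self, ne_eq,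
          not_false_eq_true, Function.update_of_ne]
        rw [hR i, hR i (f v)]
        ring
      · simp [h1, h2]
  simp only [key, Finset.sum_add_distrib]
  have e1 : (∑ v, ∑ i, if v = u then Δ i else 0) = ∑ i, Δ i := by
    rw [Finset.sum_comm]; simp
  have e2 : (∑ v, ∑ i, if S.move i v = u then Δ (S.rev i) else 0) = ∑ i, Δ i := by
    rw [← e1]
    exact S.sum_flip (fun v i => if v = u then Δ i else 0)
  rw [e1, e2, hΔ, Finset.sum_sub_distrib]
  ring

variable {Γ : SimpleGraph V}

theorem degree_eq (hadj : ∀ u v, Γ.Adj u v ↔ ∃ i, v = S.move i u)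
    (hinj : ∀ v, Function.Injective fun i => S.move i v) (v : V) :
    Γ.degree v = Fintype.card I := by
  rw [← SimpleGraph.card_neighborFinset_eq_degree, ← Finset.card_univ,
    ← Finset.card_image_of_injective _ (hinj v)]
  congr 1
  ext w
  simp [hadj, eq_comm]

theorem card_edgeSet (hadj : ∀ u v, Γ.Adj u v ↔ ∃ i, v = S.move i u)
    (hinj : ∀ v, Function.Injective fun i => S.move i v) :
    2 * Nat.card Γ.edgeSet = Fintype.card V * Fintype.card I := by
  have := Γ.sum_degrees_eq_twice_card_edges
  simp only [S.degree_eq hadj hinj, Finset.sum_const, Finset.card_univ, smul_eq_mul] at this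
  rw [this, Nat.card_eq_fintype_card, SimpleGraph.edgeFinset_card]

theorem natVertexWeight_eq (hadj : ∀ u v, Γ.Adj u v ↔ ∃ i, v = S.move i u)
    (hinj : ∀ v, Function.Injective fun i => S.move i v) [Nonempty I] (v : V) :
    natVertexWeight Γ v = 1 / Fintype.card V := by
  have h1 : Nat.card {e : Γ.edgeSet // v ∈ e.1} = Fintype.card I := by
    rw [← S.degree_eq hadj hinj v, ← SimpleGraph.card_incidenceSet_eq_degree,
      ← Nat.card_eq_fintype_card]
    exact Nat.card_congr ⟨fun e => ⟨e.1.1, e.1.2, e.2⟩, fun e => ⟨⟨e.1, e.2.1⟩, e.2.2⟩,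
      fun _ => rfl, fun _ => rfl⟩
  have h2 : (2 * Nat.card Γ.edgeSet : ℝ) = Fintype.card V * Fintype.card I := by
    exact_mod_cast S.card_edgeSet hadj hinj
  have hI : (Fintype.card I : ℝ) ≠ 0 := by exact_mod_cast Fintype.card_ne_zero
  have : Nonempty V := ⟨v⟩
  have hV : (Fintype.card V : ℝ) ≠ 0 := by exact_mod_cast Fintype.card_ne_zero
  rw [natVertexWeight, h1, h2]
  field_simp

theorem adjOp_eq (hadj : ∀ u v, Γ.Adj u v ↔ ∃ i, v = S.move i u)
    (hinj : ∀ v, Function.Injective fun i => S.move i v) [Nonempty I] (f : V → ℝ) (v : V) :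
    adjOp Γ f v = (1 / Fintype.card I) * ∑ i, f (S.move i v) := by
  have h2 : (2 * Nat.card Γ.edgeSet : ℝ) = Fintype.card V * Fintype.card I := by
    exact_mod_cast S.card_edgeSet hadj hinj
  have hI : (Fintype.card I : ℝ) ≠ 0 := by exact_mod_cast Fintype.card_ne_zero
  have : Nonempty V := ⟨v⟩
  have hV : (Fintype.card V : ℝ) ≠ 0 := by exact_mod_cast Fintype.card_ne_zero
  have hE : (Nat.card Γ.edgeSet : ℝ) ≠ 0 := by
    intro h
    rw [h, mul_zero] at h2
    exact mul_ne_zero hV hI h2.symm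
  have h3 : natEdgeWeight Γ / (2 * natVertexWeight Γ v) = 1 / Fintype.card I := by
    rw [S.natVertexWeight_eq hadj hinj, natEdgeWeight]
    field_simp
    linarith
  rw [adjOp, h3, Finset.mul_sum]
  simp only [hadj]
  rw [← Finset.sum_filter]
  refine (Finset.sum_nbij (fun i => S.move i v) ?_ ?_ ?_ ?_).symm
  · intro i _; simpa using ⟨i, rfl⟩
  · intro i _ j _ h; exact hinj v h
  · intro w hw
    obtain ⟨i, rfl⟩ := (Finset.mem_filter.1 (Finset.mem_coe.1 hw)).2
    exact ⟨i, by simp, rfl⟩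
  · intro i _; rfl

/-- The quadratic form of the adjacency operator of an expander. -/
theorem sum_mul_sum_le (hadj : ∀ u v, Γ.Adj u v ↔ ∃ i, v = S.move i u)
    (hinj : ∀ v, Function.Injective fun i => S.move i v) {lam : ℝ} (hlam : 0 ≤ lam)
    (hexp : IsExpander Γ lam) (h : V → ℝ) :
    ∑ v, h v * ∑ i, h (S.move i v)
      ≤ Fintype.card I * (lam * ∑ v, h v ^ 2 + (∑ v, h v) ^ 2 / Fintype.card V) := by
  rcases isEmpty_or_nonempty I with hI0 | hI0
  · simp
  rcases isEmpty_or_nonempty V with hV0 | hV0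
  · simp
  have hI : (0 : ℝ) < Fintype.card I := by exact_mod_cast Fintype.card_pos
  have hV : (0 : ℝ) < Fintype.card V := by exact_mod_cast Fintype.card_pos
  set d : ℝ := (Fintype.card I : ℝ)
  set n : ℝ := (Fintype.card V : ℝ)
  let N : Matrix V V ℝ := fun u v =>
    (if u = v then lam else 0) - (1 / d) * (∑ i, if S.move i u = v then 1 else 0) + 1 / n
  have hmul : ∀ (f : V → ℝ) (u : V),
      (N.mulVec f) u = lam * f u - (1 / d) * ∑ i, f (S.move i u) + (∑ v, f v) / n := by
    intro f u
    have e : ∑ v, (∑ i, if S.move i u = v then (1 : ℝ) else 0) * f v = ∑ i, f (S.move i u) := by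
      simp only [Finset.sum_mul]
      rw [Finset.sum_comm]
      simp
    simp only [Matrix.mulVec, dotProduct, N, add_mul, sub_mul, Finset.sum_add_distrib,
      Finset.sum_sub_distrib, mul_assoc, ← Finset.mul_sum]
    rw [e]
    simp
    ring
  have hsymm : N.IsHermitian := by
    ext u v
    have e : ∑ i, (if S.move i v = u then (1 : ℝ) else 0)
        = ∑ i, if S.move i u = v then (1 : ℝ) else 0 := by
      refine Fintype.sum_equiv ⟨S.rev, S.rev, S.rev_rev, S.rev_rev⟩ _ _ fun i => ?_
      refine if_congr ⟨?_, ?_⟩ rfl rfl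
      · rintro rfl; exact S.move_rev i v
      · rintro rfl; exact S.move_rev' i u
    change star (N v u) = N u v
    simp only [N, star_trivial]
    rw [e]
    simp only [eq_comm (a := v) (b := u)]
  have hpsd : N.PosSemidef := by
    rw [hsymm.posSemidef_iff_eigenvalues_nonneg]
    intro k
    by_contra hk
    have hk : hsymm.eigenvalues k < 0 := not_le.1 hk
    set ν := hsymm.eigenvalues k
    set x : V → ℝ := ⇑(hsymm.eigenvectorBasis k)
    have hx : N.mulVec x = ν • x := hsymm.mulVec_eigenvectorBasis k
    have hx0 : x ≠ 0 := by
      intro h0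
      have h1 := hsymm.eigenvectorBasis.orthonormal.ne_zero k
      exact h1 (by ext v; exact congrFun h0 v)
    have hpt : ∀ u, lam * x u - (1 / d) * ∑ i, x (S.move i u) + (∑ v, x v) / n = ν * x u := by
      intro u
      rw [← hmul, hx]; rfl
    have hsum : ∑ v, x v = 0 := by
      have := Finset.sum_congr (rfl : (Finset.univ : Finset V) = Finset.univ) fun u _ => hpt u
      simp only [Finset.sum_add_distrib, Finset.sum_sub_distrib, ← Finset.mul_sum,
        S.sum_sum_move x, Finset.sum_const, Finset.card_univ, nsmul_eq_mul] at this
      change lam * ∑ v, x v - 1 / d * (d * ∑ v, x v) + n * ((∑ v, x v) / n) = ν * ∑ v, x v at this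
      have e1 : 1 / d * (d * ∑ v, x v) = ∑ v, x v := by field_simp
      have e2 : n * ((∑ v, x v) / n) = ∑ v, x v := by field_simp
      rw [e1, e2] at this
      have h3 : (lam - ν) * ∑ v, x v = 0 := by linarith
      rcases mul_eq_zero.1 h3 with h3 | h3
      · linarith
      · exact h3
    have := hexp (lam - ν) x hx0 (by
        simp only [S.natVertexWeight_eq hadj hinj, ← Finset.mul_sum, hsum, mul_zero]) (by
        intro v
        rw [S.adjOp_eq hadj hinj]
        have := hpt v
        rw [hsum, zero_div] at this
        linarith)
    linarith [this.2]
  have hq := hpsd.dotProduct_mulVec_nonneg h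
  simp only [dotProduct, hmul, star_trivial, Pi.star_apply] at hq
  have e : ∑ u, h u * (lam * h u - (1 / d) * ∑ i, h (S.move i u) + (∑ v, h v) / n)
      = lam * ∑ u, h u ^ 2 - (1 / d) * (∑ u, h u * ∑ i, h (S.move i u)) + (∑ v, h v) ^ 2 / n := by
    simp only [mul_add, mul_sub, Finset.sum_add_distrib, Finset.sum_sub_distrib, Finset.mul_sum,
      ← Finset.sum_mul]
    congr 1
    · congr 1
      · exact Finset.sum_congr rfl fun _ _ => by ring
      · exact Finset.sum_congr rfl fun _ _ => Finset.sum_congr rfl fun _ _ => by ring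
    · ring
  rw [e] at hq
  have h4 : (1 / d) * (∑ u, h u * ∑ i, h (S.move i u))
      ≤ lam * ∑ u, h u ^ 2 + (∑ v, h v) ^ 2 / n := by linarith
  calc _ = d * ((1 / d) * (∑ u, h u * ∑ i, h (S.move i u))) := by field_simp
    _ ≤ _ := by gcongr

end Steps

/-! ## Small violations of a locally minimal assignment -/

theorem eq_zero_of_expansion_bounds {ε t X Q R : ℝ} (hε₀ : 0 < ε) (hε₁ : ε ≤ 1) (hX : 0 ≤ X)
    (hQ : 0 ≤ Q) (ht : t * 250000 ≤ 4 * ε ^ 3) (hR : 0.99 * ε * X ≤ 4 * R) (hRQ : 4 * R ≤ Q)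
    (hmain : Q ≤ 2 / ε * (2 * (ε ^ 2 / 2500 * Q + t * X)) + ε / 100 * X) : X = 0 := by
  have e1 : 2 / ε * (2 * (ε ^ 2 / 2500 * Q + t * X)) = 4 / 2500 * ε * Q + 4 * t / ε * X := by
    field_simp
    ring
  have h6 : 4 * t / ε ≤ 0.01 * ε := by
    rw [div_le_iff₀ hε₀]
    have : ε ^ 3 ≤ ε ^ 2 := pow_le_pow_of_le_one hε₀.le hε₁ (by norm_num)
    have : 0 ≤ ε ^ 2 := sq_nonneg ε
    linarith [sq ε, mul_assoc 0.01 ε ε]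
  have h7 : 4 / 2500 * ε ≤ 0.01 := by linarith
  have h8 : 4 / 2500 * ε * Q ≤ 0.01 * Q := mul_le_mul_of_nonneg_right h7 hQ
  have h9 : 4 * t / ε * X ≤ 0.01 * ε * X := mul_le_mul_of_nonneg_right h6 hX
  rw [e1] at hmain
  have h10 : 0 ≤ ε * X := by positivity
  have h11 : ε * X ≤ 0 := by linarith
  exact (mul_eq_zero.1 (le_antisymm h11 h10)).resolve_left hε₀.ne'

namespace Steps

section RowBad

variable {V I J F : Type*} (S : Steps V I) (T : Steps V J)

/-- The local views of the matrices `e v` at the two ends of the edge `(v, i)` differ. -/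
def RowBad (e : V → I → J → F) (v : V) (i : I) : Prop :=
  ∃ j, e v i j ≠ e (S.move i v) (S.rev i) j

theorem rowBad_flip (e : V → I → J → F) (v : V) (i : I) :
    S.RowBad e (S.move i v) (S.rev i) ↔ S.RowBad e v i := by
  simp only [RowBad, S.move_rev, S.rev_rev]
  exact exists_congr fun j => ne_comm

/-- The indicator function of the violated edges. -/
def badInd (e : V → I → J → F) (v : V) (i : I) : ℝ := if S.RowBad e v i then 1 else 0

theorem badInd_nonneg (e : V → I → J → F) (v : V) (i : I) : 0 ≤ S.badInd e v i := by
  unfold badInd; split_ifs <;> norm_num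

theorem badInd_sq (e : V → I → J → F) (v : V) (i : I) : S.badInd e v i ^ 2 = S.badInd e v i := by
  unfold badInd; split_ifs <;> norm_num

theorem badInd_flip (e : V → I → J → F) (v : V) (i : I) :
    S.badInd e (S.move i v) (S.rev i) = S.badInd e v i := by
  simp only [badInd, S.rowBad_flip]

/-- The fractions of violated edges at a vertex, in the first direction. -/
def badFrac [Fintype I] (e : V → I → J → F) (v : V) : ℝ := (∑ i, S.badInd e v i) / Fintype.card I

theorem badFrac_nonneg [Fintype I] (e : V → I → J → F) (v : V) : 0 ≤ S.badFrac e v :=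
  div_nonneg (Finset.sum_nonneg fun i _ => S.badInd_nonneg e v i) (Nat.cast_nonneg _)

theorem one_le_of_ne (hcomm : ∀ i j v, S.move i (T.move j v) = T.move j (S.move i v))
    {e : V → I → J → F} {v : V} {i : I} {j : J} (h : e v i j ≠ e (S.move i v) (S.rev i) j) :
    1 ≤ T.badInd (fun v j i => e v i j) v j + T.badInd (fun v j i => e v i j) (S.move i v) j
      + S.badInd e (T.move j v) i := by
  have h1 := T.badInd_nonneg (fun v j i => e v i j) v j
  have h2 := T.badInd_nonneg (fun v j i => e v i j) (S.move i v) j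
  have h3 := S.badInd_nonneg e (T.move j v) i
  by_contra hlt
  have key : ¬ T.RowBad (fun v j i => e v i j) v j ∧
      ¬ T.RowBad (fun v j i => e v i j) (S.move i v) j ∧ ¬ S.RowBad e (T.move j v) i := by
    refine ⟨fun hb => hlt ?_, fun hb => hlt ?_, fun hb => hlt ?_⟩ <;>
      simp only [badInd, hb, if_true] at h1 h2 h3 ⊢ <;> linarith
  simp only [RowBad, not_exists, not_not] at key
  exact h ((key.1 i).trans ((key.2.2 _).trans ((by rw [hcomm]; exact (key.2.1 _).symm))))

variable [Fintype V] [Fintype I] [Fintype J]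

/-- If violated edges have many nonzero coordinates, then most squares containing a violated edge
have another violated edge, and rarely the opposite one. -/
theorem badInd_sum_le (hcomm : ∀ i j v, S.move i (T.move j v) = T.move j (S.move i v))
    {e : V → I → J → F} {ε lam : ℝ}
    (hD : ∀ v i, S.RowBad e v i → ε * Fintype.card J
      ≤ ∑ j, if e v i j ≠ e (S.move i v) (S.rev i) j then (1 : ℝ) else 0)
    (hT : ∀ h : V → ℝ, ∑ v, h v * ∑ j, h (T.move j v)
      ≤ Fintype.card J * (lam * ∑ v, h v ^ 2 + (∑ v, h v) ^ 2 / Fintype.card V)) :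
    (ε - lam - (∑ v, ∑ i, S.badInd e v i) / Fintype.card V) * Fintype.card J
        * ∑ v, ∑ i, S.badInd e v i
      ≤ 2 * ∑ v, (∑ i, S.badInd e v i) * ∑ j, T.badInd (fun v j i => e v i j) v j := by
  set r := S.badInd e with hr
  set c := T.badInd (fun v j i => e v i j) with hc
  have r0 : ∀ v i, 0 ≤ r v i := S.badInd_nonneg e
  have pt : ∀ v i, ε * Fintype.card J * r v i
      ≤ r v i * ∑ j, c v j + r v i * ∑ j, c (S.move i v) j + r v i * ∑ j, r (T.move j v) i := by
    intro v i
    by_cases hb : S.RowBad e v i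
    · have h1 : r v i = 1 := by simp [hr, badInd, hb]
      rw [h1, mul_one, one_mul, one_mul, one_mul, ← Finset.sum_add_distrib,
        ← Finset.sum_add_distrib]
      refine (hD v i hb).trans (Finset.sum_le_sum fun j _ => ?_)
      split_ifs with hne
      · exact S.one_le_of_ne T hcomm hne
      · have h1 := T.badInd_nonneg (fun v j i => e v i j) v j
        have h2 := T.badInd_nonneg (fun v j i => e v i j) (S.move i v) j
        have h3 := S.badInd_nonneg e (T.move j v) i
        linarith
    · have h1 : r v i = 0 := by simp [hr, badInd, hb]
      simp [h1]
  have h2 : ∑ v, ∑ i, r v i * ∑ j, c (S.move i v) j = ∑ v, ∑ i, r v i * ∑ j, c v j := by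
    rw [← S.sum_flip (fun v i => r v i * ∑ j, c v j)]
    refine Finset.sum_congr rfl fun v _ => Finset.sum_congr rfl fun i _ => ?_
    rw [hr, S.badInd_flip]
  set N := ∑ v, ∑ i, r v i with hN
  have hN' : N = ∑ i, ∑ v, r v i := Finset.sum_comm
  have N0 : 0 ≤ N := Finset.sum_nonneg fun v _ => Finset.sum_nonneg fun i _ => r0 v i
  have h3 : ∑ v, ∑ i, r v i * ∑ j, r (T.move j v) i
      ≤ Fintype.card J * (lam * N + N * N / Fintype.card V) := by
    rw [Finset.sum_comm]
    calc ∑ i, ∑ v, r v i * ∑ j, r (T.move j v) i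
        ≤ ∑ i, (Fintype.card J : ℝ)
          * (lam * ∑ v, r v i ^ 2 + (∑ v, r v i) ^ 2 / Fintype.card V) :=
        Finset.sum_le_sum fun i _ => hT fun v => r v i
      _ ≤ ∑ i, (Fintype.card J : ℝ)
          * (lam * ∑ v, r v i + (∑ v, r v i) * N / Fintype.card V) := by
        refine Finset.sum_le_sum fun i _ => ?_
        have hs : ∑ v, r v i ≤ N := by
          rw [hN']
          exact Finset.single_le_sum (f := fun i => ∑ v, r v i)
            (fun i _ => Finset.sum_nonneg fun v _ => r0 v i) (Finset.mem_univ i)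
        have hs0 : 0 ≤ ∑ v, r v i := Finset.sum_nonneg fun v _ => r0 v i
        have hsq : ∑ v, r v i ^ 2 = ∑ v, r v i :=
          Finset.sum_congr rfl fun v _ => S.badInd_sq e v i
        rw [hsq, sq]
        gcongr
      _ = _ := by
        rw [← Finset.mul_sum, Finset.sum_add_distrib, ← Finset.mul_sum, ← Finset.sum_div,
          ← Finset.sum_mul, ← hN']
  have h4 : ∑ v, ∑ i, ε * Fintype.card J * r v i = ε * Fintype.card J * N := by
    simp only [← Finset.mul_sum, hN]
  have h5 := Finset.sum_le_sum fun v (_ : v ∈ Finset.univ) =>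
    Finset.sum_le_sum fun i (_ : i ∈ (Finset.univ : Finset I)) => pt v i
  simp only [Finset.sum_add_distrib] at h5
  rw [h4, h2] at h5
  have h6 : ∑ v, ∑ i, r v i * ∑ j, c v j = ∑ v, (∑ i, r v i) * ∑ j, c v j :=
    Finset.sum_congr rfl fun v _ => (Finset.sum_mul _ _ _).symm
  rw [h6] at h5
  have h7 : (ε - lam - N / Fintype.card V) * Fintype.card J * N
      = ε * Fintype.card J * N - Fintype.card J * (lam * N + N * N / Fintype.card V) := by ring
  rw [h7]
  linarith

theorem sum_mul_badFrac_le [Nonempty I]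
    {lam : ℝ} (hS : ∀ h : V → ℝ, ∑ v, h v * ∑ i, h (S.move i v)
      ≤ Fintype.card I * (lam * ∑ v, h v ^ 2 + (∑ v, h v) ^ 2 / Fintype.card V))
    {x y : V → ℝ} (hy : ∀ v, y v ≤ x v) (hx : ∀ v, 0 ≤ x v) :
    ∑ v, x v * ((∑ i, y (S.move i v)) / Fintype.card I)
      ≤ lam * ∑ v, x v ^ 2 + (∑ v, x v) ^ 2 / Fintype.card V := by
  have hI : (0 : ℝ) < Fintype.card I := by exact_mod_cast Fintype.card_pos
  calc ∑ v, x v * ((∑ i, y (S.move i v)) / Fintype.card I)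
      ≤ ∑ v, x v * ((∑ i, x (S.move i v)) / Fintype.card I) := by
        refine Finset.sum_le_sum fun v _ => mul_le_mul_of_nonneg_left ?_ (hx v)
        gcongr
        exact hy _
    _ = (∑ v, x v * ∑ i, x (S.move i v)) / Fintype.card I := by
        rw [Finset.sum_div]
        exact Finset.sum_congr rfl fun v _ => (mul_div_assoc _ _ _).symm
    _ ≤ _ := by
        rw [div_le_iff₀ hI, mul_comm]
        exact hS x

/-- A locally minimal assignment with few violated edges has no violated edges. -/
theorem sum_badFrac_eq_zero [Nonempty I] [Nonempty J] [Nonempty V]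
    (hcomm : ∀ i j v, S.move i (T.move j v) = T.move j (S.move i v))
    {e : V → I → J → F} {ε D : ℝ} (hε₀ : 0 < ε) (hε₁ : ε ≤ 1)
    (hDI : (Fintype.card I : ℝ) ≤ D) (hDJ : (Fintype.card J : ℝ) ≤ D)
    (hrow : ∀ v i, S.RowBad e v i → ε * Fintype.card J
      ≤ ∑ j, if e v i j ≠ e (S.move i v) (S.rev i) j then (1 : ℝ) else 0)
    (hcol : ∀ v j, T.RowBad (fun v j i => e v i j) v j → ε * Fintype.card I
      ≤ ∑ i, if e v i j ≠ e (T.move j v) i (T.rev j) then (1 : ℝ) else 0)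
    (hS : ∀ h : V → ℝ, ∑ v, h v * ∑ i, h (S.move i v)
      ≤ Fintype.card I * (ε ^ 2 / 2500 * ∑ v, h v ^ 2 + (∑ v, h v) ^ 2 / Fintype.card V))
    (hT : ∀ h : V → ℝ, ∑ v, h v * ∑ j, h (T.move j v)
      ≤ Fintype.card J * (ε ^ 2 / 2500 * ∑ v, h v ^ 2 + (∑ v, h v) ^ 2 / Fintype.card V))
    (hloc : ∀ v, S.badFrac e v + T.badFrac (fun v j i => e v i j) v
      ≤ 2 / ε * ((∑ i, T.badFrac (fun v j i => e v i j) (S.move i v)) / Fintype.card I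
        + (∑ j, S.badFrac e (T.move j v)) / Fintype.card J) + ε / 100)
    (hsmall : (∑ v, (S.badFrac e v + T.badFrac (fun v j i => e v i j) v)) / Fintype.card V
      < 4 * (1 / (250000 * ε⁻¹ ^ 3 + 4800 * D * ε⁻¹))) :
    ∑ v, (S.badFrac e v + T.badFrac (fun v j i => e v i j) v) = 0 := by
  set a := S.badFrac e with ha
  set b := T.badFrac (fun v j i => e v i j) with hb
  set x := fun v => a v + b v with hx
  have hI : (0 : ℝ) < Fintype.card I := by exact_mod_cast Fintype.card_pos
  have hJ : (0 : ℝ) < Fintype.card J := by exact_mod_cast Fintype.card_pos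
  have hV : (0 : ℝ) < Fintype.card V := by exact_mod_cast Fintype.card_pos
  set n : ℝ := (Fintype.card V : ℝ)
  set p : ℝ := (Fintype.card I : ℝ)
  set r : ℝ := (Fintype.card J : ℝ)
  have a0 : ∀ v, 0 ≤ a v := S.badFrac_nonneg e
  have b0 : ∀ v, 0 ≤ b v := T.badFrac_nonneg _
  have x0 : ∀ v, 0 ≤ x v := fun v => add_nonneg (a0 v) (b0 v)
  change (∑ v, x v) / n < _ at hsmall
  change ∑ v, x v = 0
  set X := ∑ v, x v with hX
  set Q := ∑ v, x v ^ 2 with hQ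
  set lam := ε ^ 2 / 2500 with hlam
  have hA := S.badInd_sum_le T hcomm hrow hT
  have hB := T.badInd_sum_le S (fun j i v => (hcomm i j v).symm) hcol hS
  have ea : ∀ v, ∑ i, S.badInd e v i = p * a v := fun v => by
    rw [ha, badFrac, mul_div_cancel₀ _ hI.ne']
  have eb : ∀ v, ∑ j, T.badInd (fun v j i => e v i j) v j = r * b v := fun v => by
    rw [hb, badFrac, mul_div_cancel₀ _ hJ.ne']
  simp only [ea, eb, ← Finset.mul_sum] at hA hB
  set Y := ∑ v, a v with hY
  set Z := ∑ v, b v with hZ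
  have Y0 : 0 ≤ Y := Finset.sum_nonneg fun v _ => a0 v
  have Z0 : 0 ≤ Z := Finset.sum_nonneg fun v _ => b0 v
  have hXYZ : X = Y + Z := Finset.sum_add_distrib
  set R := ∑ v, a v * b v with hR
  have eR : ∑ v, p * a v * (r * b v) = p * r * R := by
    rw [hR, Finset.mul_sum]; exact Finset.sum_congr rfl fun v _ => by ring
  have eR' : ∑ v, r * b v * (p * a v) = p * r * R := by
    rw [hR, Finset.mul_sum]; exact Finset.sum_congr rfl fun v _ => by ring
  rw [eR] at hA
  rw [eR'] at hB
  have hA' : (ε - lam - p * Y / n) * Y ≤ 2 * R := by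
    have : (p * r) * ((ε - lam - p * Y / n) * Y) ≤ (p * r) * (2 * R) := by linarith
    exact le_of_mul_le_mul_left this (by positivity)
  have hB' : (ε - lam - r * Z / n) * Z ≤ 2 * R := by
    have : (p * r) * ((ε - lam - r * Z / n) * Z) ≤ (p * r) * (2 * R) := by linarith
    exact le_of_mul_le_mul_left this (by positivity)
  set t := X / n with ht
  have t0 : 0 ≤ t := div_nonneg (by rw [hXYZ]; positivity) hV.le
  have hD0 : 0 < D := hI.trans_le hDI
  have hpY : p * Y / n ≤ D * t := by
    rw [ht, mul_div_assoc]
    have : Y ≤ X := by linarith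
    gcongr
  have hrZ : r * Z / n ≤ D * t := by
    rw [ht, mul_div_assoc]
    have : Z ≤ X := by linarith
    gcongr
  have hden : t * (250000 * ε⁻¹ ^ 3 + 4800 * D * ε⁻¹) < 4 := by
    have hpos : 0 < 250000 * ε⁻¹ ^ 3 + 4800 * D * ε⁻¹ := by positivity
    rw [mul_one_div, lt_div_iff₀ hpos] at hsmall
    exact hsmall
  have ht1 : t * 250000 ≤ 4 * ε ^ 3 := by
    have h1 : t * (250000 * ε⁻¹ ^ 3) ≤ 4 := by
      have : 0 ≤ t * (4800 * D * ε⁻¹) := by positivity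
      linarith
    calc t * 250000 = t * (250000 * ε⁻¹ ^ 3) * ε ^ 3 := by field_simp
      _ ≤ 4 * ε ^ 3 := by gcongr
  have ht2 : D * t * 1200 ≤ ε := by
    have h1 : t * (4800 * D * ε⁻¹) ≤ 4 := by
      have : 0 ≤ t * (250000 * ε⁻¹ ^ 3) := by positivity
      linarith
    have : D * t * 1200 = t * (4800 * D * ε⁻¹) * ε / 4 := by field_simp; ring
    rw [this]
    have : t * (4800 * D * ε⁻¹) * ε ≤ 4 * ε := by gcongr
    linarith
  have hlamε : lam ≤ ε / 2500 := by
    rw [hlam]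
    have : ε ^ 2 ≤ ε := by nlinarith
    linarith
  have hR4 : 0.99 * ε * X ≤ 4 * R := by
    have h1 : 0.99 * ε * Y ≤ 2 * R := by
      refine le_trans ?_ hA'
      gcongr
      linarith
    have h2 : 0.99 * ε * Z ≤ 2 * R := by
      refine le_trans ?_ hB'
      gcongr
      linarith
    rw [hXYZ]; linarith
  have hQR : 4 * R ≤ Q := by
    rw [hQ, hR, Finset.mul_sum]
    refine Finset.sum_le_sum fun v _ => ?_
    simp only [hx]
    nlinarith [sq_nonneg (a v - b v)]
  have hQ0 : 0 ≤ Q := Finset.sum_nonneg fun v _ => sq_nonneg _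
  have h1 := S.sum_mul_badFrac_le hS (x := x) (y := b)
    (fun v => by simpa [hx] using a0 v) x0
  have h2 := T.sum_mul_badFrac_le hT (x := x) (y := a)
    (fun v => by simpa [hx] using b0 v) x0
  have hmain : Q ≤ 2 / ε * (2 * (lam * Q + X ^ 2 / n)) + ε / 100 * X := by
    calc Q = ∑ v, x v * x v := Finset.sum_congr rfl fun v _ => sq _
      _ ≤ ∑ v, x v * (2 / ε * ((∑ i, b (S.move i v)) / p + (∑ j, a (T.move j v)) / r) + ε / 100) :=
        Finset.sum_le_sum fun v _ => mul_le_mul_of_nonneg_left (hloc v) (x0 v)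
      _ = 2 / ε * (∑ v, x v * ((∑ i, b (S.move i v)) / p)
            + ∑ v, x v * ((∑ j, a (T.move j v)) / r)) + ε / 100 * X := by
        rw [hX, ← Finset.sum_add_distrib, Finset.mul_sum, Finset.mul_sum,
          ← Finset.sum_add_distrib]
        exact Finset.sum_congr rfl fun v _ => by ring
      _ ≤ _ := by
        gcongr
        linarith
  have hXt : X ^ 2 / n = t * X := by rw [ht]; ring
  rw [hXt] at hmain
  exact eq_zero_of_expansion_bounds hε₀ hε₁ (by rw [hXYZ]; positivity) hQ0 ht1 hR4 hQR hmain

end RowBad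

end Steps

/-! ## Counting faces of the double Cayley complex -/

theorem sum_comp_of_card_fiber {X Y : Type*} [Fintype X] [Fintype Y] (π : X → Y) (k : ℕ)
    (hk : ∀ y, (Finset.univ.filter fun x => π x = y).card = k) (ψ : Y → ℝ) :
    ∑ x, ψ (π x) = k * ∑ y, ψ y := by
  rw [← Finset.sum_fiberwise Finset.univ π, Finset.mul_sum]
  refine Finset.sum_congr rfl fun y _ => ?_
  rw [Finset.sum_congr rfl fun x hx => by rw [(Finset.mem_filter.1 hx).2], Finset.sum_const, hk,
    nsmul_eq_mul]

section Counting

variable {G : Type u} [Group G] (P : CayleyPair G)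

/-- The moves `g ↦ a g`. -/
def leftSteps : Steps G P.A where
  move a g := a * g
  rev a := ⟨(a : G)⁻¹, P.inv_mem_A a a.2⟩
  rev_rev a := by simp
  move_rev a g := by simp
  move_ne a g := A_ne P a g

/-- The moves `g ↦ g b`. -/
def rightSteps : Steps G P.B where
  move b g := g * b
  rev b := ⟨(b : G)⁻¹, P.inv_mem_B b b.2⟩
  rev_rev b := by simp
  move_rev b g := by simp
  move_ne b g := B_ne P b g

theorem leftSteps_comm (a : P.A) (b : P.B) (g : G) :
    (leftSteps P).move a ((rightSteps P).move b g)
      = (rightSteps P).move b ((leftSteps P).move a g) :=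
  (mul_assoc _ _ _).symm

theorem leftSteps_injective (g : G) : Function.Injective fun a => (leftSteps P).move a g :=
  fun _ _ h => Subtype.ext (mul_right_cancel h)

theorem rightSteps_injective (g : G) : Function.Injective fun b => (rightSteps P).move b g :=
  fun _ _ h => Subtype.ext (mul_left_cancel h)

theorem leftCayley_adj (g h : G) :
    (leftCayley (P.A : Set G)).Adj g h ↔ ∃ a, h = (leftSteps P).move a g := by
  simp only [leftCayley, SimpleGraph.fromRel_adj]
  constructor
  · rintro ⟨-, ⟨a, ha, rfl⟩ | ⟨a, ha, rfl⟩⟩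
    · exact ⟨⟨a, ha⟩, rfl⟩
    · exact ⟨⟨a⁻¹, P.inv_mem_A a ha⟩, by simp [leftSteps]⟩
  · rintro ⟨a, rfl⟩
    exact ⟨((leftSteps P).move_ne a g).symm, .inl ⟨a, a.2, rfl⟩⟩

theorem rightCayley_adj (g h : G) :
    (rightCayley (P.B : Set G)).Adj g h ↔ ∃ b, h = (rightSteps P).move b g := by
  simp only [rightCayley, SimpleGraph.fromRel_adj]
  constructor
  · rintro ⟨-, ⟨b, hb, rfl⟩ | ⟨b, hb, rfl⟩⟩
    · exact ⟨⟨b, hb⟩, rfl⟩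
    · exact ⟨⟨b⁻¹, P.inv_mem_B b hb⟩, by simp [rightSteps]⟩
  · rintro ⟨b, rfl⟩
    exact ⟨((rightSteps P).move_ne b g).symm, .inl ⟨b, b.2, rfl⟩⟩

/-- The edge `{g, ag}`. -/
def mkEdgeA (g : G) (a : P.A) : EdgeA P := ⟨s(g, a * g), g, a, a.2, rfl⟩

/-- The edge `{g, gb}`. -/
def mkEdgeB (g : G) (b : P.B) : EdgeB P := ⟨s(g, g * b), g, b, b.2, rfl⟩

/-- The square `{g, ag, gb, agb}`. -/
def mkSquare (g : G) (a : P.A) (b : P.B) : Square P := ⟨squareOf g a b, g, a, a.2, b, b.2, rfl⟩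

variable {P}

theorem exists_mkEdgeA (e : EdgeA P) : ∃ g a, e = mkEdgeA P g a := by
  obtain ⟨e, g, a, ha, rfl⟩ := e
  exact ⟨g, ⟨a, ha⟩, rfl⟩

theorem exists_mkEdgeB (e : EdgeB P) : ∃ g b, e = mkEdgeB P g b := by
  obtain ⟨e, g, b, hb, rfl⟩ := e
  exact ⟨g, ⟨b, hb⟩, rfl⟩

theorem exists_mkSquare (s : Square P) : ∃ g a b, s = mkSquare P g a b := by
  obtain ⟨s, g, a, ha, b, hb, rfl⟩ := s
  exact ⟨g, ⟨a, ha⟩, ⟨b, hb⟩, rfl⟩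

theorem eq_mkEdgeA_iff (e : EdgeA P) (g : G) (a : P.A) :
    e = mkEdgeA P g a ↔ e.1 = s(g, a * g) := Subtype.ext_iff

theorem eq_mkEdgeB_iff (e : EdgeB P) (g : G) (b : P.B) :
    e = mkEdgeB P g b ↔ e.1 = s(g, g * b) := Subtype.ext_iff

theorem mkEdgeA_injective (g : G) : Function.Injective (mkEdgeA P g) := fun _ _ h =>
  Subtype.ext (mul_right_cancel (Sym2.congr_right.1 (congrArg Subtype.val h)))

theorem mkEdgeB_injective (g : G) : Function.Injective (mkEdgeB P g) := fun _ _ h =>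
  Subtype.ext (mul_left_cancel (Sym2.congr_right.1 (congrArg Subtype.val h)))

theorem mkEdgeA_flip (g : G) (a : P.A) :
    mkEdgeA P ((leftSteps P).move a g) ((leftSteps P).rev a) = mkEdgeA P g a :=
  Subtype.ext (by simp [mkEdgeA, leftSteps, Sym2.eq_swap])

theorem mkEdgeB_flip (g : G) (b : P.B) :
    mkEdgeB P ((rightSteps P).move b g) ((rightSteps P).rev b) = mkEdgeB P g b :=
  Subtype.ext (by simp [mkEdgeB, rightSteps, Sym2.eq_swap])

theorem mkEdgeA_eq_iff (g h : G) (a c : P.A) : mkEdgeA P h c = mkEdgeA P g a ↔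
    (h, c) = (g, a) ∨ (h, c) = ((leftSteps P).move a g, (leftSteps P).rev a) := by
  constructor
  · intro he
    have hm : h ∈ (mkEdgeA P g a).1 := by rw [← he]; exact Sym2.mem_mk_left _ _
    rcases Sym2.mem_iff.1 hm with rfl | rfl
    · exact .inl (by rw [mkEdgeA_injective _ he])
    · rw [← mkEdgeA_flip g a] at he
      exact .inr (by rw [mkEdgeA_injective _ he]; rfl)
  · rintro (h | h) <;> obtain ⟨rfl, rfl⟩ := Prod.mk.inj h
    · rfl
    · exact mkEdgeA_flip g a

theorem mkEdgeB_eq_iff (g h : G) (b c : P.B) : mkEdgeB P h c = mkEdgeB P g b ↔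
    (h, c) = (g, b) ∨ (h, c) = ((rightSteps P).move b g, (rightSteps P).rev b) := by
  constructor
  · intro he
    have hm : h ∈ (mkEdgeB P g b).1 := by rw [← he]; exact Sym2.mem_mk_left _ _
    rcases Sym2.mem_iff.1 hm with rfl | rfl
    · exact .inl (by rw [mkEdgeB_injective _ he])
    · rw [← mkEdgeB_flip g b] at he
      exact .inr (by rw [mkEdgeB_injective _ he]; rfl)
  · rintro (h | h) <;> obtain ⟨rfl, rfl⟩ := Prod.mk.inj h
    · rfl
    · exact mkEdgeB_flip g b

theorem mkSquare_injective (g : G) : Function.Injective fun x : P.A × P.B => mkSquare P g x.1 x.2 := by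
  rintro ⟨a, b⟩ ⟨c, d⟩ h
  have h' : squareOf g (a : G) b = squareOf g (c : G) d := congrArg Subtype.val h
  have h1 : s(g, (a : G) * g) ∈ (squareOf g (c : G) (d : G)).1 := by
    rw [← h']; exact Sym2.mem_mk_left _ _
  have h2 : s(g, g * (b : G)) ∈ (squareOf g (c : G) (d : G)).2 := by
    rw [← h']; exact Sym2.mem_mk_left _ _
  have h1 := edgeA_of_square h1 (Sym2.mem_mk_left _ _)
  have h2 := edgeB_of_square h2 (Sym2.mem_mk_left _ _)
  exact Prod.ext (Subtype.ext (mul_right_cancel (Sym2.congr_right.1 h1)))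
    (Subtype.ext (mul_left_cancel (Sym2.congr_right.1 h2)))

theorem vertex_le_square_iff (g : G) (s : Square P) :
    Face.vertex g ≤ Face.square s ↔ ∃ a b, mkSquare P g a b = s := by
  constructor
  · intro h
    obtain ⟨⟨a, b⟩, hs⟩ := s.exists_label h
    exact ⟨a, b, Subtype.ext hs.symm⟩
  · rintro ⟨a, b, rfl⟩
    exact ⟨_, Sym2.mem_mk_left _ _, Sym2.mem_mk_left _ _⟩

theorem edgeA_le_square_iff (g : G) (a : P.A) (s : Square P) :
    Face.edgeA (mkEdgeA P g a) ≤ Face.square s ↔ ∃ b, mkSquare P g a b = s := by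
  constructor
  · intro h
    obtain ⟨⟨c, b⟩, hs⟩ := s.exists_label ⟨_, h, Sym2.mem_mk_left _ _⟩
    change s(g, (a : G) * g) ∈ s.1.1 at h
    rw [hs] at h
    have := edgeA_of_square h (Sym2.mem_mk_left _ _)
    have hac : a = c := Subtype.ext (mul_right_cancel (Sym2.congr_right.1 this))
    subst hac
    exact ⟨b, Subtype.ext hs.symm⟩
  · rintro ⟨b, rfl⟩
    exact Sym2.mem_mk_left _ _

theorem edgeB_le_square_iff (g : G) (b : P.B) (s : Square P) :
    Face.edgeB (mkEdgeB P g b) ≤ Face.square s ↔ ∃ a, mkSquare P g a b = s := by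
  constructor
  · intro h
    obtain ⟨⟨a, c⟩, hs⟩ := s.exists_label (Face.mem_sq_iff.2 ⟨_, h, Sym2.mem_mk_left _ _⟩)
    change s(g, g * (b : G)) ∈ s.1.2 at h
    rw [hs] at h
    have := edgeB_of_square h (Sym2.mem_mk_left _ _)
    have hbc : b = c := Subtype.ext (mul_left_cancel (Sym2.congr_right.1 this))
    subst hbc
    exact ⟨a, Subtype.ext hs.symm⟩
  · rintro ⟨b, rfl⟩
    exact Sym2.mem_mk_left _ _

variable (P)

/-- The vertices. -/
def facesZeroEquiv : G ≃ Faces (Face P) 0 where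
  toFun g := ⟨.vertex g, rfl⟩
  invFun x := match x with
    | ⟨.vertex g, _⟩ => g
    | ⟨.empty, _⟩ | ⟨.edgeA _, _⟩ | ⟨.edgeB _, _⟩ | ⟨.square _, _⟩ => 1
  left_inv _ := rfl
  right_inv x := by
    obtain ⟨x, hx⟩ := x
    change x.dim = 0 at hx
    cases x <;> simp [Face.dim] at hx
    rfl

/-- The edges. -/
def facesOneEquiv : EdgeA P ⊕ EdgeB P ≃ Faces (Face P) (0 + 1) :=
  Equiv.ofBijective
    (Sum.elim (fun e => ⟨.edgeA e, rfl⟩) fun e => ⟨.edgeB e, rfl⟩)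
    (by
      constructor
      · rintro (e | e) (e' | e') h <;> simpa using congrArg Subtype.val h
      · rintro ⟨x, hx⟩
        change x.dim = 1 at hx
        cases x <;> simp only [Face.dim] at hx <;> try omega
        case edgeA e _ => exact ⟨.inl e, rfl⟩
        case edgeB e _ => exact ⟨.inr e, rfl⟩)

/-- The squares. -/
def facesTwoEquiv : Square P ≃ Faces (Face P) 2 :=
  Equiv.ofBijective (fun s => ⟨.square s, rfl⟩)
    (by
      constructor
      · intro s s' h; simpa using congrArg Subtype.val h
      · rintro ⟨x, hx⟩
        change x.dim = 2 at hx
        cases x <;> simp only [Face.dim] at hx <;> try omega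
        case square s _ => exact ⟨s, rfl⟩)

variable [Fintype G]

instance : Fintype (EdgeA P) := Fintype.ofFinite _
instance : Fintype (EdgeB P) := Fintype.ofFinite _
instance : Fintype (Square P) := Fintype.ofFinite _

theorem sum_mkEdgeA (ψ : EdgeA P → ℝ) : ∑ g, ∑ a, ψ (mkEdgeA P g a) = 2 * ∑ e, ψ e := by
  rw [← Fintype.sum_prod_type', sum_comp_of_card_fiber (fun x : G × P.A => mkEdgeA P x.1 x.2) 2]
  · norm_num
  · intro e
    obtain ⟨g, a, rfl⟩ := exists_mkEdgeA e
    rw [Finset.card_eq_two]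
    refine ⟨(g, a), ((leftSteps P).move a g, (leftSteps P).rev a), ?_, ?_⟩
    · exact fun h => (leftSteps P).move_ne a g (congrArg Prod.fst h).symm
    · ext ⟨h, c⟩
      simpa using mkEdgeA_eq_iff g h a c

theorem sum_mkEdgeB (ψ : EdgeB P → ℝ) : ∑ g, ∑ b, ψ (mkEdgeB P g b) = 2 * ∑ e, ψ e := by
  rw [← Fintype.sum_prod_type', sum_comp_of_card_fiber (fun x : G × P.B => mkEdgeB P x.1 x.2) 2]
  · norm_num
  · intro e
    obtain ⟨g, b, rfl⟩ := exists_mkEdgeB e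
    rw [Finset.card_eq_two]
    refine ⟨(g, b), ((rightSteps P).move b g, (rightSteps P).rev b), ?_, ?_⟩
    · exact fun h => (rightSteps P).move_ne b g (congrArg Prod.fst h).symm
    · ext ⟨h, c⟩
      simpa using mkEdgeB_eq_iff g h b c

theorem card_vertices_of_square (s : Square P) :
    Nat.card {x : Face P // grade ℤ x = 0 ∧ x ≤ .square s} = 4 := by
  obtain ⟨g, a, b, rfl⟩ := exists_mkSquare s
  rw [Nat.card_eq_fintype_card, Fintype.card_of_subtype
    {.vertex g, .vertex (a * g), .vertex (g * b), .vertex (a * g * b)}]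
  · have n1 := A_ne P a g
    have n2 := B_ne P b g
    have n3 := AB_ne P a b g
    have n4 := AB_ne' P a b g
    have n5 : (a : G) * g * b ≠ a * g := B_ne P b (a * g)
    have n6 : (a : G) * g * b ≠ g * b := by rw [mul_assoc]; exact A_ne P a (g * b)
    rw [Finset.card_insert_of_notMem, Finset.card_insert_of_notMem, Finset.card_pair]
    · simp only [ne_eq, Face.vertex.injEq]
      exact n6.symm
    · simp only [Finset.mem_insert, Finset.mem_singleton, Face.vertex.injEq, not_or]
      exact ⟨n3, n5.symm⟩
    · simp only [Finset.mem_insert, Finset.mem_singleton, Face.vertex.injEq, not_or]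
      exact ⟨n1.symm, n2.symm, n4.symm⟩
  · intro x
    change _ ↔ x.dim = 0 ∧ Face.le x _
    cases x <;> simp [Face.dim, Face.le, mkSquare, squareOf]
    tauto

theorem card_edges_of_square (s : Square P) :
    Nat.card {x : Face P // grade ℤ x = 1 ∧ x ≤ .square s} = 4 := by
  obtain ⟨g, a, b, rfl⟩ := exists_mkSquare s
  rw [Nat.card_eq_fintype_card, Fintype.card_of_subtype
    {.edgeA (mkEdgeA P g a), .edgeA (mkEdgeA P (g * b) a), .edgeB (mkEdgeB P g b),
      .edgeB (mkEdgeB P (a * g) b)}]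
  · have n1 := A_ne P a g
    have n2 := B_ne P b g
    have n4 := AB_ne' P a b g
    rw [Finset.card_insert_of_notMem, Finset.card_insert_of_notMem, Finset.card_pair]
    · simp only [ne_eq, Face.edgeB.injEq, mkEdgeB_eq_iff, Prod.mk.injEq, not_or, not_and]
      refine ⟨fun h => absurd h.symm n1, fun h => absurd h.symm n4⟩
    · simp
    · simp only [Finset.mem_insert, Finset.mem_singleton, Face.edgeA.injEq, mkEdgeA_eq_iff,
        Prod.mk.injEq, reduceCtorEq, or_false, not_or, not_and]
      refine ⟨fun h => absurd h.symm n2, fun h => ?_⟩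
      rw [show (leftSteps P).move a (g * b) = a * g * b from (mul_assoc _ _ _).symm] at h
      exact absurd h.symm n4
  · intro x
    change _ ↔ x.dim = 1 ∧ Face.le x _
    cases x <;>
      simp [Face.dim, Face.le, mkSquare, squareOf, eq_mkEdgeA_iff, eq_mkEdgeB_iff, mul_assoc]

theorem card_squares_of_vertex (g : G) :
    (Finset.univ.filter fun s : Square P => Face.vertex g ≤ Face.square s).card
      = P.A.card * P.B.card := by
  have : (Finset.univ.filter fun s : Square P => Face.vertex g ≤ Face.square s)
      = Finset.univ.image fun x : P.A × P.B => mkSquare P g x.1 x.2 := by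
    ext s
    simp [vertex_le_square_iff]
  rw [this, Finset.card_image_of_injective _ (mkSquare_injective g)]
  simp

theorem card_squares_of_edgeA (e : EdgeA P) :
    (Finset.univ.filter fun s : Square P => Face.edgeA e ≤ Face.square s).card = P.B.card := by
  obtain ⟨g, a, rfl⟩ := exists_mkEdgeA e
  have : (Finset.univ.filter fun s : Square P => Face.edgeA (mkEdgeA P g a) ≤ Face.square s)
      = Finset.univ.image fun b => mkSquare P g a b := by
    ext s
    simp [edgeA_le_square_iff]
  rw [this, Finset.card_image_of_injective]
  · simp
  · intro b b' h
    exact (Prod.mk.inj (mkSquare_injective g (a₁ := (a, b)) (a₂ := (a, b')) h)).2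

theorem card_squares_of_edgeB (e : EdgeB P) :
    (Finset.univ.filter fun s : Square P => Face.edgeB e ≤ Face.square s).card = P.A.card := by
  obtain ⟨g, b, rfl⟩ := exists_mkEdgeB e
  have : (Finset.univ.filter fun s : Square P => Face.edgeB (mkEdgeB P g b) ≤ Face.square s)
      = Finset.univ.image fun a => mkSquare P g a b := by
    ext s
    simp [edgeB_le_square_iff]
  rw [this, Finset.card_image_of_injective]
  · simp
  · intro a a' h
    exact (Prod.mk.inj (mkSquare_injective g (a₁ := (a, b)) (a₂ := (a', b)) h)).1

theorem card_square : 4 * Fintype.card (Square P) = Fintype.card G * (P.A.card * P.B.card) := by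
  have h1 : ∑ s : Square P, ∑ g : G, (if Face.vertex g ≤ Face.square s then 1 else 0)
      = 4 * Fintype.card (Square P) := by
    have : ∀ s : Square P, ∑ g : G, (if Face.vertex g ≤ Face.square s then 1 else 0) = 4 := by
      intro s
      rw [← card_vertices_of_square P s, ← Finset.card_filter, Nat.card_eq_fintype_card,
        ← Fintype.card_subtype]
      refine Fintype.card_congr ⟨fun g => ⟨.vertex g.1, rfl, g.2⟩,
        fun x => ⟨(facesZeroEquiv P).symm ⟨x.1, x.2.1⟩, ?_⟩, fun _ => rfl, ?_⟩
      · have := (facesZeroEquiv P).apply_symm_apply ⟨x.1, x.2.1⟩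
        have := congrArg Subtype.val this
        change Face.vertex _ = x.1 at this
        rw [this]
        exact x.2.2
      · intro x
        exact Subtype.ext
          (congrArg Subtype.val ((facesZeroEquiv P).apply_symm_apply ⟨x.1, x.2.1⟩) :)
    simp [this, mul_comm]
  rw [← h1, Finset.sum_comm]
  simp only [← Finset.card_filter, card_squares_of_vertex]
  simp

theorem cayleyWeight_eq (x : Face P) (hx : ∀ s : Square P,
      Nat.card {x' : Face P // grade ℤ x' = grade ℤ x ∧ x' ≤ .square s} = 4) :
    cayleyWeight P x
      = (Finset.univ.filter fun s : Square P => x ≤ .square s).card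
        / (Fintype.card G * (P.A.card * P.B.card) : ℝ) := by
  have h4 : (4 * Fintype.card (Square P) : ℝ) = Fintype.card G * (P.A.card * P.B.card) := by
    exact_mod_cast card_square P
  have h1 : Fintype.card (Faces (Face P) 2) = Fintype.card (Square P) :=
    (Fintype.card_congr (facesTwoEquiv P)).symm
  rw [cayleyWeight, natWeight, h1, ← (facesTwoEquiv P).sum_comp, ← h4]
  change _ * ∑ s : Square P, (if x ≤ .square s then
    1 / (Nat.card {x' : Face P // grade ℤ x' = grade ℤ x ∧ x' ≤ .square s} : ℝ) else 0) = _
  simp only [hx]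
  rw [← Finset.sum_filter, Finset.sum_const, nsmul_eq_mul, Nat.cast_ofNat, mul_one_div,
    div_mul_div_comm, one_mul, mul_comm (4 : ℝ)]

theorem cayleyWeight_vertex (hA : P.A.card ≠ 0) (hB : P.B.card ≠ 0) (g : G) :
    cayleyWeight P (.vertex g) = 1 / Fintype.card G := by
  have hA : (P.A.card : ℝ) ≠ 0 := by exact_mod_cast hA
  have hB : (P.B.card : ℝ) ≠ 0 := by exact_mod_cast hB
  rw [cayleyWeight_eq P (.vertex g) (card_vertices_of_square P), card_squares_of_vertex]
  push_cast
  field_simp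

theorem cayleyWeight_edgeA (hB : P.B.card ≠ 0) (e : EdgeA P) :
    cayleyWeight P (.edgeA e) = 1 / (Fintype.card G * P.A.card) := by
  have hB : (P.B.card : ℝ) ≠ 0 := by exact_mod_cast hB
  rw [cayleyWeight_eq P (.edgeA e) (card_edges_of_square P), card_squares_of_edgeA]
  field_simp

theorem cayleyWeight_edgeB (hA : P.A.card ≠ 0) (e : EdgeB P) :
    cayleyWeight P (.edgeB e) = 1 / (Fintype.card G * P.B.card) := by
  have hA : (P.A.card : ℝ) ≠ 0 := by exact_mod_cast hA
  rw [cayleyWeight_eq P (.edgeB e) (card_edges_of_square P), card_squares_of_edgeB]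
  field_simp

end Counting

/-! ## Local description of the correction algorithm -/

section Local

variable {G F : Type u} [Group G] [Field F] {P : CayleyPair G}
  {CA : Submodule F (P.A → F)} {CB : Submodule F (P.B → F)}

variable (P CA CB) in
/-- A `0`-cochain is a word in the letters of the tensor code. -/
def cochainEquiv : Cochain (tensorSheaf P CA CB) 0 ≃ (G → tensorCode CA CB) where
  toFun f := letterAt P CA CB f
  invFun φ x := match x with
    | ⟨.vertex g, _⟩ => φ g
    | ⟨.empty, _⟩ | ⟨.edgeA _, _⟩ | ⟨.edgeB _, _⟩ | ⟨.square _, _⟩ => 0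
  left_inv f := by
    funext ⟨x, hx⟩
    have hd : x.dim = 0 := hx
    cases x <;> simp only [Face.dim] at hd <;> first | omega | rfl
  right_inv _ := rfl

theorem cochain_ext {f f' : Cochain (tensorSheaf P CA CB) 0}
    (h : ∀ g, letterAt P CA CB f g = letterAt P CA CB f' g) : f = f' :=
  (cochainEquiv P CA CB).injective (funext h)

/-- The matrix entries of the letters of a word. -/
def view (f : Cochain (tensorSheaf P CA CB) 0) (g : G) (a : P.A) (b : P.B) : F :=
  (letterAt P CA CB f g).1 a b

/-- The matrix entries of the letters of a word, transposed. -/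
def viewT (f : Cochain (tensorSheaf P CA CB) 0) (g : G) (b : P.B) (a : P.A) : F :=
  view f g a b

/-- The word `f` with the letter at `u` replaced with `m`. -/
def setLetter (f : Cochain (tensorSheaf P CA CB) 0) (u : G) (m : tensorCode CA CB) :
    Cochain (tensorSheaf P CA CB) 0 :=
  (cochainEquiv P CA CB).symm (Function.update (letterAt P CA CB f) u m)

theorem letterAt_setLetter (f : Cochain (tensorSheaf P CA CB) 0) (u : G) (m : tensorCode CA CB) :
    letterAt P CA CB (setLetter f u m) = Function.update (letterAt P CA CB f) u m :=
  (cochainEquiv P CA CB).apply_symm_apply _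

/-- With the letter `m` at `u`, the edge `{u, au}` is violated. -/
def RowViolated (f : Cochain (tensorSheaf P CA CB) 0) (u : G) (m : tensorCode CA CB) (a : P.A) :
    Prop :=
  ∃ b, m.1 a b ≠ view f ((leftSteps P).move a u) ((leftSteps P).rev a) b

/-- With the letter `m` at `u`, the edge `{u, ub}` is violated. -/
def ColViolated (f : Cochain (tensorSheaf P CA CB) 0) (u : G) (m : tensorCode CA CB) (b : P.B) :
    Prop :=
  ∃ a, m.1 a b ≠ view f ((rightSteps P).move b u) a ((rightSteps P).rev b)

/-- The weighted number of violated edges at `u` if the letter at `u` is replaced with `m`. -/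
def vertexCost (f : Cochain (tensorSheaf P CA CB) 0) (u : G) (m : tensorCode CA CB) : ℝ :=
  (∑ a, if RowViolated f u m a then (1 : ℝ) else 0) / P.A.card
    + (∑ b, if ColViolated f u m b then (1 : ℝ) else 0) / P.B.card

/-- The weighted number of violated edges at `u`. -/
def defect (f : Cochain (tensorSheaf P CA CB) 0) (u : G) : ℝ :=
  (leftSteps P).badFrac (view f) u + (rightSteps P).badFrac (viewT f) u

theorem defect_eq_vertexCost (f : Cochain (tensorSheaf P CA CB) 0) (u : G) :
    defect f u = vertexCost f u (letterAt P CA CB f u) := by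
  simp only [defect, vertexCost, Steps.badFrac, Fintype.card_coe]
  rfl

theorem defect_nonneg (f : Cochain (tensorSheaf P CA CB) 0) (u : G) : 0 ≤ defect f u :=
  add_nonneg (Steps.badFrac_nonneg _ _ _) (Steps.badFrac_nonneg _ _ _)

variable [Fintype G]

theorem sum_defect_setLetter (f : Cochain (tensorSheaf P CA CB) 0) (u : G)
    (m : tensorCode CA CB) : ∑ g, defect (setLetter f u m) g
      = ∑ g, defect f g + 2 * (vertexCost f u m - defect f u) := by
  have h1 := (leftSteps P).sum_update (A := tensorCode CA CB)
    (R := fun a x y => ∃ b, x.1 a b ≠ y.1 ((leftSteps P).rev a) b)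
    (fun a x y => by simp only [(leftSteps P).rev_rev]; exact exists_congr fun _ => ne_comm)
    (letterAt P CA CB f) u m
  have h2 := (rightSteps P).sum_update (A := tensorCode CA CB)
    (R := fun b x y => ∃ a, x.1 a b ≠ y.1 a ((rightSteps P).rev b))
    (fun b x y => by simp only [(rightSteps P).rev_rev]; exact exists_congr fun _ => ne_comm)
    (letterAt P CA CB f) u m
  rw [← letterAt_setLetter] at h1 h2
  rw [defect_eq_vertexCost]
  simp only [vertexCost, defect, Finset.sum_add_distrib, Steps.badFrac, Fintype.card_coe,
    ← Finset.sum_div]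
  change (∑ g, ∑ a, (leftSteps P).badInd (view (setLetter f u m)) g a)
    = (∑ g, ∑ a, (leftSteps P).badInd (view f) g a)
      + 2 * ((∑ a, if RowViolated f u m a then (1 : ℝ) else 0)
        - ∑ a, if RowViolated f u (letterAt P CA CB f u) a then (1 : ℝ) else 0) at h1
  change (∑ g, ∑ b, (rightSteps P).badInd (viewT (setLetter f u m)) g b)
    = (∑ g, ∑ b, (rightSteps P).badInd (viewT f) g b)
      + 2 * ((∑ b, if ColViolated f u m b then (1 : ℝ) else 0)
        - ∑ b, if ColViolated f u (letterAt P CA CB f u) b then (1 : ℝ) else 0) at h2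
  rw [h1, h2]
  ring

theorem coboundary_apply (o : PosetOrientation F (Face P))
    (ho : ∀ g, o.sign (.vertex g) .empty = 1) (f : Cochain (tensorSheaf P CA CB) 0)
    (z : Faces (Face P) (0 + 1)) {g h : G} (hgh : h ≠ g) (hg : Face.vertex g < z.1)
    (hh : Face.vertex h < z.1) (hz : ∀ v, Face.vertex v < z.1 → v = g ∨ v = h) :
    coboundary o (tensorSheaf P CA CB) 0 f z = o.sign z.1 (.vertex g) •
      ((tensorSheaf P CA CB).res hg (f ⟨.vertex g, rfl⟩)
        - (tensorSheaf P CA CB).res hh (f ⟨.vertex h, rfl⟩)) := by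
  have hzd : z.1.dim = 1 := z.2
  have hsign : o.sign z.1 (.vertex g) + o.sign z.1 (.vertex h) = 0 := by
    have h0 := o.sum_eq_zero .empty z.1 (show Face.le _ _ from trivial)
      (show z.1.dim = -1 + 2 by rw [hzd]; norm_num)
    rw [Fintype.sum_eq_add (Face.vertex g) (Face.vertex h) (by simpa using hgh.symm)] at h0
    · have h1 : (Face.empty : Face P) < .vertex g := Face.lt_iff.2 ⟨trivial, by simp [Face.dim]⟩
      have h2 : (Face.empty : Face P) < .vertex h := Face.lt_iff.2 ⟨trivial, by simp [Face.dim]⟩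
      rwa [if_pos ⟨h1, hg⟩, if_pos ⟨h2, hh⟩, ho, ho, mul_one, mul_one] at h0
    · intro y hy
      refine if_neg fun hlt => ?_
      have h1 := (Face.lt_iff.1 hlt.1).2
      have h2 := (Face.lt_iff.1 hlt.2).2
      rw [hzd] at h2
      cases y <;> simp only [Face.dim] at h1 h2 <;> try omega
      rcases hz _ hlt.2 with rfl | rfl
      · exact hy.1 rfl
      · exact hy.2 rfl
  change (∑ x : Faces (Face P) 0, if h : x.1 < z.1 then
    o.sign z.1 x.1 • (tensorSheaf P CA CB).res h (f x) else 0) = _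
  rw [Fintype.sum_eq_add ⟨.vertex g, rfl⟩ ⟨.vertex h, rfl⟩]
  · rw [dif_pos hg, dif_pos hh, eq_neg_of_add_eq_zero_right hsign, neg_smul, smul_sub,
      sub_eq_add_neg]
  · intro h
    simpa using hgh.symm (by simpa using congrArg Subtype.val h)
  · rintro ⟨x, hx⟩ hne
    have hd : x.dim = 0 := hx
    refine dif_neg fun hlt => ?_
    cases x <;> simp only [Face.dim] at hd <;> try omega
    rcases hz _ hlt with rfl | rfl
    · exact hne.1 rfl
    · exact hne.2 rfl

theorem coboundary_apply_eq_zero_iff (o : PosetOrientation F (Face P))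
    (ho : ∀ g, o.sign (.vertex g) .empty = 1) (f : Cochain (tensorSheaf P CA CB) 0)
    (z : Faces (Face P) (0 + 1)) {g h : G} (hgh : h ≠ g) (hg : Face.vertex g < z.1)
    (hh : Face.vertex h < z.1) (hz : ∀ v, Face.vertex v < z.1 → v = g ∨ v = h) :
    coboundary o (tensorSheaf P CA CB) 0 f z = 0 ↔
      (tensorSheaf P CA CB).res hg (f ⟨.vertex g, rfl⟩)
        = (tensorSheaf P CA CB).res hh (f ⟨.vertex h, rfl⟩) := by
  have hzd : z.1.dim = 1 := z.2
  have hu : IsUnit (o.sign z.1 (.vertex g)) := o.isUnit_sign ⟨hg, fun {c} h1 h2 => by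
    have h1 := (Face.lt_iff.1 h1).2
    have h2 := (Face.lt_iff.1 h2).2
    rw [hzd] at h2
    change (0 : ℤ) < c.dim at h1
    omega⟩
  rw [coboundary_apply o ho f z hgh hg hh hz, hu.smul_eq_zero, sub_eq_zero]

theorem coboundary_edgeA_eq_zero_iff (o : PosetOrientation F (Face P))
    (ho : ∀ g, o.sign (.vertex g) .empty = 1) (f : Cochain (tensorSheaf P CA CB) 0)
    (g : G) (a : P.A) :
    coboundary o (tensorSheaf P CA CB) 0 f ⟨.edgeA (mkEdgeA P g a), rfl⟩ = 0
      ↔ ¬ (leftSteps P).RowBad (view f) g a := by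
  have h1 : g ∈ (mkEdgeA P g a).1 := Sym2.mem_mk_left _ _
  have h2 : a * g ∈ (mkEdgeA P g a).1 := Sym2.mem_mk_right _ _
  have hl1 : (mkEdgeA P g a).label h1 = a :=
    (mkEdgeA_injective g (Subtype.ext ((mkEdgeA P g a).label_spec h1))).symm
  have hl2 : (mkEdgeA P g a).label h2 = (leftSteps P).rev a := by
    have := (mkEdgeA P g a).label_spec h2
    refine (mkEdgeA_injective (a * g : G) (Subtype.ext (Eq.trans ?_ this))).symm
    exact congrArg Subtype.val (mkEdgeA_flip g a)
  rw [coboundary_apply_eq_zero_iff o ho f ⟨.edgeA (mkEdgeA P g a), rfl⟩ (A_ne P a g)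
    (Face.lt_iff.2 ⟨h1, by simp [Face.dim]⟩) (Face.lt_iff.2 ⟨h2, by simp [Face.dim]⟩)
    (fun v hv => Sym2.mem_iff.1 (Face.lt_iff.1 hv).1)]
  change rowMap CA CB ((mkEdgeA P g a).label h1) (letterAt P CA CB f g)
    = rowMap CA CB ((mkEdgeA P g a).label h2) (letterAt P CA CB f (a * g)) ↔ _
  rw [hl1, hl2, Subtype.ext_iff, funext_iff]
  simp only [Steps.RowBad, not_exists, not_not]
  rfl

theorem coboundary_edgeB_eq_zero_iff (o : PosetOrientation F (Face P))
    (ho : ∀ g, o.sign (.vertex g) .empty = 1) (f : Cochain (tensorSheaf P CA CB) 0)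
    (g : G) (b : P.B) :
    coboundary o (tensorSheaf P CA CB) 0 f ⟨.edgeB (mkEdgeB P g b), rfl⟩ = 0
      ↔ ¬ (rightSteps P).RowBad (viewT f) g b := by
  have h1 : g ∈ (mkEdgeB P g b).1 := Sym2.mem_mk_left _ _
  have h2 : g * b ∈ (mkEdgeB P g b).1 := Sym2.mem_mk_right _ _
  have hl1 : (mkEdgeB P g b).label h1 = b :=
    (mkEdgeB_injective g (Subtype.ext ((mkEdgeB P g b).label_spec h1))).symm
  have hl2 : (mkEdgeB P g b).label h2 = (rightSteps P).rev b := by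
    have := (mkEdgeB P g b).label_spec h2
    refine (mkEdgeB_injective (g * b : G) (Subtype.ext (Eq.trans ?_ this))).symm
    exact congrArg Subtype.val (mkEdgeB_flip g b)
  rw [coboundary_apply_eq_zero_iff o ho f ⟨.edgeB (mkEdgeB P g b), rfl⟩ (B_ne P b g)
    (Face.lt_iff.2 ⟨h1, by simp [Face.dim]⟩) (Face.lt_iff.2 ⟨h2, by simp [Face.dim]⟩)
    (fun v hv => Sym2.mem_iff.1 (Face.lt_iff.1 hv).1)]
  change colMap CA CB ((mkEdgeB P g b).label h1) (letterAt P CA CB f g)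
    = colMap CA CB ((mkEdgeB P g b).label h2) (letterAt P CA CB f (g * b)) ↔ _
  rw [hl1, hl2, Subtype.ext_iff, funext_iff]
  simp only [Steps.RowBad, not_exists, not_not]
  rfl

theorem sum_edges (φ : Faces (Face P) (0 + 1) → ℝ) :
    ∑ y, φ y = (∑ g, ∑ a, φ ⟨.edgeA (mkEdgeA P g a), rfl⟩) / 2
      + (∑ g, ∑ b, φ ⟨.edgeB (mkEdgeB P g b), rfl⟩) / 2 := by
  rw [← (facesOneEquiv P).sum_comp, Fintype.sum_sum_type,
    sum_mkEdgeA P (fun e => φ ⟨.edgeA e, rfl⟩), sum_mkEdgeB P (fun e => φ ⟨.edgeB e, rfl⟩)]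
  change (∑ e : EdgeA P, φ ⟨.edgeA e, rfl⟩) + (∑ e : EdgeB P, φ ⟨.edgeB e, rfl⟩) = _
  ring

theorem mem_cocycleCode_iff (o : PosetOrientation F (Face P))
    (ho : ∀ g, o.sign (.vertex g) .empty = 1) (f : Cochain (tensorSheaf P CA CB) 0) :
    f ∈ cocycleCode o (tensorSheaf P CA CB) 0 ↔
      (∀ g a, ¬ (leftSteps P).RowBad (view f) g a)
        ∧ ∀ g b, ¬ (rightSteps P).RowBad (viewT f) g b := by
  change coboundary o _ 0 f = 0 ↔ _
  simp only [← coboundary_edgeA_eq_zero_iff o ho, ← coboundary_edgeB_eq_zero_iff o ho]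
  constructor
  · intro h
    exact ⟨fun g a => congrFun h _, fun g b => congrFun h _⟩
  · rintro ⟨h1, h2⟩
    funext y
    obtain ⟨e | e, rfl⟩ := (facesOneEquiv P).surjective y
    · obtain ⟨g, a, rfl⟩ := exists_mkEdgeA e
      exact h1 g a
    · obtain ⟨g, b, rfl⟩ := exists_mkEdgeB e
      exact h2 g b

theorem wnorm_coboundary (o : PosetOrientation F (Face P))
    (ho : ∀ g, o.sign (.vertex g) .empty = 1) (hA : P.A.card ≠ 0) (hB : P.B.card ≠ 0)
    (f : Cochain (tensorSheaf P CA CB) 0) :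
    wnorm (cayleyWeight P) (coboundary o (tensorSheaf P CA CB) 0 f)
      = (∑ g, defect f g) / (2 * Fintype.card G) := by
  rw [wnorm, sum_edges]
  simp only [ne_eq, coboundary_edgeA_eq_zero_iff o ho, coboundary_edgeB_eq_zero_iff o ho, not_not,
    cayleyWeight_edgeA P hB, cayleyWeight_edgeB P hA]
  have e1 : ∀ (p : Prop) (c : ℝ), (if p then c else 0) = (if p then 1 else 0) * c := by
    intro p c; simp
  simp only [e1 _ (1 / _), ← Finset.sum_mul, defect, Finset.sum_add_distrib, Steps.badFrac,
    ← Finset.sum_div, Steps.badInd, Fintype.card_coe]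
  field_simp

theorem correctionStep_iff (o : PosetOrientation F (Face P))
    (ho : ∀ g, o.sign (.vertex g) .empty = 1) (hA : P.A.card ≠ 0) (hB : P.B.card ≠ 0) (q : ℝ)
    (f f' : Cochain (tensorSheaf P CA CB) 0) :
    CorrectionStep (cayleyWeight P) o (tensorSheaf P CA CB) 0 q f f' ↔
      ∃ u m, vertexCost f u m < defect f u - q ∧ f' = setLetter f u m := by
  have hn : (0 : ℝ) < Fintype.card G := by exact_mod_cast Fintype.card_pos
  have key : ∀ u m, wnorm (cayleyWeight P) (coboundary o (tensorSheaf P CA CB) 0 (setLetter f u m))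
      < wnorm (cayleyWeight P) (coboundary o (tensorSheaf P CA CB) 0 f)
        - q * cayleyWeight P (.vertex u) ↔ vertexCost f u m < defect f u - q := by
    intro u m
    rw [wnorm_coboundary o ho hA hB, wnorm_coboundary o ho hA hB, cayleyWeight_vertex P hA hB,
      sum_defect_setLetter, mul_one_div, ← sub_pos, ← sub_pos (a := defect f u - q)]
    have : (∑ g, defect f g) / (2 * Fintype.card G) - q / Fintype.card G
        - (∑ g, defect f g + 2 * (vertexCost f u m - defect f u)) / (2 * Fintype.card G)
        = (defect f u - q - vertexCost f u m) / Fintype.card G := by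
      field_simp
      ring
    rw [this]
    exact div_pos_iff_of_pos_right hn
  constructor
  · rintro ⟨u, h, hu0, hu1, hsupp, hlt, rfl⟩
    have hd : u.dim = 0 := le_antisymm hu1 hu0
    cases u <;> simp only [Face.dim] at hd <;> try omega
    case vertex u =>
      have e : f + h = setLetter f u (letterAt P CA CB (f + h) u) := by
        refine cochain_ext fun g => ?_
        rw [letterAt_setLetter]
        by_cases hg : g = u
        · subst hg; simp
        · rw [Function.update_of_ne hg]
          change f ⟨.vertex g, rfl⟩ + h ⟨.vertex g, rfl⟩ = f ⟨.vertex g, rfl⟩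
          rw [hsupp ⟨.vertex g, rfl⟩ (fun hle => hg (Eq.symm hle)), add_zero]
      refine ⟨u, letterAt P CA CB (f + h) u, ?_, e⟩
      rw [← key, ← e, map_add]
      exact hlt
  · rintro ⟨u, m, hlt, rfl⟩
    refine ⟨.vertex u, setLetter f u m - f, le_rfl, le_rfl, ?_, ?_, by abel⟩
    · intro x hx
      obtain ⟨g, rfl⟩ := (facesZeroEquiv P).surjective x
      have hg : g ≠ u := fun h => hx (show u = g from h.symm)
      change letterAt P CA CB (setLetter f u m) g - letterAt P CA CB f g = 0
      rw [letterAt_setLetter, Function.update_of_ne hg, sub_self]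
    · rw [← map_add, add_sub_cancel]
      exact (key u m).2 hlt

end Local

/-! ## Distances -/

section Distances

variable {ι : Type*} [Fintype ι] {α : ι → Type*}

theorem coe_le_relDist_iff {C : Set (∀ i, α i)} {c : ℝ} :
    (c : EReal) ≤ relDist C ↔ ∀ f ∈ C, ∀ g ∈ C, f ≠ g → c ≤ ndist f g := by
  simp only [relDist, le_iInf_iff, EReal.coe_le_coe_iff]

theorem ndist_nonneg (f g : ∀ i, α i) : 0 ≤ ndist f g :=
  div_nonneg (Nat.cast_nonneg _) (Nat.cast_nonneg _)

theorem ndist_le_one (f g : ∀ i, α i) : ndist f g ≤ 1 :=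
  div_le_one_of_le₀ (by exact_mod_cast hammingDist_le_card_fintype) (Nat.cast_nonneg _)

theorem ndist_comm (f g : ∀ i, α i) : ndist f g = ndist g f := by
  rw [ndist, ndist, hammingDist_comm]

theorem ndist_self (f : ∀ i, α i) : ndist f f = 0 := by simp [ndist]

theorem ndist_triangle (f g h : ∀ i, α i) : ndist f h ≤ ndist f g + ndist g h := by
  rw [ndist, ndist, ndist, ← add_div]
  gcongr
  exact_mod_cast hammingDist_triangle f g h

theorem distTo_le {f g : ∀ i, α i} {C : Set (∀ i, α i)} (hg : g ∈ C) : distTo f C ≤ ndist f g :=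
  ciInf_le ⟨0, by rintro _ ⟨x, rfl⟩; exact ndist_nonneg _ _⟩ (⟨g, hg⟩ : C)

/-- Two distinct words of a code of large distance differ in many coordinates. -/
theorem mul_card_le_sum_ne {F : Type*} {C : Set (ι → F)} {ε : ℝ} (hC : (ε : EReal) ≤ relDist C)
    {x y : ι → F} (hx : x ∈ C) (hy : y ∈ C) (hxy : x ≠ y) :
    ε * Fintype.card ι ≤ ∑ i, if x i ≠ y i then (1 : ℝ) else 0 := by
  have h := coe_le_relDist_iff.1 hC x hx y hy hxy
  obtain ⟨i, -⟩ := Function.ne_iff.1 hxy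
  have : Nonempty ι := ⟨i⟩
  have hι : (0 : ℝ) < Fintype.card ι := by exact_mod_cast Fintype.card_pos
  rw [ndist, le_div_iff₀ hι] at h
  refine h.trans (le_of_eq ?_)
  rw [Finset.sum_boole, hammingDist]

end Distances

theorem sum_badInd_le {V I J E : Type*} [Fintype V] [Fintype I] (S : Steps V I)
    (e e' : V → I → J → E) (s : V → ℝ)
    (hs0 : ∀ g, 0 ≤ s g) (hs : ∀ g, e g ≠ e' g → 1 ≤ s g) (he' : ∀ g i, ¬ S.RowBad e' g i) :
    ∑ g, S.badFrac e g ≤ 2 * ∑ g, s g := by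
  have pt : ∀ g i, S.badInd e g i ≤ s g + s (S.move i g) := by
    intro g i
    have h1 := hs0 g
    have h2 := hs0 (S.move i g)
    unfold Steps.badInd
    split_ifs with hb
    · by_cases hg : e g = e' g
      · have : e (S.move i g) ≠ e' (S.move i g) := by
          intro hm
          apply he' g i
          unfold Steps.RowBad at hb ⊢
          rwa [← hg, ← hm]
        linarith [hs _ this]
      · linarith [hs _ hg]
    · positivity
  simp only [Steps.badFrac, ← Finset.sum_div]
  rcases isEmpty_or_nonempty I with hI | hI
  · simpa using Finset.sum_nonneg fun g _ => hs0 g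
  have hI : (0 : ℝ) < Fintype.card I := by exact_mod_cast Fintype.card_pos
  rw [div_le_iff₀ hI]
  calc ∑ g, ∑ i, S.badInd e g i ≤ ∑ g, ∑ i, (s g + s (S.move i g)) :=
        Finset.sum_le_sum fun g _ => Finset.sum_le_sum fun i _ => pt g i
    _ = _ := by
        simp only [Finset.sum_add_distrib, S.sum_sum_move, Finset.sum_const, Finset.card_univ,
          nsmul_eq_mul, ← Finset.mul_sum]
        ring

/-! ## Distance, testability and decoding of the cocycle code -/

section Cocycles

variable {G F : Type u} [Group G] [Field F] {P : CayleyPair G}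
  {CA : Submodule F (P.A → F)} {CB : Submodule F (P.B → F)}

theorem col_mem (f : Cochain (tensorSheaf P CA CB) 0) (g : G) (b : P.B) :
    (fun a => view f g a b) ∈ CA := (letterAt P CA CB f g).2.1 b

theorem row_mem (f : Cochain (tensorSheaf P CA CB) 0) (g : G) (a : P.A) :
    (fun b => view f g a b) ∈ CB := (letterAt P CA CB f g).2.2 a

theorem defect_le_of_locallyMinimal {ε : ℝ} (hε₀ : 0 < ε)
    (hagr : IsAgreementTestable CA CB ε) {q : ℝ}
    {f : Cochain (tensorSheaf P CA CB) 0} {u : G}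
    (hmin : ∀ m, ¬ vertexCost f u m < defect f u - q) :
    defect f u ≤ 2 / ε * ((∑ a, (rightSteps P).badFrac (viewT f) ((leftSteps P).move a u))
          / Fintype.card P.A
        + (∑ b, (leftSteps P).badFrac (view f) ((rightSteps P).move b u)) / Fintype.card P.B)
      + q := by
  set m₁ : Matrix P.A P.B F := fun a b =>
    view f u a b - view f ((rightSteps P).move b u) a ((rightSteps P).rev b) with hm₁
  set m₂ : Matrix P.A P.B F := fun a b =>
    view f u a b - view f ((leftSteps P).move a u) ((leftSteps P).rev a) b with hm₂
  obtain ⟨m, hm, hle⟩ := hagr m₁ m₂ (fun b => CA.sub_mem (col_mem f u b) (col_mem f _ _))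
    (fun a => CB.sub_mem (row_mem f u a) (row_mem f _ _))
  set m' : tensorCode CA CB := letterAt P CA CB f u - ⟨m, hm⟩ with hm'
  have hent : ∀ a b, m'.1 a b = view f u a b - m a b := fun a b => rfl
  have hrow : ∀ a, RowViolated f u m' a ↔ ∃ b, m₂ a b ≠ m a b := fun a => by
    refine exists_congr fun b => not_congr ?_
    rw [hent, sub_eq_iff_eq_add, hm₂, sub_eq_iff_eq_add, add_comm]
  have hcol : ∀ b, ColViolated f u m' b ↔ ∃ a, m₁ a b ≠ m a b := fun b => by
    refine exists_congr fun a => not_congr ?_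
    rw [hent, sub_eq_iff_eq_add, hm₁, sub_eq_iff_eq_add, add_comm]
  have hcost : vertexCost f u m' = (Nat.card {a // ∃ b, m₂ a b ≠ m a b} : ℝ) / P.A.card
      + (Nat.card {b // ∃ a, m₁ a b ≠ m a b} : ℝ) / P.B.card := by
    simp only [vertexCost, hrow, hcol, Finset.sum_boole, Nat.card_eq_fintype_card,
      Fintype.card_subtype]
  have hfrac : (Nat.card {x : P.A × P.B // m₁ x.1 x.2 ≠ m₂ x.1 x.2} : ℝ)
      ≤ ∑ a, ∑ b, ((rightSteps P).badInd (viewT f) ((leftSteps P).move a u) b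
          + (leftSteps P).badInd (view f) ((rightSteps P).move b u) a) := by
    rw [Nat.card_eq_fintype_card, Fintype.card_subtype, ← Finset.sum_boole,
      ← Fintype.sum_prod_type']
    refine Finset.sum_le_sum fun ⟨a, b⟩ _ => ?_
    have h1 := (rightSteps P).badInd_nonneg (viewT f) ((leftSteps P).move a u) b
    have h2 := (leftSteps P).badInd_nonneg (view f) ((rightSteps P).move b u) a
    dsimp only
    split_ifs with hne
    · by_contra hlt
      have key : ¬ (rightSteps P).RowBad (viewT f) ((leftSteps P).move a u) b ∧
          ¬ (leftSteps P).RowBad (view f) ((rightSteps P).move b u) a := by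
        refine ⟨fun hb => hlt ?_, fun hb => hlt ?_⟩ <;>
          simp only [Steps.badInd, hb, if_true] at h1 h2 ⊢ <;> linarith
      simp only [Steps.RowBad, not_exists, not_not] at key
      apply hne
      simp only [hm₁, hm₂]
      rw [key.2, leftSteps_comm]
      exact congrArg _ (key.1 _).symm
    · linarith
  have hsum : (∑ a, ∑ b, ((rightSteps P).badInd (viewT f) ((leftSteps P).move a u) b
          + (leftSteps P).badInd (view f) ((rightSteps P).move b u) a))
        / (Fintype.card P.A * Fintype.card P.B)
      = (∑ a, (rightSteps P).badFrac (viewT f) ((leftSteps P).move a u)) / Fintype.card P.A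
        + (∑ b, (leftSteps P).badFrac (view f) ((rightSteps P).move b u)) / Fintype.card P.B := by
    simp only [Steps.badFrac, Finset.sum_add_distrib, ← Finset.sum_div]
    rw [Finset.sum_comm (f := fun a b => (leftSteps P).badInd (view f) ((rightSteps P).move b u) a)]
    rw [add_div, div_div, div_div, mul_comm (Fintype.card P.A : ℝ)]
  rw [← hsum]
  have h1 := not_lt.1 (hmin m')
  rw [hcost] at h1
  simp only [Fintype.card_coe] at hle ⊢
  have h2 : ε / 2 * ((Nat.card {a // ∃ b, m₂ a b ≠ m a b} : ℝ) / P.A.card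
      + (Nat.card {b // ∃ a, m₁ a b ≠ m a b} : ℝ) / P.B.card)
      ≤ (∑ a, ∑ b, ((rightSteps P).badInd (viewT f) ((leftSteps P).move a u) b
          + (leftSteps P).badInd (view f) ((rightSteps P).move b u) a))
        / (P.A.card * P.B.card) := by
    refine le_trans (le_of_eq ?_) (hle.trans (by gcongr))
    ring
  have h3 : (Nat.card {a // ∃ b, m₂ a b ≠ m a b} : ℝ) / P.A.card
      + (Nat.card {b // ∃ a, m₁ a b ≠ m a b} : ℝ) / P.B.card
      ≤ 2 / ε * ((∑ a, ∑ b, ((rightSteps P).badInd (viewT f) ((leftSteps P).move a u) b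
          + (leftSteps P).badInd (view f) ((rightSteps P).move b u) a))
        / (P.A.card * P.B.card)) := by
    calc _ = 2 / ε * (ε / 2 * ((Nat.card {a // ∃ b, m₂ a b ≠ m a b} : ℝ) / P.A.card
      + (Nat.card {b // ∃ a, m₁ a b ≠ m a b} : ℝ) / P.B.card)) := by field_simp
      _ ≤ _ := by gcongr
  linarith

variable [Fintype G]

theorem ndist_eq_sum (f f' : Cochain (tensorSheaf P CA CB) 0) :
    ndist f f' = (∑ g, if letterAt P CA CB f g ≠ letterAt P CA CB f' g then (1 : ℝ) else 0)
      / Fintype.card G := by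
  rw [ndist, ← Fintype.card_congr (facesZeroEquiv P), hammingDist, ← Finset.sum_boole,
    ← (facesZeroEquiv P).sum_comp]
  exact congrArg (· / _) (Finset.sum_congr rfl fun g _ => if_congr Iff.rfl rfl rfl)

theorem ndist_setLetter_le (f : Cochain (tensorSheaf P CA CB) 0) (u : G) (m : tensorCode CA CB) :
    ndist f (setLetter f u m) ≤ 1 / Fintype.card G := by
  rw [ndist_eq_sum]
  gcongr
  calc _ ≤ ∑ g, if g = u then (1 : ℝ) else 0 := by
        refine Finset.sum_le_sum fun g _ => ?_
        rw [letterAt_setLetter]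
        by_cases h : g = u
        · simp only [h, if_true]; split_ifs <;> norm_num
        · simp [h]
    _ = 1 := by simp

theorem sum_defect_le (o : PosetOrientation F (Face P))
    (ho : ∀ g, o.sign (.vertex g) .empty = 1) (f c : Cochain (tensorSheaf P CA CB) 0)
    (hc : c ∈ cocycleCode o (tensorSheaf P CA CB) 0) :
    (∑ g, defect f g) / Fintype.card G ≤ 4 * ndist f c := by
  rw [mem_cocycleCode_iff o ho] at hc
  rw [ndist_eq_sum, mul_div_assoc']
  gcongr
  set s : G → ℝ := fun g => if letterAt P CA CB f g ≠ letterAt P CA CB c g then (1 : ℝ) else 0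
    with hs
  have hs0 : ∀ g, 0 ≤ s g := fun g => by simp only [hs]; split_ifs <;> norm_num
  have hs1 : ∀ g, letterAt P CA CB f g ≠ letterAt P CA CB c g → 1 ≤ s g := fun g h => by
    simp [hs, h]
  have h1 := sum_badInd_le (leftSteps P) (view f) (view c) s hs0
    (fun g h => hs1 g fun h' => h (by funext a b; simp only [view, h'])) hc.1
  have h2 := sum_badInd_le (rightSteps P) (viewT f) (viewT c) s hs0
    (fun g h => hs1 g fun h' => h (by funext a b; simp only [viewT, view, h'])) hc.2
  simp only [defect, Finset.sum_add_distrib]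
  linarith

theorem le_relDist_cocycleCode (o : PosetOrientation F (Face P))
    (ho : ∀ g, o.sign (.vertex g) .empty = 1) {ε : ℝ} (hε₀ : 0 < ε) (hε₁ : ε ≤ 1)
    (hCA : (ε : EReal) ≤ relDist (CA : Set (P.A → F)))
    (hexp : IsExpander (leftCayley (P.A : Set G)) (ε ^ 2 / 2500)) :
    ((0.9996 * ε : ℝ) : EReal) ≤ relDist (cocycleCode o (tensorSheaf P CA CB) 0) := by
  rw [coe_le_relDist_iff]
  intro f hf f' hf' hne
  have hn : (0 : ℝ) < Fintype.card G := by exact_mod_cast Fintype.card_pos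
  set s : G → ℝ := fun g => if letterAt P CA CB f g ≠ letterAt P CA CB f' g then (1 : ℝ) else 0
    with hs
  have hs0 : ∀ g, 0 ≤ s g := fun g => by simp only [hs]; split_ifs <;> norm_num
  have hss : ∀ g, s g ^ 2 = s g := fun g => by simp only [hs]; split_ifs <;> norm_num
  rw [ndist_eq_sum]
  change _ ≤ (∑ g, s g) / _
  rw [mem_cocycleCode_iff o ho] at hf hf'
  have hA := hf.1
  have hA' := hf'.1
  simp only [Steps.RowBad, not_exists, not_not] at hA hA'
  have hdiff : ∀ g, letterAt P CA CB f g ≠ letterAt P CA CB f' g →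
      ∃ a b, view f g a b ≠ view f' g a b := by
    intro g hg
    by_contra! h
    exact hg (Subtype.ext (by funext a b; exact h a b))
  have pt : ∀ g, ε * P.A.card * s g ≤ s g * ∑ a, s ((leftSteps P).move a g) := by
    intro g
    by_cases hg : letterAt P CA CB f g = letterAt P CA CB f' g
    · simp [hs, hg]
    · have hsg : s g = 1 := by simp [hs, hg]
      obtain ⟨a₀, b, hab⟩ := hdiff g hg
      have h1 := mul_card_le_sum_ne hCA (col_mem f g b) (col_mem f' g b)
        (fun h => hab (congrFun h a₀))
      rw [hsg, mul_one, one_mul]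
      rw [Fintype.card_coe] at h1
      refine h1.trans (Finset.sum_le_sum fun a _ => ?_)
      split_ifs with hne'
      · have : letterAt P CA CB f ((leftSteps P).move a g)
            ≠ letterAt P CA CB f' ((leftSteps P).move a g) := by
          intro h
          apply hne'
          rw [hA g a b, hA' g a b, view, view, h]
        simp [hs, this]
      · exact hs0 _
  obtain ⟨g₀, hg₀⟩ : ∃ g, letterAt P CA CB f g ≠ letterAt P CA CB f' g := by
    by_contra! h
    exact hne (cochain_ext h)
  obtain ⟨a₀, -, -⟩ := hdiff g₀ hg₀
  have hAc : (0 : ℝ) < P.A.card := by exact_mod_cast Finset.card_pos.2 ⟨a₀.1, a₀.2⟩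
  have hpos : 0 < ∑ g, s g := by
    have h1 : s g₀ = 1 := by simp [hs, hg₀]
    have := Finset.single_le_sum (f := s) (fun g _ => hs0 g) (Finset.mem_univ g₀)
    linarith
  have hq := (leftSteps P).sum_mul_sum_le (leftCayley_adj P) (leftSteps_injective P)
    (by positivity) hexp s
  have h2 := Finset.sum_le_sum fun g (_ : g ∈ Finset.univ) => pt g
  rw [← Finset.mul_sum] at h2
  rw [Finset.sum_congr rfl fun g _ => hss g, Fintype.card_coe] at hq
  have h3 : (P.A.card * ∑ g, s g) * ε
      ≤ (P.A.card * ∑ g, s g) * (ε ^ 2 / 2500 + (∑ g, s g) / Fintype.card G) := by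
    calc _ = ε * P.A.card * ∑ g, s g := by ring
      _ ≤ _ := h2.trans hq
      _ = _ := by ring
  have h4 := le_of_mul_le_mul_left h3 (mul_pos hAc hpos)
  have : ε ^ 2 ≤ ε := by nlinarith
  linarith

theorem mem_cocycleCode_of_sum_defect_eq_zero (o : PosetOrientation F (Face P))
    (ho : ∀ g, o.sign (.vertex g) .empty = 1) (hA : P.A.card ≠ 0) (hB : P.B.card ≠ 0)
    {f : Cochain (tensorSheaf P CA CB) 0} (h : ∑ g, defect f g = 0) :
    f ∈ cocycleCode o (tensorSheaf P CA CB) 0 := by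
  have hA : (0 : ℝ) < P.A.card := by exact_mod_cast Nat.pos_of_ne_zero hA
  have hB : (0 : ℝ) < P.B.card := by exact_mod_cast Nat.pos_of_ne_zero hB
  rw [Finset.sum_eq_zero_iff_of_nonneg fun g _ => defect_nonneg f g] at h
  have h' : ∀ g, (∑ a, (leftSteps P).badInd (view f) g a) = 0
      ∧ (∑ b, (rightSteps P).badInd (viewT f) g b) = 0 := by
    intro g
    have h0 := h g (Finset.mem_univ g)
    have h1 := (add_eq_zero_iff_of_nonneg (Steps.badFrac_nonneg _ _ _)
      (Steps.badFrac_nonneg _ _ _)).1 h0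
    simp only [Steps.badFrac, Fintype.card_coe, div_eq_zero_iff, hA.ne', hB.ne', or_false] at h1
    exact h1
  rw [mem_cocycleCode_iff o ho]
  refine ⟨fun g a hb => ?_, fun g b hb => ?_⟩
  · have := (Finset.sum_eq_zero_iff_of_nonneg
      fun a _ => Steps.badInd_nonneg _ _ _ _).1 (h' g).1 a (Finset.mem_univ a)
    simp [Steps.badInd, hb] at this
  · have := (Finset.sum_eq_zero_iff_of_nonneg
      fun a _ => Steps.badInd_nonneg _ _ _ _).1 (h' g).2 b (Finset.mem_univ b)
    simp [Steps.badInd, hb] at this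

/-- The assumptions on the complex and on the codes. -/
structure GoodPair (P : CayleyPair G) (CA : Submodule F (P.A → F)) (CB : Submodule F (P.B → F))
    (ε : ℝ) : Prop where
  pos : 0 < ε
  le_one : ε ≤ 1
  cardA : P.A.card ≠ 0
  cardB : P.B.card ≠ 0
  relDistA : (ε : EReal) ≤ relDist (CA : Set (P.A → F))
  relDistB : (ε : EReal) ≤ relDist (CB : Set (P.B → F))
  agreement : IsAgreementTestable CA CB ε
  expanderA : IsExpander (leftCayley (P.A : Set G)) (ε ^ 2 / 2500)
  expanderB : IsExpander (rightCayley (P.B : Set G)) (ε ^ 2 / 2500)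

/-- The decoding radius. -/
def radius (ε : ℝ) (dA dB : ℕ) : ℝ :=
  1 / (250000 * ε⁻¹ ^ 3 + 4800 * (max dA dB : ℕ) * ε⁻¹)

theorem radius_pos {ε : ℝ} (hε : 0 < ε) (dA dB : ℕ) : 0 < radius ε dA dB := by
  unfold radius; positivity

theorem radius_le {ε : ℝ} (hε : 0 < ε) (dA dB : ℕ) : radius ε dA dB ≤ ε ^ 3 / 250000 := by
  have : ε ^ 3 / 250000 = 1 / (250000 * ε⁻¹ ^ 3) := by field_simp
  rw [this, radius]
  gcongr
  have : 0 ≤ 4800 * ((max dA dB : ℕ) : ℝ) * ε⁻¹ := by positivity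
  linarith

variable {ε : ℝ}

theorem mem_cocycleCode_of_locallyMinimal (H : GoodPair P CA CB ε) (o : PosetOrientation F (Face P))
    (ho : ∀ g, o.sign (.vertex g) .empty = 1) {f : Cochain (tensorSheaf P CA CB) 0}
    (hmin : ∀ u m, ¬ vertexCost f u m < defect f u - ε / 100)
    (hsmall : (∑ g, defect f g) / Fintype.card G < 4 * radius ε P.A.card P.B.card) :
    f ∈ cocycleCode o (tensorSheaf P CA CB) 0 := by
  refine mem_cocycleCode_of_sum_defect_eq_zero o ho H.cardA H.cardB ?_
  have : Nonempty P.A := by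
    obtain ⟨a, ha⟩ := Finset.card_ne_zero.1 H.cardA; exact ⟨⟨a, ha⟩⟩
  have : Nonempty P.B := by
    obtain ⟨b, hb⟩ := Finset.card_ne_zero.1 H.cardB; exact ⟨⟨b, hb⟩⟩
  refine (leftSteps P).sum_badFrac_eq_zero (rightSteps P) (leftSteps_comm P)
    (D := (max P.A.card P.B.card : ℕ)) H.pos H.le_one
    (by rw [Fintype.card_coe]; exact_mod_cast le_max_left _ _)
    (by rw [Fintype.card_coe]; exact_mod_cast le_max_right _ _) ?_ ?_ ?_ ?_ ?_ hsmall
  · intro g a hb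
    obtain ⟨b, hb⟩ := hb
    exact mul_card_le_sum_ne H.relDistB (row_mem f g a)
      (row_mem f ((leftSteps P).move a g) ((leftSteps P).rev a)) fun h => hb (congrFun h b)
  · intro g b hb
    obtain ⟨a, ha⟩ := hb
    exact mul_card_le_sum_ne H.relDistA (col_mem f g b)
      (col_mem f ((rightSteps P).move b g) ((rightSteps P).rev b)) fun h => ha (congrFun h a)
  · exact (leftSteps P).sum_mul_sum_le (leftCayley_adj P) (leftSteps_injective P)
      (by positivity) H.expanderA
  · exact (rightSteps P).sum_mul_sum_le (rightCayley_adj P) (rightSteps_injective P)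
      (by positivity) H.expanderB
  · exact fun u => defect_le_of_locallyMinimal H.pos H.agreement (hmin u)

theorem ndist_le_of_reflTransGen (H : GoodPair P CA CB ε) (o : PosetOrientation F (Face P))
    (ho : ∀ g, o.sign (.vertex g) .empty = 1) {f f' : Cochain (tensorSheaf P CA CB) 0}
    (h : Relation.ReflTransGen (CorrectionStep (cayleyWeight P) o (tensorSheaf P CA CB) 0 (ε / 100))
      f f') :
    ε / 50 * ndist f f' + (∑ g, defect f' g) / Fintype.card G
      ≤ (∑ g, defect f g) / Fintype.card G := by
  induction h with
  | refl => simp [ndist_self]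
  | @tail f₁ f₂ _ h ih =>
    obtain ⟨u, m, hlt, rfl⟩ := (correctionStep_iff o ho H.cardA H.cardB _ _ _).1 h
    have h1 := ndist_triangle f f₁ (setLetter f₁ u m)
    have h2 := ndist_setLetter_le f₁ u m
    have hε := H.pos
    have h3 : ε / 50 * ndist f (setLetter f₁ u m) ≤ ε / 50 * ndist f f₁ + ε / 50 * (1 / Fintype.card G) := by
      rw [← mul_add]
      gcongr
      linarith
    have h4 : ε / 50 * (1 / Fintype.card G) + (∑ g, defect (setLetter f₁ u m) g) / Fintype.card G
        ≤ (∑ g, defect f₁ g) / Fintype.card G := by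
      rw [mul_one_div, ← add_div, sum_defect_setLetter]
      gcongr
      linarith
    linarith

theorem wellFounded_correctionStep (H : GoodPair P CA CB ε) (o : PosetOrientation F (Face P))
    (ho : ∀ g, o.sign (.vertex g) .empty = 1) [Finite F] :
    WellFounded fun f₂ f₁ => CorrectionStep (cayleyWeight P) o (tensorSheaf P CA CB) 0 (ε / 100)
      f₁ f₂ := by
  have : Finite (Cochain (tensorSheaf P CA CB) 0) := Finite.of_equiv _ (cochainEquiv P CA CB).symm
  refine Subrelation.wf (r := InvImage (· < ·) fun f : Cochain (tensorSheaf P CA CB) 0 =>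
    ∑ g, defect f g) ?_ ?_
  · intro f₂ f₁ h
    obtain ⟨u, m, hlt, rfl⟩ := (correctionStep_iff o ho H.cardA H.cardB _ _ _).1 h
    change ∑ g, defect (setLetter f₁ u m) g < ∑ g, defect f₁ g
    rw [sum_defect_setLetter]
    linarith [H.pos]
  · have : IsTrans (Cochain (tensorSheaf P CA CB) 0)
        (InvImage (· < ·) fun f : Cochain (tensorSheaf P CA CB) 0 => ∑ g, defect f g) :=
      ⟨fun _ _ _ h1 h2 => lt_trans (α := ℝ) h1 h2⟩
    have : Std.Irrefl (α := Cochain (tensorSheaf P CA CB) 0)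
        (InvImage (· < ·) fun f : Cochain (tensorSheaf P CA CB) 0 => ∑ g, defect f g) :=
      ⟨fun _ h => lt_irrefl (α := ℝ) _ h⟩
    exact Finite.wellFounded_of_trans_of_irrefl _

theorem mem_cocycleCode_of_correctionReturns (H : GoodPair P CA CB ε) (o : PosetOrientation F (Face P))
    (ho : ∀ g, o.sign (.vertex g) .empty = 1) {f f' : Cochain (tensorSheaf P CA CB) 0}
    (h : CorrectionReturns (cayleyWeight P) o (tensorSheaf P CA CB) 0 (ε / 100) f f')
    (hsmall : (∑ g, defect f g) / Fintype.card G < 4 * radius ε P.A.card P.B.card) :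
    f' ∈ cocycleCode o (tensorSheaf P CA CB) 0 := by
  refine mem_cocycleCode_of_locallyMinimal H o ho (fun u m hlt => h.2 (setLetter f' u m) ?_) ?_
  · exact (correctionStep_iff o ho H.cardA H.cardB _ _ _).2 ⟨u, m, hlt, rfl⟩
  · have h1 := ndist_le_of_reflTransGen H o ho h.1
    have h2 : 0 ≤ ε / 50 * ndist f f' := mul_nonneg (by linarith [H.pos]) (ndist_nonneg _ _)
    linarith

theorem correctionDecodes (H : GoodPair P CA CB ε) (o : PosetOrientation F (Face P))
    (ho : ∀ g, o.sign (.vertex g) .empty = 1) [Finite F] : CorrectionDecodes (cayleyWeight P) o (tensorSheaf P CA CB) 0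
    (ε / 100) (radius ε P.A.card P.B.card) := by
  intro f hf
  have hε := H.pos
  refine ⟨(wellFounded_correctionStep H o ho).apply f, ?_⟩
  have : Nonempty (cocycleCode o (tensorSheaf P CA CB) 0) :=
    ⟨⟨0, (cocycles o (tensorSheaf P CA CB) 0).zero_mem⟩⟩
  obtain ⟨⟨c, hc⟩, hfc⟩ := exists_lt_of_ciInf_lt hf
  have hdist := coe_le_relDist_iff.1
    (le_relDist_cocycleCode o ho H.pos H.le_one H.relDistA H.expanderA (CB := CB))
  have hr := radius_le H.pos P.A.card P.B.card
  have hε3 : ε ^ 3 ≤ ε ^ 2 := pow_le_pow_of_le_one hε.le H.le_one (by norm_num)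
  have hε2 : ε ^ 2 ≤ ε := by nlinarith [H.le_one]
  have huniq : ∀ c' ∈ cocycleCode o (tensorSheaf P CA CB) 0, ndist c' c < 0.9996 * ε → c' = c := by
    intro c' hc' hlt
    by_contra hne
    linarith [hdist c' hc' c hc hne]
  change ndist f c < _ at hfc
  refine ⟨c, hc, hfc, fun c' hc' hlt => huniq c' hc' ?_, fun f' hf' => huniq f' ?_ ?_⟩
  · have := ndist_triangle c' f c
    rw [ndist_comm c' f] at this
    linarith
  · refine mem_cocycleCode_of_correctionReturns H o ho hf' ?_
    linarith [sum_defect_le o ho f c hc]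
  · have h1 := ndist_le_of_reflTransGen H o ho hf'.1
    have h2 := sum_defect_le o ho f c hc
    have h3 : 0 ≤ (∑ g, defect f' g) / Fintype.card G :=
      div_nonneg (Finset.sum_nonneg fun g _ => defect_nonneg f' g) (Nat.cast_nonneg _)
    have h4 := ndist_triangle f' f c
    rw [ndist_comm f' f] at h4
    have h5 : ε * ndist f f' ≤ ε * (0.0008 * ε) := by
      have : ε * (0.0008 * ε) = 200 * (ε ^ 2 / 250000) := by ring
      rw [this]
      linarith
    have h6 := le_of_mul_le_mul_left h5 hε
    linarith

theorem rejectProb_naturalTester (o : PosetOrientation F (Face P))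
    (ho : ∀ g, o.sign (.vertex g) .empty = 1) (f : Cochain (tensorSheaf P CA CB) 0) :
    (naturalTester o (tensorSheaf P CA CB) 0).rejectProb f
      = ((∑ g, ∑ a, (leftSteps P).badInd (view f) g a)
          + ∑ g, ∑ b, (rightSteps P).badInd (viewT f) g b)
        / (Fintype.card G * (P.A.card + P.B.card)) := by
  have h1 : (Nat.card {y : Faces (Face P) (0 + 1) // ¬ coboundary o (tensorSheaf P CA CB) 0 f y = 0} : ℝ)
      = ((∑ g, ∑ a, (leftSteps P).badInd (view f) g a)
          + ∑ g, ∑ b, (rightSteps P).badInd (viewT f) g b) / 2 := by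
    rw [Nat.card_eq_fintype_card, Fintype.card_subtype, ← Finset.sum_boole, sum_edges]
    simp only [coboundary_edgeA_eq_zero_iff o ho, coboundary_edgeB_eq_zero_iff o ho, not_not,
      Steps.badInd]
    ring
  have h2 : (Nat.card (Faces (Face P) (0 + 1)) : ℝ)
      = Fintype.card G * (P.A.card + P.B.card) / 2 := by
    have := sum_edges (P := P) fun _ => (1 : ℝ)
    simp only [Finset.sum_const, Finset.card_univ, nsmul_eq_mul, mul_one, Fintype.card_coe] at this
    rw [Nat.card_eq_fintype_card, this]
    ring
  change (Nat.card {y : Faces (Face P) (0 + 1) // ¬ coboundary o (tensorSheaf P CA CB) 0 f y = 0} : ℝ)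
    / Nat.card (Faces (Face P) (0 + 1)) = _
  rw [h1, h2]
  exact div_div_div_cancel_right₀ two_ne_zero _ _

theorem radius_mul_distTo_le (H : GoodPair P CA CB ε) (o : PosetOrientation F (Face P))
    (ho : ∀ g, o.sign (.vertex g) .empty = 1) [Finite F] (f : Cochain (tensorSheaf P CA CB) 0) :
    radius ε P.A.card P.B.card * distTo f (cocycleCode o (tensorSheaf P CA CB) 0)
      ≤ (∑ g, defect f g) / Fintype.card G / 2 := by
  have hε := H.pos
  have hr := radius_le H.pos P.A.card P.B.card
  have hr0 := radius_pos H.pos P.A.card P.B.card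
  have h0 : (0 : Cochain (tensorSheaf P CA CB) 0) ∈ cocycleCode o (tensorSheaf P CA CB) 0 :=
    (cocycles o (tensorSheaf P CA CB) 0).zero_mem
  rcases lt_or_ge ((∑ g, defect f g) / Fintype.card G) (4 * radius ε P.A.card P.B.card) with h | h
  · obtain ⟨f', hf', hmin⟩ := (wellFounded_correctionStep H o ho).has_min
      {f' | Relation.ReflTransGen
        (CorrectionStep (cayleyWeight P) o (tensorSheaf P CA CB) 0 (ε / 100)) f f'}
      ⟨f, Relation.ReflTransGen.refl⟩
    have hret : CorrectionReturns (cayleyWeight P) o (tensorSheaf P CA CB) 0 (ε / 100) f f' :=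
      ⟨hf', fun f'' hs => hmin f'' (Relation.ReflTransGen.tail hf' hs) hs⟩
    have hmem := mem_cocycleCode_of_correctionReturns H o ho hret h
    have h1 := ndist_le_of_reflTransGen H o ho hf'
    have h3 : 0 ≤ (∑ g, defect f' g) / Fintype.card G :=
      div_nonneg (Finset.sum_nonneg fun g _ => defect_nonneg f' g) (Nat.cast_nonneg _)
    have h5 : radius ε P.A.card P.B.card ≤ ε / 100 := by
      have hε3 : ε ^ 3 ≤ ε ^ 1 := pow_le_pow_of_le_one hε.le H.le_one (by norm_num)
      linarith
    have h6 : distTo f (cocycleCode o (tensorSheaf P CA CB) 0) ≤ ndist f f' := distTo_le hmem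
    have h7 := mul_le_mul_of_nonneg_left h6 hr0.le
    have h8 := mul_le_mul_of_nonneg_right h5 (ndist_nonneg f f')
    linarith
  · have h1 : distTo f (cocycleCode o (tensorSheaf P CA CB) 0) ≤ 1 :=
      (distTo_le h0).trans (ndist_le_one _ _)
    have h2 : radius ε P.A.card P.B.card * distTo f (cocycleCode o (tensorSheaf P CA CB) 0)
        ≤ radius ε P.A.card P.B.card * 1 := by gcongr
    linarith

theorem hasSoundness_naturalTester (H : GoodPair P CA CB ε) (o : PosetOrientation F (Face P))
    (ho : ∀ g, o.sign (.vertex g) .empty = 1) [Finite F] :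
    (naturalTester o (tensorSheaf P CA CB) 0).HasSoundness
      (cocycleCode o (tensorSheaf P CA CB) 0)
      (1 / (max ((P.A.card : ℝ) / P.B.card) ((P.B.card : ℝ) / P.A.card)
        * (250000 * ε⁻¹ ^ 3 + 4800 * (max P.A.card P.B.card : ℕ) * ε⁻¹))) := by
  intro f
  have hmain := radius_mul_distTo_le H o ho f
  have hA : (0 : ℝ) < P.A.card := by exact_mod_cast Nat.pos_of_ne_zero H.cardA
  have hB : (0 : ℝ) < P.B.card := by exact_mod_cast Nat.pos_of_ne_zero H.cardB
  have hn : (0 : ℝ) < Fintype.card G := by exact_mod_cast Fintype.card_pos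
  rw [rejectProb_naturalTester o ho]
  simp only [defect, Finset.sum_add_distrib, Steps.badFrac, Fintype.card_coe, ← Finset.sum_div]
    at hmain
  have hX : 0 ≤ ∑ g, ∑ a, (leftSteps P).badInd (view f) g a :=
    Finset.sum_nonneg fun g _ => Finset.sum_nonneg fun a _ => Steps.badInd_nonneg _ _ _ _
  have hY : 0 ≤ ∑ g, ∑ b, (rightSteps P).badInd (viewT f) g b :=
    Finset.sum_nonneg fun g _ => Finset.sum_nonneg fun a _ => Steps.badInd_nonneg _ _ _ _
  generalize (∑ g, ∑ a, (leftSteps P).badInd (view f) g a) = X at *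
  generalize (∑ g, ∑ b, (rightSteps P).badInd (viewT f) g b) = Y at *
  set p : ℝ := (P.A.card : ℝ)
  set r : ℝ := (P.B.card : ℝ)
  set n : ℝ := (Fintype.card G : ℝ)
  set M := max (p / r) (r / p) with hM
  have hM1 : r ≤ M * p := (div_le_iff₀ hA).1 (le_max_right _ _)
  have hM2 : p ≤ M * r := (div_le_iff₀ hB).1 (le_max_left _ _)
  have hM0 : 0 < M := lt_of_lt_of_le (div_pos hA hB) (le_max_left _ _)
  have hM3 : 1 ≤ M := by
    by_contra hlt
    have hlt := not_le.1 hlt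
    nlinarith
  rw [one_div, mul_inv, ← one_div (250000 * _ + _)]
  change M⁻¹ * radius ε P.A.card P.B.card * _ ≤ _
  rw [mul_assoc, inv_mul_le_iff₀ hM0]
  refine hmain.trans ?_
  have e1 : X / p ≤ 2 * M * X / (p + r) := by
    rw [div_le_div_iff₀ hA (by positivity)]
    have : p + r ≤ 2 * M * p := by nlinarith
    nlinarith
  have e2 : Y / r ≤ 2 * M * Y / (p + r) := by
    rw [div_le_div_iff₀ hB (by positivity)]
    have : p + r ≤ 2 * M * r := by nlinarith
    nlinarith
  calc (X / p + Y / r) / n / 2 ≤ (2 * M * X / (p + r) + 2 * M * Y / (p + r)) / n / 2 := by gcongr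
    _ = _ := by field_simp

theorem isTesterFor_naturalTester (o : PosetOrientation F (Face P)) : (naturalTester o (tensorSheaf P CA CB) 0).IsTesterFor 2
    (cocycleCode o (tensorSheaf P CA CB) 0) := by
  refine ⟨fun y => ?_, fun f hf y => congrFun hf y⟩
  have key : ∀ (z : Faces (Face P) (0 + 1)) (g h : G),
      (∀ v, Face.vertex v < z.1 → v = g ∨ v = h) →
      (Finset.univ.filter fun x : Faces (Face P) 0 => x.1 < z.1).card ≤ 2 := by
    intro z g h hz
    refine (Finset.card_le_card (t := {facesZeroEquiv P g, facesZeroEquiv P h}) ?_).trans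
      Finset.card_le_two
    intro x hx
    obtain ⟨v, rfl⟩ := (facesZeroEquiv P).surjective x
    simpa using hz v (Finset.mem_filter.1 hx).2
  obtain ⟨e | e, rfl⟩ := (facesOneEquiv P).surjective y
  · obtain ⟨g, a, rfl⟩ := exists_mkEdgeA e
    exact key ⟨.edgeA (mkEdgeA P g a), rfl⟩ g (a * g)
      fun v hv => Sym2.mem_iff.1 (Face.lt_iff.1 hv).1
  · obtain ⟨g, b, rfl⟩ := exists_mkEdgeB e
    exact key ⟨.edgeB (mkEdgeB P g b), rfl⟩ g (g * b)
      fun v hv => Sym2.mem_iff.1 (Face.lt_iff.1 hv).1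

end Cocycles

/-! ## The rate of the cocycle code -/

section Rate

theorem finrank_mul_le_tensorCode {F ι κ : Type*} [Field F] [Fintype ι] [Fintype κ]
    (C₁ : Submodule F (ι → F)) (C₂ : Submodule F (κ → F)) :
    Module.finrank F C₁ * Module.finrank F C₂ ≤ Module.finrank F (tensorCode C₁ C₂) := by
  let β := Module.finBasis F C₁
  let L : (Fin (Module.finrank F C₁) → C₂) →ₗ[F] tensorCode C₁ C₂ :=
    { toFun := fun y => ⟨fun i j => ∑ k, (y k).1 j * (β k).1 i, fun j => by
          convert (∑ k, (y k).1 j • β k).2 using 1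
          funext i
          simp, fun i => by
          convert (∑ k, (β k).1 i • y k).2 using 1
          funext j
          simp [mul_comm]⟩
      map_add' := fun y z => by
        ext i j
        simp [add_mul, Finset.sum_add_distrib]
        rfl
      map_smul' := fun c y => by
        ext i j
        simp [mul_assoc]
        exact (Finset.mul_sum _ _ _).symm }
  have hL : Function.Injective L := by
    rw [← LinearMap.ker_eq_bot, LinearMap.ker_eq_bot']
    intro y hy
    funext k
    ext j
    have h : ∑ k, (y k).1 j • β k = 0 := by
      ext i
      have := congrFun (congrFun (congrArg Subtype.val hy) i) j
      simpa [L] using this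
    exact Fintype.linearIndependent_iff.1 β.linearIndependent (fun k => (y k).1 j) h k
  have := LinearMap.finrank_le_finrank_of_injective hL
  rwa [Module.finrank_pi_fintype, Finset.sum_const, Finset.card_univ, Fintype.card_fin,
    smul_eq_mul] at this

theorem logb_pow_pow {p : ℝ} (hp : 1 < p) (a k : ℕ) : Real.logb (p ^ a) (p ^ k) = k / a := by
  rw [Real.logb, Real.log_pow, Real.log_pow, mul_div_mul_right _ _ (Real.log_pos hp).ne']

theorem logb_card_eq {F V W : Type*} [Field F] [Finite F] [AddCommGroup V] [Module F V]
    [AddCommGroup W] [Module F W] [Module.Finite F V] [Module.Finite F W] :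
    Real.logb (Nat.card V) (Nat.card W) = Module.finrank F W / Module.finrank F V := by
  rw [Module.natCard_eq_pow_finrank (K := F) (V := V), Module.natCard_eq_pow_finrank (K := F) (V := W)]
  push_cast
  exact logb_pow_pow (by exact_mod_cast Finite.one_lt_card) _ _

variable {G F : Type u} [Group G] [Field F] {P : CayleyPair G}
  {CA : Submodule F (P.A → F)} {CB : Submodule F (P.B → F)}

variable (P CA CB) in
/-- The matrix entries of the letters of a word, as a linear map. -/
def viewLinear : Cochain (tensorSheaf P CA CB) 0 →ₗ[F] (G → P.A → P.B → F) where
  toFun f := view f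
  map_add' _ _ := rfl
  map_smul' _ _ := rfl

theorem viewLinear_injective : Function.Injective (viewLinear P CA CB) := fun _ _ h =>
  cochain_ext fun g => Subtype.ext (by funext a b; exact congrFun (congrFun (congrFun h g) a) b)

variable (P F) in
/-- A function on the squares, as a function of `g, a, b`. -/
def squareView : (Square P → F) →ₗ[F] (G → P.A → P.B → F) where
  toFun x g a b := x (mkSquare P g a b)
  map_add' _ _ := rfl
  map_smul' _ _ := rfl

theorem squareView_injective : Function.Injective (squareView F P) := by
  intro x y h
  funext s
  obtain ⟨g, a, b, rfl⟩ := exists_mkSquare s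
  exact congrFun (congrFun (congrFun h g) a) b

variable [Fintype G]

theorem mem_cocycleCode_of_view_eq (o : PosetOrientation F (Face P))
    (ho : ∀ g, o.sign (.vertex g) .empty = 1) {f : Cochain (tensorSheaf P CA CB) 0}
    {x : Square P → F} (h : squareView F P x = view f) :
    f ∈ cocycleCode o (tensorSheaf P CA CB) 0 := by
  have h' : ∀ g a b, view f g a b = x (mkSquare P g a b) := fun g a b =>
    (congrFun (congrFun (congrFun h g) a) b).symm
  rw [mem_cocycleCode_iff o ho]
  simp only [Steps.RowBad, not_exists, not_not, viewT, h']
  refine ⟨fun g a b => congrArg x (Subtype.ext ?_), fun g b a => congrArg x (Subtype.ext ?_)⟩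
  · exact (squareOf_A g a b).symm
  · exact (squareOf_B g a b).symm

theorem finrank_cochain [Finite F] : Module.finrank F (Cochain (tensorSheaf P CA CB) 0)
    = Fintype.card G * Module.finrank F (tensorCode CA CB) := by
  let L : Cochain (tensorSheaf P CA CB) 0 ≃ₗ[F] (G → tensorCode CA CB) :=
    { cochainEquiv P CA CB with
      map_add' := fun _ _ => rfl
      map_smul' := fun _ _ => rfl }
  rw [L.finrank_eq, Module.finrank_pi_fintype, Finset.sum_const, Finset.card_univ, smul_eq_mul]

instance [Finite F] : Module.Finite F (Cochain (tensorSheaf P CA CB) 0) :=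
  Module.Finite.of_injective _ viewLinear_injective

theorem finrank_cocycles_ge [Finite F] (o : PosetOrientation F (Face P))
    (ho : ∀ g, o.sign (.vertex g) .empty = 1) :
    4 * (Fintype.card G * Module.finrank F (tensorCode CA CB))
      ≤ 4 * Module.finrank F (cocycles o (tensorSheaf P CA CB) 0)
        + 3 * (Fintype.card G * (P.A.card * P.B.card)) := by
  have h1 := Submodule.finrank_sup_add_finrank_inf_eq (LinearMap.range (squareView F P))
    (LinearMap.range (viewLinear P CA CB))
  rw [LinearMap.finrank_range_of_inj squareView_injective,
    LinearMap.finrank_range_of_inj viewLinear_injective, finrank_cochain,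
    Module.finrank_fintype_fun_eq_card] at h1
  have h2 := Submodule.finrank_le (LinearMap.range (squareView F P) ⊔
    LinearMap.range (viewLinear P CA CB))
  have h3 : Module.finrank F (G → P.A → P.B → F) = Fintype.card G * (P.A.card * P.B.card) := by
    simp [Module.finrank_pi_fintype]
  rw [h3] at h2
  have h4 : LinearMap.range (squareView F P) ⊓ LinearMap.range (viewLinear P CA CB)
      ≤ (cocycles o (tensorSheaf P CA CB) 0).map (viewLinear P CA CB) := by
    rintro _ ⟨⟨x, hx⟩, f, rfl⟩
    exact ⟨f, mem_cocycleCode_of_view_eq o ho hx, rfl⟩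
  have h5 := (Submodule.finrank_mono h4).trans (Submodule.finrank_map_le _ _)
  have h6 := card_square P
  omega

theorem le_rate_cocycleCode [Finite F] (hA : P.A.card ≠ 0) (hB : P.B.card ≠ 0)
    (o : PosetOrientation F (Face P)) (ho : ∀ g, o.sign (.vertex g) .empty = 1) :
    (4 * rate (CA : Set (P.A → F)) * rate (CB : Set (P.B → F)) - 3)
        / (4 * rate (CA : Set (P.A → F)) * rate (CB : Set (P.B → F)))
      ≤ rate (cocycleCode o (tensorSheaf P CA CB) 0) := by
  have eA : rate (CA : Set (P.A → F)) = Module.finrank F CA / P.A.card := by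
    have := logb_card_eq (F := F) (V := P.A → F) (W := CA)
    rwa [Module.finrank_fintype_fun_eq_card, Fintype.card_coe] at this
  have eB : rate (CB : Set (P.B → F)) = Module.finrank F CB / P.B.card := by
    have := logb_card_eq (F := F) (V := P.B → F) (W := CB)
    rwa [Module.finrank_fintype_fun_eq_card, Fintype.card_coe] at this
  have eZ : rate (cocycleCode o (tensorSheaf P CA CB) 0)
      = Module.finrank F (cocycles o (tensorSheaf P CA CB) 0)
        / (Fintype.card G * Module.finrank F (tensorCode CA CB)) := by
    have := logb_card_eq (F := F) (V := Cochain (tensorSheaf P CA CB) 0)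
      (W := cocycles o (tensorSheaf P CA CB) 0)
    rw [finrank_cochain] at this
    push_cast at this
    exact this
  have ht := finrank_mul_le_tensorCode CA CB
  have hZ := finrank_cocycles_ge (CA := CA) (CB := CB) o ho
  rw [eA, eB, eZ]
  generalize Module.finrank F CA = k at *
  generalize Module.finrank F CB = l at *
  generalize Module.finrank F (tensorCode CA CB) = t at *
  generalize Module.finrank F (cocycles o (tensorSheaf P CA CB) 0) = z at *
  have hA : (0 : ℝ) < P.A.card := by exact_mod_cast Nat.pos_of_ne_zero hA
  have hB : (0 : ℝ) < P.B.card := by exact_mod_cast Nat.pos_of_ne_zero hB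
  have hn : (0 : ℝ) < Fintype.card G := by exact_mod_cast Fintype.card_pos
  rcases Nat.eq_zero_or_pos (k * l) with h0 | h0
  · have : (4 * ((k : ℝ) / P.A.card) * (l / P.B.card)) = 0 := by
      rcases Nat.mul_eq_zero.1 h0 with h | h <;> simp [h]
    rw [this, div_zero]
    positivity
  · have hkl : (0 : ℝ) < k * l := by exact_mod_cast h0
    have ht' : (k * l : ℝ) ≤ t := by exact_mod_cast ht
    have hZ' : (4 * (Fintype.card G * t) : ℝ) ≤ 4 * z + 3 * (Fintype.card G * (P.A.card * P.B.card)) := by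
      exact_mod_cast hZ
    have ht0 : (0 : ℝ) < t := hkl.trans_le ht'
    have e : (4 * ((k : ℝ) / P.A.card) * (l / P.B.card) - 3)
        / (4 * ((k : ℝ) / P.A.card) * (l / P.B.card))
        = 1 - 3 * (P.A.card * P.B.card) / (4 * (k * l)) := by
      have hk : (k : ℝ) ≠ 0 := left_ne_zero_of_mul hkl.ne'
      have hl : (l : ℝ) ≠ 0 := right_ne_zero_of_mul hkl.ne'
      field_simp
    have h1 : (3 * (P.A.card * P.B.card) / (4 * t) : ℝ)
        ≤ 3 * (P.A.card * P.B.card) / (4 * (k * l)) := by gcongr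
    rw [e]
    calc (1 - 3 * (P.A.card * P.B.card) / (4 * (k * l)) : ℝ)
        ≤ 1 - 3 * (P.A.card * P.B.card) / (4 * t) := by linarith
      _ ≤ _ := by
        rw [le_div_iff₀ (by positivity), sub_mul]
        have : (3 * (P.A.card * P.B.card) / (4 * t) : ℝ) * (Fintype.card G * t)
            = 3 * (Fintype.card G * (P.A.card * P.B.card)) / 4 := by field_simp
        rw [this]
        linarith

end Rate

/-! ## Programs given by finite families of decision trees -/

namespace RAM

/-- Loop-free pieces of programs, ending with a jump to one of the labels in `K`. -/
inductive Tree (K : Type) : Type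
  | goto (k : K)
  | halt
  | const (r c : ℕ) (t : Tree K)
  | incr (r : ℕ) (t : Tree K)
  | decr (r : ℕ) (t : Tree K)
  | load (r : ℕ) (a : Arr) (s : ℕ) (t : Tree K)
  | store (a : Arr) (s r : ℕ) (t : Tree K)
  | ifLt (r s : ℕ) (yes no : Tree K)
  | jump (r m : ℕ) (target : Fin m → Tree K) (default : Tree K)

/-- The contents of the registers and of the arrays. -/
structure Store where
  reg : ℕ → ℕ
  mem : Arr → ℕ → ℕ

namespace Store

/-- `r := c` -/
def setReg (s : Store) (r c : ℕ) : Store := ⟨Function.update s.reg r c, s.mem⟩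

/-- `a[i] := c` -/
def setMem (s : Store) (a : Arr) (i c : ℕ) : Store :=
  ⟨s.reg, Function.update s.mem a (Function.update (s.mem a) i c)⟩

@[simp] theorem setReg_reg (s : Store) (r c : ℕ) : (s.setReg r c).reg = Function.update s.reg r c :=
  rfl

@[simp] theorem setReg_mem (s : Store) (r c : ℕ) : (s.setReg r c).mem = s.mem := rfl

@[simp] theorem setMem_reg (s : Store) (a : Arr) (i c : ℕ) : (s.setMem a i c).reg = s.reg := rfl

@[simp] theorem setMem_mem (s : Store) (a : Arr) (i c : ℕ) :
    (s.setMem a i c).mem = Function.update s.mem a (Function.update (s.mem a) i c) := rfl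

end Store

namespace Tree

variable {K : Type}

/-- The result of the execution of a tree. -/
def exec : Tree K → Store → Option K × Store
  | goto k, s => (some k, s)
  | halt, s => (none, s)
  | const r c t, s => t.exec (s.setReg r c)
  | incr r t, s => t.exec (s.setReg r (s.reg r + 1))
  | decr r t, s => t.exec (s.setReg r (s.reg r - 1))
  | load r a i t, s => t.exec (s.setReg r (s.mem a (s.reg i)))
  | store a i r t, s => t.exec (s.setMem a (s.reg i) (s.reg r))
  | ifLt r i yes no, s => if s.reg r < s.reg i then yes.exec s else no.exec s
  | jump r m target default, s =>
    if h : s.reg r < m then (target ⟨s.reg r, h⟩).exec s else default.exec s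

/-- A bound for the number of steps. -/
def depth : Tree K → ℕ
  | goto _ => 1
  | halt => 0
  | const _ _ t | incr _ t | decr _ t | load _ _ _ t | store _ _ _ t => t.depth + 1
  | ifLt _ _ yes no => max yes.depth no.depth + 1
  | jump _ _ target default => max (Finset.univ.sup fun i => (target i).depth) default.depth + 1

/-- The subtrees. -/
def sub : Tree K → Set (Tree K)
  | goto k => {goto k}
  | halt => {halt}
  | const r c t => insert (const r c t) t.sub
  | incr r t => insert (incr r t) t.sub
  | decr r t => insert (decr r t) t.sub
  | load r a i t => insert (load r a i t) t.sub
  | store a i r t => insert (store a i r t) t.sub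
  | ifLt r i yes no => insert (ifLt r i yes no) (yes.sub ∪ no.sub)
  | jump r m target default =>
    insert (jump r m target default) ((⋃ i, (target i).sub) ∪ default.sub)

theorem finite_sub (t : Tree K) : t.sub.Finite := by
  induction t with
  | goto => exact Set.finite_singleton _
  | halt => exact Set.finite_singleton _
  | ifLt _ _ _ _ h1 h2 => exact (h1.union h2).insert _
  | jump _ _ _ _ h1 h2 => exact ((Set.finite_iUnion h1).union h2).insert _
  | _ => rename_i h; exact h.insert _

theorem self_mem_sub (t : Tree K) : t ∈ t.sub := by
  cases t <;> simp [sub]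

theorem sub_subset {t t' : Tree K} (h : t ∈ t'.sub) : t.sub ⊆ t'.sub := by
  induction t' with
  | goto => rw [Set.mem_singleton_iff.1 h]
  | halt => rw [Set.mem_singleton_iff.1 h]
  | ifLt _ _ _ _ h1 h2 =>
    rcases h with rfl | h | h
    · exact subset_rfl
    · exact (h1 h).trans (Set.subset_union_left.trans (Set.subset_insert _ _))
    · exact (h2 h).trans (Set.subset_union_right.trans (Set.subset_insert _ _))
  | jump _ _ _ _ h1 h2 =>
    rcases h with rfl | h | h
    · exact subset_rfl
    · obtain ⟨i, h⟩ := Set.mem_iUnion.1 h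
      exact fun x hx => .inr (.inl (Set.mem_iUnion.2 ⟨i, h1 i h hx⟩))
    · exact (h2 h).trans (Set.subset_union_right.trans (Set.subset_insert _ _))
  | _ =>
    rename_i ih
    rcases h with rfl | h
    · exact subset_rfl
    · exact (ih h).trans (Set.subset_insert _ _)

/-- Reads values less than `m` into the finite control; `pre x` loads the value for `x` into the
register `0`. -/
def read {X : Type} (m : ℕ) (pre : X → Tree K → Tree K) :
    List X → (X → Fin m) → ((X → Fin m) → Tree K) → Tree K
  | [], e, k => k e
  | x :: l, e, k => pre x (jump 0 m (fun v => read m pre l (Function.update e x v) k) halt)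

theorem exec_read {X : Type} {m : ℕ} {pre : X → Tree K → Tree K} {Q : Store → Prop}
    {val : X → Fin m} (hpre : ∀ x t s, Q s → ∃ s', (pre x t).exec s = t.exec s' ∧ Q s' ∧
      s'.reg 0 = val x) (k : (X → Fin m) → Tree K) (l : List X) :
    ∀ (e : X → Fin m) (s : Store), Q s → (∀ x, x ∈ l ∨ e x = val x) →
      ∃ s', (read m pre l e k).exec s = (k val).exec s' ∧ Q s' := by
  induction l with
  | nil =>
    intro e s hs he
    have : e = val := funext fun x => by simpa using he x
    exact ⟨s, by rw [read, this], hs⟩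
  | cons x l ih =>
    intro e s hs he
    obtain ⟨s₁, h1, hs₁, h2⟩ := hpre x
      (jump 0 m (fun v => read m pre l (Function.update e x v) k) halt) s hs
    obtain ⟨s', h3, hs'⟩ := ih (Function.update e x (val x)) s₁ hs₁ (by
      intro y
      by_cases hy : y = x
      · subst hy; simp
      · rw [Function.update_of_ne hy]
        simpa [hy] using he y)
    refine ⟨s', ?_, hs'⟩
    rw [read, h1, exec, dif_pos (by rw [h2]; exact (val x).2), ← h3]
    congr 3
    exact Fin.ext h2

end Tree

section OfTrees

variable {K : Type} (trees : K → Tree K) (start : K)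

/-- The lines of the program with the given trees. -/
abbrev TreeLine (trees : K → Tree K) : Type := {t : Tree K // ∃ k, t ∈ (trees k).sub}

variable {trees} in
theorem TreeLine.mem_of_sub {t t' : Tree K} (h : ∃ k, t ∈ (trees k).sub) (ht : t' ∈ t.sub) :
    ∃ k, t' ∈ (trees k).sub :=
  h.imp fun _ hk => Tree.sub_subset hk ht

/-- The instruction at the root of a tree. -/
def treeCode : TreeLine trees → Instr (TreeLine trees)
  | ⟨.goto k, _⟩ => .jump 0 0 Fin.elim0 ⟨trees k, k, Tree.self_mem_sub _⟩
  | ⟨.halt, _⟩ => .halt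
  | ⟨.const r c t, h⟩ =>
    .const r c ⟨t, TreeLine.mem_of_sub h (.inr (Tree.self_mem_sub t))⟩
  | ⟨.incr r t, h⟩ => .incr r ⟨t, TreeLine.mem_of_sub h (.inr (Tree.self_mem_sub t))⟩
  | ⟨.decr r t, h⟩ => .decr r ⟨t, TreeLine.mem_of_sub h (.inr (Tree.self_mem_sub t))⟩
  | ⟨.load r a i t, h⟩ => .load r a i ⟨t, TreeLine.mem_of_sub h (.inr (Tree.self_mem_sub t))⟩
  | ⟨.store a i r t, h⟩ => .store a i r ⟨t, TreeLine.mem_of_sub h (.inr (Tree.self_mem_sub t))⟩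
  | ⟨.ifLt r i yes no, h⟩ =>
    .ifLt r i ⟨yes, TreeLine.mem_of_sub h (.inr (.inl (Tree.self_mem_sub yes)))⟩
      ⟨no, TreeLine.mem_of_sub h (.inr (.inr (Tree.self_mem_sub no)))⟩
  | ⟨.jump r m target default, h⟩ =>
    .jump r m (fun i => ⟨target i, TreeLine.mem_of_sub h
      (.inr (.inl (Set.mem_iUnion.2 ⟨i, Tree.self_mem_sub _⟩)))⟩)
      ⟨default, TreeLine.mem_of_sub h (.inr (.inr (Tree.self_mem_sub default)))⟩

/-- The program with the given trees. -/
def treeProgram [Finite K] : Program where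
  Line := TreeLine trees
  finite := by
    have : (⋃ k, (trees k).sub).Finite := Set.finite_iUnion fun k => (trees k).finite_sub
    have h : {t | ∃ k, t ∈ (trees k).sub}.Finite := this.subset fun t ht => Set.mem_iUnion.2 ht
    exact h.to_subtype
  start := ⟨trees start, start, Tree.self_mem_sub _⟩
  code := treeCode trees

/-- The configuration of the program at a tree. -/
def treeConfig [Finite K] (l : TreeLine trees) (s : Store) : Config (treeProgram trees start).Line :=
  ⟨l, s.reg, s.mem⟩

theorem exec_spec [Finite K] (t : Tree K) : ∀ (h : ∃ k, t ∈ (trees k).sub) (s : Store),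
    ∃ n ≤ t.depth, ∃ l : TreeLine trees,
      (step (treeProgram trees start))^[n] (treeConfig trees start ⟨t, h⟩ s)
        = treeConfig trees start l (t.exec s).2 ∧
      ((t.exec s).1 = none → treeCode trees l = .halt) ∧
      ∀ k, (t.exec s).1 = some k → l = ⟨trees k, k, Tree.self_mem_sub _⟩ := by
  have cons : ∀ {t t' : Tree K} {h : ∃ k, t ∈ (trees k).sub} {h' : ∃ k, t' ∈ (trees k).sub}
      {s s' : Store} {d : ℕ},
      step (treeProgram trees start) (treeConfig trees start ⟨t, h⟩ s)
        = treeConfig trees start ⟨t', h'⟩ s' →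
      t.exec s = t'.exec s' → t'.depth ≤ d →
      (∃ n ≤ t'.depth, ∃ l : TreeLine trees,
        (step (treeProgram trees start))^[n] (treeConfig trees start ⟨t', h'⟩ s')
          = treeConfig trees start l (t'.exec s').2 ∧
        ((t'.exec s').1 = none → treeCode trees l = .halt) ∧
        ∀ k, (t'.exec s').1 = some k → l = ⟨trees k, k, Tree.self_mem_sub _⟩) →
      ∃ n ≤ d + 1, ∃ l : TreeLine trees,
        (step (treeProgram trees start))^[n] (treeConfig trees start ⟨t, h⟩ s)
          = treeConfig trees start l (t.exec s).2 ∧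
        ((t.exec s).1 = none → treeCode trees l = .halt) ∧
        ∀ k, (t.exec s).1 = some k → l = ⟨trees k, k, Tree.self_mem_sub _⟩ := by
    rintro t t' h h' s s' d hstep hexec hd ⟨n, hn, l, hl⟩
    refine ⟨n + 1, by omega, l, ?_⟩
    rw [Function.iterate_succ_apply, hstep, hexec]
    exact hl
  induction t with
  | goto k =>
    intro h s
    refine ⟨1, le_rfl, ⟨trees k, k, Tree.self_mem_sub _⟩, rfl, fun h0 => ?_, fun k' hk => ?_⟩
    · cases h0
    · cases hk; rfl
  | halt =>
    intro h s
    refine ⟨0, le_rfl, ⟨.halt, h⟩, rfl, fun _ => rfl, fun k' hk => ?_⟩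
    cases hk
  | const r c t ih => exact fun h s => cons (t' := t) (s' := s.setReg r c) rfl rfl le_rfl (ih _ _)
  | incr r t ih =>
    exact fun h s => cons (t' := t) (s' := s.setReg r (s.reg r + 1)) rfl rfl le_rfl (ih _ _)
  | decr r t ih =>
    exact fun h s => cons (t' := t) (s' := s.setReg r (s.reg r - 1)) rfl rfl le_rfl (ih _ _)
  | load r a i t ih =>
    exact fun h s => cons (t' := t) (s' := s.setReg r (s.mem a (s.reg i))) rfl rfl le_rfl (ih _ _)
  | store a i r t ih =>
    exact fun h s => cons (t' := t) (s' := s.setMem a (s.reg i) (s.reg r)) rfl rfl le_rfl (ih _ _)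
  | ifLt r i yes no ih1 ih2 =>
    intro h s
    have h1 := TreeLine.mem_of_sub h (.inr (.inl (Tree.self_mem_sub yes)))
    have h2 := TreeLine.mem_of_sub h (.inr (.inr (Tree.self_mem_sub no)))
    by_cases hlt : s.reg r < s.reg i
    · have e : (if s.reg r < s.reg i then (⟨yes, h1⟩ : TreeLine trees) else ⟨no, h2⟩) = ⟨yes, h1⟩ :=
        if_pos hlt
      exact cons (s' := s) (congrArg (fun l : TreeLine trees => treeConfig trees start l s) e)
        (by rw [Tree.exec, if_pos hlt]) (le_max_left _ _) (ih1 _ _)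
    · have e : (if s.reg r < s.reg i then (⟨yes, h1⟩ : TreeLine trees) else ⟨no, h2⟩) = ⟨no, h2⟩ :=
        if_neg hlt
      exact cons (s' := s) (congrArg (fun l : TreeLine trees => treeConfig trees start l s) e)
        (by rw [Tree.exec, if_neg hlt]) (le_max_right _ _) (ih2 _ _)
  | jump r m target default ih1 ih2 =>
    intro h s
    have h1 := fun i => TreeLine.mem_of_sub h (t' := target i)
      (.inr (.inl (Set.mem_iUnion.2 ⟨i, Tree.self_mem_sub _⟩)))
    have h2 := TreeLine.mem_of_sub h (.inr (.inr (Tree.self_mem_sub default)))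
    by_cases hlt : s.reg r < m
    · have e : (if h : s.reg r < m then (⟨target ⟨s.reg r, h⟩, h1 _⟩ : TreeLine trees)
          else ⟨default, h2⟩) = ⟨target ⟨s.reg r, hlt⟩, h1 _⟩ := dif_pos hlt
      exact cons (s' := s) (congrArg (fun l : TreeLine trees => treeConfig trees start l s) e)
        (by rw [Tree.exec, dif_pos hlt])
        ((Finset.le_sup (f := fun i => (target i).depth) (Finset.mem_univ _)).trans
          (le_max_left _ _)) (ih1 _ _ _)
    · have e : (if h : s.reg r < m then (⟨target ⟨s.reg r, h⟩, h1 _⟩ : TreeLine trees)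
          else ⟨default, h2⟩) = ⟨default, h2⟩ := dif_neg hlt
      exact cons (s' := s) (congrArg (fun l : TreeLine trees => treeConfig trees start l s) e)
        (by rw [Tree.exec, dif_neg hlt]) (le_max_right _ _) (ih2 _ _)

/-- Starting at the label `k`, at most `N` trees are executed until the program halts with a store
satisfying `Q`. -/
def Halts (trees : K → Tree K) (Q : Store → Prop) : ℕ → K → Store → Prop
  | 0, _, _ => False
  | N + 1, k, s => match (trees k).exec s with
    | (none, s') => Q s'
    | (some k', s') => Halts trees Q N k' s'

variable {trees} in
theorem Halts.of_some {Q : Store → Prop} {N : ℕ} {k k' : K} {s s' : Store}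
    (h : (trees k).exec s = (some k', s')) (h' : Halts trees Q N k' s') :
    Halts trees Q (N + 1) k s := by
  simp only [Halts, h]
  exact h'

variable {trees} in
theorem Halts.of_none {Q : Store → Prop} {N : ℕ} {k : K} {s s' : Store}
    (h : (trees k).exec s = (none, s')) (h' : Q s') : Halts trees Q (N + 1) k s := by
  simp only [Halts, h]
  exact h'

variable {trees} in
theorem Halts.imp {Q Q' : Store → Prop} (hQ : ∀ s, Q s → Q' s) {N : ℕ} {k : K} {s : Store}
    (h : Halts trees Q N k s) : Halts trees Q' N k s := by
  induction N generalizing k s with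
  | zero => exact h
  | succ N ih =>
    rcases e : (trees k).exec s with ⟨_ | k', s'⟩
    · exact .of_none e (hQ _ (by simpa only [Halts, e] using h))
    · exact .of_some e (ih (by simpa only [Halts, e] using h))

variable {trees} in
theorem Halts.mono {Q : Store → Prop} {N N' : ℕ} (hN : N ≤ N') {k : K} {s : Store}
    (h : Halts trees Q N k s) : Halts trees Q N' k s := by
  induction N generalizing N' k s with
  | zero => exact h.elim
  | succ N ih =>
    obtain ⟨N', rfl⟩ : ∃ N'', N' = N'' + 1 := ⟨N' - 1, by omega⟩
    rcases e : (trees k).exec s with ⟨_ | k', s'⟩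
    · simp only [Halts, e] at h ⊢
      exact h
    · simp only [Halts, e] at h ⊢
      exact ih (by omega) h

theorem Halts.haltsWithin [Finite K] {Q : Store → Prop} {d N : ℕ} (hd : ∀ k, (trees k).depth ≤ d) {k : K}
    {s : Store} (h : Halts trees Q N k s) :
    ∃ n ≤ N * d, ∃ (l : TreeLine trees) (s' : Store),
      (step (treeProgram trees start))^[n]
          (treeConfig trees start ⟨trees k, k, Tree.self_mem_sub _⟩ s)
        = treeConfig trees start l s' ∧ treeCode trees l = .halt ∧ Q s' := by
  induction N generalizing k s with
  | zero => exact h.elim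
  | succ N ih =>
    obtain ⟨n, hn, l, h1, h2, h3⟩ := exec_spec trees start (trees k) ⟨k, Tree.self_mem_sub _⟩ s
    have hdk := hd k
    rw [Nat.succ_mul]
    rcases e : (trees k).exec s with ⟨_ | k', s'⟩
    · simp only [Halts, e] at h
      rw [e] at h1 h2
      exact ⟨n, by omega, l, s', h1, h2 rfl, h⟩
    · simp only [Halts, e] at h
      rw [e] at h1 h3
      obtain ⟨n', hn', l', s'', h4, h5, h6⟩ := ih h
      refine ⟨n' + n, by omega, l', s'', ?_, h5, h6⟩
      rw [Function.iterate_add_apply, h1, h3 k' rfl]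
      exact h4

theorem exists_depth_bound [Finite K] : ∃ d, ∀ k, (trees k).depth ≤ d := by
  have := Fintype.ofFinite K
  exact ⟨Finset.univ.sup fun k => (trees k).depth,
    fun k => Finset.le_sup (f := fun k => (trees k).depth) (Finset.mem_univ k)⟩

end OfTrees

end RAM

/-! ## A linear time implementation of the correction algorithm -/

namespace RAM

section Machine

/-- The constant-size part of the input: the entries of the letters, the inverses in `A` and in `B`,
and the number of letters. -/
abbrev EnvIdx (dA dB m : ℕ) : Type := (Fin dA × Fin dB × Fin (m + 1)) ⊕ (Fin dA ⊕ Fin dB) ⊕ Unit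

/-- Values for the constant-size part of the input. -/
abbrev Env (dA dB m : ℕ) : Type := EnvIdx dA dB m → Fin (m + 1)

/-- The labels of the neighbours of a vertex. -/
abbrev NbrIdx (dA dB : ℕ) : Type := Fin dA ⊕ Fin dB

variable {dA dB m : ℕ}

/-- The place of an item of the constant-size part of the input. -/
def envAddr : EnvIdx dA dB m → Arr × ℕ
  | .inl (i, j, c) => (.letter i j, c)
  | .inr (.inl (.inl i)) => (.invA, i)
  | .inr (.inl (.inr j)) => (.invB, j)
  | .inr (.inr ()) => (.size, 1)

/-- The adjacency tables. -/
def nbrArr : NbrIdx dA dB → Arr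
  | .inl i => .nbrA i
  | .inr j => .nbrB j

/-- With the letter `c` at a vertex with neighbouring letters `nb`, the `i`-th edge in the direction
of `A` is violated. -/
def RowDiff (e : Env dA dB m) (nb : NbrIdx dA dB → Fin (m + 1)) (c : Fin (m + 1)) (i : Fin dA) : Prop :=
  ∃ (j : Fin dB) (i' : Fin dA), (i' : ℕ) = e (.inr (.inl (.inl i))) ∧
    e (.inl (i, j, c)) ≠ e (.inl (i', j, nb (.inl i)))

/-- With the letter `c` at a vertex with neighbouring letters `nb`, the `j`-th edge in the direction
of `B` is violated. -/
def ColDiff (e : Env dA dB m) (nb : NbrIdx dA dB → Fin (m + 1)) (c : Fin (m + 1)) (j : Fin dB) : Prop :=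
  ∃ (i : Fin dA) (j' : Fin dB), (j' : ℕ) = e (.inr (.inl (.inr j))) ∧
    e (.inl (i, j, c)) ≠ e (.inl (i, j', nb (.inr j)))

/-- The weighted number of violated edges. -/
def localCost (e : Env dA dB m) (nb : NbrIdx dA dB → Fin (m + 1)) (c : Fin (m + 1)) : ℝ :=
  (∑ i, if RowDiff e nb c i then (1 : ℝ) else 0) / dA
    + (∑ j, if ColDiff e nb c j then (1 : ℝ) else 0) / dB

/-- `c'` is a letter which improves on `c` by more than `q`. -/
def Improves (q : ℝ) (e : Env dA dB m) (nb : NbrIdx dA dB → Fin (m + 1)) (c c' : Fin (m + 1)) : Prop :=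
  c' < e (.inr (.inr ())) ∧ localCost e nb c' < localCost e nb c - q

/-- A letter which improves on `c` by more than `q`, if there is one. -/
def improvement (q : ℝ) (e : Env dA dB m) (nb : NbrIdx dA dB → Fin (m + 1)) (c : Fin (m + 1)) :
    Option (Fin (m + 1)) :=
  if h : ∃ c', Improves q e nb c c' then some h.choose else none

/-- Pushes the vertex in the register `r` onto the stack. -/
def push {K : Type} (r : ℕ) (t : Tree K) : Tree K := .store (.work 0) 2 r (.incr 2 t)

/-- Pushes the given neighbours of the vertex in the register `4` onto the stack. -/
def pushNbrs {K : Type} : List (NbrIdx dA dB) → Tree K → Tree K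
  | [], t => t
  | x :: l, t => .load 6 (nbrArr x) 4 (push 6 (pushNbrs l t))

/-- Loads an item of the constant-size part of the input. -/
def loadEnv {K : Type} (x : EnvIdx dA dB m) (t : Tree K) : Tree K :=
  .const 1 (envAddr x).2 (.load 0 (envAddr x).1 1 t)

/-- Loads the letter at a neighbour of the vertex in the register `4`. -/
def loadNbr {K : Type} (x : NbrIdx dA dB) (t : Tree K) : Tree K :=
  .load 6 (nbrArr x) 4 (.load 0 .word 6 t)

variable (dA dB m) in
/-- The labels: the start, and two loops for each value of the constant-size part of the input. -/
abbrev Label : Type := Option (Bool × Env dA dB m)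

variable (dA dB m) in
/-- Reads the constant-size part of the input and the number of vertices. -/
def startTree : Tree (Label dA dB m) :=
  Tree.read (m + 1) loadEnv Finset.univ.toList (fun _ => 0) fun e =>
    .const 1 0 (.load 3 .size 1 (.goto (some (false, e))))

/-- Pushes all vertices onto the stack. -/
def initTree (e : Env dA dB m) : Tree (Label dA dB m) :=
  .ifLt 2 3 (push 2 (.goto (some (false, e)))) (.goto (some (true, e)))

/-- Replaces the letter at the vertex in the register `4`, and pushes the vertex and its neighbours
onto the stack. -/
def replaceTree (e : Env dA dB m) : Option (Fin (m + 1)) → Tree (Label dA dB m)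
  | none => .goto (some (true, e))
  | some c => .const 0 c (.store .word 4 0
      (push 4 (pushNbrs (Finset.univ : Finset (NbrIdx dA dB)).toList (.goto (some (true, e))))))

/-- Pops a vertex from the stack and improves the letter at this vertex if possible. -/
def mainTree (q : ℝ) (e : Env dA dB m) : Tree (Label dA dB m) :=
  .ifLt 5 2 (.decr 2 (.load 4 (.work 0) 2 (.load 0 .word 4 (.jump 0 (m + 1) (fun c =>
    Tree.read (m + 1) loadNbr Finset.univ.toList (fun _ => 0) fun nb =>
      replaceTree e (improvement q e nb c)) .halt)))) .halt

variable (dA dB m) in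
/-- The trees of the machine. -/
def machineTrees (q : ℝ) : Label dA dB m → Tree (Label dA dB m)
  | none => startTree dA dB m
  | some (false, e) => initTree e
  | some (true, e) => mainTree q e

variable (dA dB m) in
/-- A machine for the correction algorithm with parameter `q`. -/
def machine (q : ℝ) : Program := treeProgram (machineTrees dA dB m q) none

end Machine

end RAM

open RAM

section Correctness

theorem table_coe {n : ℕ} (t : Fin n → ℕ) (k : Fin n) : table t k = t k := by
  simp [table]

variable {G F : Type u} [Group G] [Fintype G] [Field F] [Fintype F] {P : CayleyPair G}
  {CA : Submodule F (P.A → F)} {CB : Submodule F (P.B → F)} (N : Numbering P CA CB)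

theorem inputOf_congr (f f' : Cochain (tensorSheaf P CA CB) 0) {a : Arr} (ha : a ≠ .word) :
    inputOf P CA CB N f a = inputOf P CA CB N f' a := by
  cases a <;> first | exact absurd rfl ha | rfl

theorem inputOf_word (f : Cochain (tensorSheaf P CA CB) 0) (g : G) :
    inputOf P CA CB N f .word (N.group g) = N.letter (letterAt P CA CB f g) := by
  simp [inputOf, table_coe]

/-- The neighbour with a given label. -/
def nbr (g : G) : NbrIdx P.A.card P.B.card → G
  | .inl i => (leftSteps P).move (N.setA.symm i) g
  | .inr j => (rightSteps P).move (N.setB.symm j) g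

theorem inputOf_nbrArr (f : Cochain (tensorSheaf P CA CB) 0) (g : G)
    (x : NbrIdx P.A.card P.B.card) :
    inputOf P CA CB N f (nbrArr x) (N.group g) = N.group (nbr N g x) := by
  cases x <;> simp [inputOf, nbrArr, table_coe, nbr, leftSteps, rightSteps]

/-- The store represents the word `f` and the stack `L`. -/
structure Represents (f : Cochain (tensorSheaf P CA CB) 0) (L : List G) (s : Store) : Prop where
  mem : ∀ a, a ≠ .work 0 → s.mem a = inputOf P CA CB N f a
  zero : s.reg 5 = 0
  sp : s.reg 2 = L.length
  stack : ∀ k (h : k < L.length), s.mem (.work 0) k = N.group L[k]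

variable {N} {f : Cochain (tensorSheaf P CA CB) 0} {L : List G} {s : Store}

theorem Represents.setReg (h : Represents N f L s) {r : ℕ} (h2 : r ≠ 2) (h5 : r ≠ 5) (c : ℕ) :
    Represents N f L (s.setReg r c) where
  mem := h.mem
  zero := by simp [Function.update_of_ne h5.symm, h.zero]
  sp := by simp [Function.update_of_ne h2.symm, h.sp]
  stack := h.stack

theorem Represents.push (h : Represents N f L s) {r : ℕ} {v : G} (hr : s.reg r = N.group v) :
    Represents N f (L ++ [v])
      ((s.setMem (.work 0) (s.reg 2) (s.reg r)).setReg 2 (s.reg 2 + 1)) where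
  mem a ha := by simp [Function.update_of_ne ha, h.mem a ha]
  zero := by simp [h.zero]
  sp := by simp [h.sp]
  stack k hk := by
    rw [List.length_append, List.length_singleton] at hk
    simp only [Store.setReg_mem, Store.setMem_mem, Function.update_self]
    by_cases hkL : k = L.length
    · subst hkL
      have e : (L ++ [v])[L.length]'(by simp) = v := by simp
      rw [e, h.sp, Function.update_self, hr]
    · rw [Function.update_of_ne (by rw [h.sp]; exact hkL), List.getElem_append_left (by omega)]
      exact h.stack k (by omega)

theorem Represents.pop {u : G} (h : Represents N f (L ++ [u]) s) :
    Represents N f L (s.setReg 2 (s.reg 2 - 1)) where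
  mem := h.mem
  zero := by simp [h.zero]
  sp := by simp [h.sp]
  stack k hk := by
    have := h.stack k (by simp; omega)
    rwa [List.getElem_append_left hk] at this

theorem Represents.top {u : G} (h : Represents N f (L ++ [u]) s) :
    s.mem (.work 0) L.length = N.group u := by
  have := h.stack L.length (by simp)
  simpa using this

theorem Represents.setLetter (h : Represents N f L s) {i r : ℕ} {u : G} {σ : tensorCode CA CB}
    (hi : s.reg i = N.group u) (hr : s.reg r = N.letter σ) :
    Represents N (setLetter f u σ) L (s.setMem .word (s.reg i) (s.reg r)) where
  mem a ha := by
    by_cases hw : a = .word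
    · subst hw
      rw [Store.setMem_mem, Function.update_self, h.mem _ (by simp), hi, hr]
      funext k
      by_cases hk : k < Fintype.card G
      · obtain ⟨g, hg⟩ := N.group.surjective ⟨k, hk⟩
        have hgk : k = N.group g := by rw [hg]
        rw [hgk, inputOf_word, letterAt_setLetter]
        by_cases hgu : g = u
        · subst hgu; simp
        · rw [Function.update_of_ne, Function.update_of_ne hgu, inputOf_word]
          exact fun h => hgu (N.group.injective (Fin.ext h))
      · rw [Function.update_of_ne]
        · simp [inputOf, table, hk]
        · exact fun h => hk (by rw [h]; exact (N.group u).2)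
    · rw [Store.setMem_mem, Function.update_of_ne hw, h.mem a ha]
      exact inputOf_congr N _ _ hw
  zero := h.zero
  sp := h.sp
  stack k hk := by
    rw [Store.setMem_mem, Function.update_of_ne (by simp)]
    exact h.stack k hk

theorem Represents.exec_pushNbrs {K : Type} (t : RAM.Tree K) {u : G}
    (l : List (NbrIdx P.A.card P.B.card)) : ∀ {L : List G} {s : Store}, Represents N f L s →
      s.reg 4 = N.group u → ∃ s', (pushNbrs l t).exec s = t.exec s' ∧
        Represents N f (L ++ l.map (nbr N u)) s' := by
  induction l with
  | nil => exact fun {L s} h _ => ⟨s, rfl, by simpa using h⟩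
  | cons x l ih =>
    intro L s h h4
    have h6 : s.mem (nbrArr x) (s.reg 4) = N.group (nbr N u x) := by
      rw [h.mem _ (by cases x <;> simp [nbrArr]), h4, inputOf_nbrArr]
    have h1 := (h.setReg (r := 6) (by norm_num) (by norm_num)
      (s.mem (nbrArr x) (s.reg 4))).push (r := 6) (v := nbr N u x) (by simp [h6])
    obtain ⟨s', hs, hr⟩ := ih (L := L ++ [nbr N u x]) h1 (by simpa using h4)
    exact ⟨s', hs, by simpa using hr⟩

/-- `m + 1` exceeds all numbers in the constant-size part of the input. -/
structure IsBound (CA : Submodule F (P.A → F)) (CB : Submodule F (P.B → F)) (m : ℕ) : Prop where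
  card_field : Fintype.card F ≤ m
  cardA : P.A.card ≤ m
  cardB : P.B.card ≤ m
  card_letter : Nat.card (tensorCode CA CB) ≤ m

variable {m : ℕ}

theorem table_lt {n : ℕ} {t : Fin n → ℕ} {k b : ℕ} (hb : 0 < b) (ht : ∀ i, t i < b) : table t k < b := by
  unfold table
  split_ifs
  · exact ht _
  · exact hb

theorem inputOf_envAddr_lt (hm : IsBound CA CB m) (N : Numbering P CA CB)
    (f : Cochain (tensorSheaf P CA CB) 0) (x : EnvIdx P.A.card P.B.card m) :
    inputOf P CA CB N f (envAddr x).1 (envAddr x).2 < m + 1 := by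
  obtain ⟨i, j, c⟩ | (i | j) | ⟨⟩ := x
  · simp only [envAddr, inputOf]
    refine table_lt (Nat.succ_pos _) fun k => ?_
    split_ifs
    · exact (Fin.is_lt _).trans_le (hm.card_field.trans (Nat.le_succ m))
    · exact Nat.succ_pos _
  · simp only [envAddr, inputOf]
    exact table_lt (Nat.succ_pos _) fun k => (Fin.is_lt _).trans_le (hm.cardA.trans (Nat.le_succ m))
  · simp only [envAddr, inputOf]
    exact table_lt (Nat.succ_pos _) fun k => (Fin.is_lt _).trans_le (hm.cardB.trans (Nat.le_succ m))
  · simpa [envAddr, inputOf] using Nat.lt_succ_of_le hm.card_letter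

/-- The code of a letter. -/
def letterCode (hm : IsBound CA CB m) (N : Numbering P CA CB) (σ : tensorCode CA CB) : Fin (m + 1) :=
  ⟨N.letter σ, (Fin.is_lt _).trans_le (hm.card_letter.trans (Nat.le_succ m))⟩

/-- The constant-size part of the input. -/
def envOf (hm : IsBound CA CB m) (N : Numbering P CA CB) : Env P.A.card P.B.card m := fun x =>
  ⟨inputOf P CA CB N 0 (envAddr x).1 (envAddr x).2, inputOf_envAddr_lt hm N 0 x⟩

/-- The codes of the letters at the neighbours of a vertex. -/
def nbrCode (hm : IsBound CA CB m) (N : Numbering P CA CB) (f : Cochain (tensorSheaf P CA CB) 0)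
    (g : G) (x : NbrIdx P.A.card P.B.card) : Fin (m + 1) :=
  letterCode hm N (letterAt P CA CB f (nbr N g x))

theorem envOf_letter (hm : IsBound CA CB m) (N : Numbering P CA CB) (i : Fin P.A.card)
    (j : Fin P.B.card) (σ : tensorCode CA CB) :
    (envOf hm N (.inl (i, j, letterCode hm N σ)) : ℕ)
      = N.field (σ.1 (N.setA.symm i) (N.setB.symm j)) := by
  simp [envOf, envAddr, inputOf, letterCode, table_coe]

theorem envOf_invA (hm : IsBound CA CB m) (N : Numbering P CA CB) (i : Fin P.A.card) :
    (envOf hm N (.inr (.inl (.inl i))) : ℕ) = N.setA ((leftSteps P).rev (N.setA.symm i)) := by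
  simp [envOf, envAddr, inputOf, table_coe, leftSteps]

theorem envOf_invB (hm : IsBound CA CB m) (N : Numbering P CA CB) (j : Fin P.B.card) :
    (envOf hm N (.inr (.inl (.inr j))) : ℕ) = N.setB ((rightSteps P).rev (N.setB.symm j)) := by
  simp [envOf, envAddr, inputOf, table_coe, rightSteps]

theorem envOf_size (hm : IsBound CA CB m) (N : Numbering P CA CB) :
    (envOf hm N (.inr (.inr ())) : ℕ) = Nat.card (tensorCode CA CB) := by
  simp [envOf, envAddr, inputOf]

theorem rowDiff_iff (hm : IsBound CA CB m) (N : Numbering P CA CB)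
    (f : Cochain (tensorSheaf P CA CB) 0) (g : G) (σ : tensorCode CA CB) (i : Fin P.A.card) :
    RowDiff (envOf hm N) (nbrCode hm N f g) (letterCode hm N σ) i
      ↔ RowViolated f g σ (N.setA.symm i) := by
  unfold RowDiff RowViolated
  refine Iff.trans (exists_congr fun j => ?_) N.setB.symm.surjective.exists.symm
  have key : ∀ i' : Fin P.A.card, (envOf hm N (.inl (i, j, letterCode hm N σ))
      ≠ envOf hm N (.inl (i', j, nbrCode hm N f g (.inl i)))) ↔
      σ.1 (N.setA.symm i) (N.setB.symm j)
        ≠ view f ((leftSteps P).move (N.setA.symm i) g) (N.setA.symm i') (N.setB.symm j) := by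
    intro i'
    rw [ne_eq, Fin.ext_iff, nbrCode, envOf_letter, envOf_letter, ← Fin.ext_iff,
      N.field.injective.eq_iff]
    rfl
  simp only [key, envOf_invA, ← Fin.ext_iff, exists_eq_left, Equiv.symm_apply_apply]

theorem colDiff_iff (hm : IsBound CA CB m) (N : Numbering P CA CB)
    (f : Cochain (tensorSheaf P CA CB) 0) (g : G) (σ : tensorCode CA CB) (j : Fin P.B.card) :
    ColDiff (envOf hm N) (nbrCode hm N f g) (letterCode hm N σ) j
      ↔ ColViolated f g σ (N.setB.symm j) := by
  unfold ColDiff ColViolated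
  refine Iff.trans (exists_congr fun i => ?_) N.setA.symm.surjective.exists.symm
  have key : ∀ j' : Fin P.B.card, (envOf hm N (.inl (i, j, letterCode hm N σ))
      ≠ envOf hm N (.inl (i, j', nbrCode hm N f g (.inr j)))) ↔
      σ.1 (N.setA.symm i) (N.setB.symm j)
        ≠ view f ((rightSteps P).move (N.setB.symm j) g) (N.setA.symm i) (N.setB.symm j') := by
    intro j'
    rw [ne_eq, Fin.ext_iff, nbrCode, envOf_letter, envOf_letter, ← Fin.ext_iff,
      N.field.injective.eq_iff]
    rfl
  simp only [key, envOf_invB, ← Fin.ext_iff, exists_eq_left, Equiv.symm_apply_apply]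

theorem localCost_eq (hm : IsBound CA CB m) (N : Numbering P CA CB)
    (f : Cochain (tensorSheaf P CA CB) 0) (g : G) (σ : tensorCode CA CB) :
    localCost (envOf hm N) (nbrCode hm N f g) (letterCode hm N σ) = vertexCost f g σ := by
  simp only [localCost, vertexCost, rowDiff_iff, colDiff_iff]
  rw [N.setA.symm.sum_comp fun a => if RowViolated f g σ a then (1 : ℝ) else 0,
    N.setB.symm.sum_comp fun b => if ColViolated f g σ b then (1 : ℝ) else 0]

theorem improves_iff (hm : IsBound CA CB m) (N : Numbering P CA CB)
    (f : Cochain (tensorSheaf P CA CB) 0) (g : G) (q : ℝ) (c : Fin (m + 1)) :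
    Improves q (envOf hm N) (nbrCode hm N f g) (letterCode hm N (letterAt P CA CB f g)) c
      ↔ ∃ σ, c = letterCode hm N σ ∧ vertexCost f g σ < defect f g - q := by
  rw [Improves, Fin.lt_def, envOf_size, localCost_eq, ← defect_eq_vertexCost]
  constructor
  · rintro ⟨hc, hlt⟩
    obtain ⟨σ, hσ⟩ := N.letter.surjective ⟨c, hc⟩
    have : c = letterCode hm N σ := Fin.ext (by simp [letterCode, hσ])
    refine ⟨σ, this, ?_⟩
    rwa [this, localCost_eq] at hlt
  · rintro ⟨σ, rfl, hlt⟩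
    rw [localCost_eq]
    exact ⟨Fin.is_lt (N.letter σ), hlt⟩

end Correctness

section Runs

open RAM

variable {G F : Type u} [Group G] [Field F] {P : CayleyPair G}
  {CA : Submodule F (P.A → F)} {CB : Submodule F (P.B → F)}

/-- No letter at `g` reduces the weighted number of violated edges by more than `q`. -/
def IsMinimalAt (q : ℝ) (f : Cochain (tensorSheaf P CA CB) 0) (g : G) : Prop :=
  ∀ σ, ¬ vertexCost f g σ < defect f g - q

/-- The replacement of one letter that reduces the weighted number of violated edges at a vertex by
more than `q`. -/
def LocalStep (q : ℝ) (f f' : Cochain (tensorSheaf P CA CB) 0) : Prop :=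
  ∃ u σ, vertexCost f u σ < defect f u - q ∧ f' = setLetter f u σ

theorem view_setLetter_of_ne (f : Cochain (tensorSheaf P CA CB) 0) {u g : G} (h : g ≠ u)
    (σ : tensorCode CA CB) : view (setLetter f u σ) g = view f g := by
  funext a b
  rw [view, letterAt_setLetter, Function.update_of_ne h, view]

theorem defect_le_two (f : Cochain (tensorSheaf P CA CB) 0) (g : G) : defect f g ≤ 2 := by
  have key : ∀ {V I E : Type u} [Fintype I] (S : Steps V I) (J : Type u) (v : V → I → J → E) (x : V),
      S.badFrac v x ≤ 1 := by
    intro V I E _ S J v x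
    refine div_le_one_of_le₀ ?_ (Nat.cast_nonneg _)
    refine (Finset.sum_le_card_nsmul Finset.univ _ 1 fun i _ => ?_).trans (by simp)
    unfold Steps.badInd
    split_ifs <;> norm_num
  have h1 := key (leftSteps P) _ (view f) g
  have h2 := key (rightSteps P) _ (viewT f) g
  unfold defect
  linarith

variable [Fintype G] [Fintype F]

theorem vertexCost_setLetter (N : Numbering P CA CB) (f : Cochain (tensorSheaf P CA CB) 0) {u g : G}
    (σ τ : tensorCode CA CB) (h : ∀ x, nbr N u x ≠ g) :
    vertexCost (setLetter f u σ) g τ = vertexCost f g τ := by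
  have hA : ∀ a, (leftSteps P).move a g ≠ u := by
    rintro a rfl
    exact h (.inl (N.setA ((leftSteps P).rev a))) (by simp [nbr, (leftSteps P).move_rev])
  have hB : ∀ b, (rightSteps P).move b g ≠ u := by
    rintro b rfl
    exact h (.inr (N.setB ((rightSteps P).rev b))) (by simp [nbr, (rightSteps P).move_rev])
  have h1 : ∀ a, RowViolated (setLetter f u σ) g τ a = RowViolated f g τ a := fun a => by
    simp only [RowViolated, view_setLetter_of_ne f (hA a)]
  have h2 : ∀ b, ColViolated (setLetter f u σ) g τ b = ColViolated f g τ b := fun b => by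
    simp only [ColViolated, view_setLetter_of_ne f (hB b)]
  simp only [vertexCost, h1, h2]

theorem IsMinimalAt.setLetter {q : ℝ} {f : Cochain (tensorSheaf P CA CB) 0} {u g : G}
    (hf : IsMinimalAt q f g) (N : Numbering P CA CB) (σ : tensorCode CA CB) (hgu : g ≠ u)
    (h : ∀ x, nbr N u x ≠ g) : IsMinimalAt q (setLetter f u σ) g := by
  intro τ
  rw [defect_eq_vertexCost, vertexCost_setLetter N f σ _ h, vertexCost_setLetter N f σ _ h,
    letterAt_setLetter, Function.update_of_ne hgu, ← defect_eq_vertexCost]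
  exact hf τ

variable {N : Numbering P CA CB} {f : Cochain (tensorSheaf P CA CB) 0} {L : List G} {s : Store}
  {m : ℕ} {q : ℝ}

theorem Represents.exec_loadNbr (hm : IsBound CA CB m) {K : Type} {u : G}
    (x : NbrIdx P.A.card P.B.card) (t : RAM.Tree K) (s : Store)
    (h : Represents N f L s ∧ s.reg 4 = N.group u) :
    ∃ s', (loadNbr x t).exec s = t.exec s' ∧ (Represents N f L s' ∧ s'.reg 4 = N.group u) ∧
      s'.reg 0 = nbrCode hm N f u x := by
  refine ⟨_, rfl, ⟨(h.1.setReg (r := 6) (by norm_num) (by norm_num) _).setReg (by norm_num)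
    (by norm_num) _, by simpa using h.2⟩, ?_⟩
  have h6 : s.mem (nbrArr x) (s.reg 4) = N.group (nbr N u x) := by
    rw [h.1.mem _ (by cases x <;> simp [nbrArr]), h.2, inputOf_nbrArr]
  simp [h6, h.1.mem, inputOf_word, nbrCode, letterCode]

theorem Represents.exec_mainTree (hm : IsBound CA CB m) {u : G} (h : Represents N f (L ++ [u]) s) :
    ∃ s', (mainTree q (envOf hm N)).exec s = (some (some (true, envOf hm N)), s') ∧
      ((Represents N f L s' ∧ IsMinimalAt q f u) ∨
        ∃ σ, vertexCost f u σ < defect f u - q ∧ Represents N (SheafCode.setLetter f u σ)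
          (L ++ [u] ++ (Finset.univ : Finset (NbrIdx P.A.card P.B.card)).toList.map (nbr N u)) s') := by
  have hlt : s.reg 5 < s.reg 2 := by rw [h.zero, h.sp]; simp
  have hsp : s.reg 2 - 1 = L.length := by simp [h.sp]
  set s₁ := s.setReg 2 (s.reg 2 - 1) with hs₁
  set s₂ := s₁.setReg 4 (s₁.mem (.work 0) (s₁.reg 2)) with hs₂
  set s₃ := s₂.setReg 0 (s₂.mem .word (s₂.reg 4)) with hs₃
  have r1 : Represents N f L s₁ := h.pop
  have r2 : Represents N f L s₂ := r1.setReg (by norm_num) (by norm_num) _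
  have r3 : Represents N f L s₃ := r2.setReg (by norm_num) (by norm_num) _
  have h24 : s₂.reg 4 = N.group u := by
    simp [hs₂, hs₁, hsp, h.top]
  have h34 : s₃.reg 4 = N.group u := by simpa [hs₃] using h24
  have h30 : s₃.reg 0 = letterCode hm N (letterAt P CA CB f u) := by
    simp [hs₃, h24, r2.mem, inputOf_word, letterCode]
  obtain ⟨s₄, h4, r4, h44⟩ := RAM.Tree.exec_read (pre := loadNbr)
    (Q := fun s => Represents N f L s ∧ s.reg 4 = N.group u) (val := nbrCode hm N f u)
    (fun x (t : RAM.Tree (Label P.A.card P.B.card m)) s hs =>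
      Represents.exec_loadNbr hm x t s hs)
    (fun nb => replaceTree (envOf hm N)
      (improvement q (envOf hm N) nb (letterCode hm N (letterAt P CA CB f u))))
    Finset.univ.toList (fun _ => 0) s₃ ⟨r3, h34⟩ (fun x => .inl (by simp))
  have hexec : (mainTree q (envOf hm N)).exec s = (replaceTree (envOf hm N)
      (improvement q (envOf hm N) (nbrCode hm N f u)
        (letterCode hm N (letterAt P CA CB f u)))).exec s₄ := by
    rw [← h4, mainTree, RAM.Tree.exec, if_pos hlt]
    simp only [RAM.Tree.exec]
    change (if h : s₃.reg 0 < m + 1 then _ else _) = _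
    rw [dif_pos (by rw [h30]; exact Fin.is_lt _)]
    congr 3
    funext nb
    congr 2
    exact Fin.ext h30
  rw [hexec]
  by_cases hi : ∃ c, Improves q (envOf hm N) (nbrCode hm N f u)
      (letterCode hm N (letterAt P CA CB f u)) c
  · have hc := hi.choose_spec
    rw [improves_iff] at hc
    obtain ⟨σ, hσ, hlt⟩ := hc
    rw [improvement, dif_pos hi, hσ]
    have r5 := (r4.setReg (r := 0) (by norm_num) (by norm_num) (letterCode hm N σ)).setLetter
      (i := 4) (r := 0) (u := u) (σ := σ) (by simpa using h44) (by simp [letterCode])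
    have r6 := r5.push (r := 4) (v := u) (by simpa using h44)
    obtain ⟨s', hs', r7⟩ := r6.exec_pushNbrs
      (.goto (some (true, envOf hm N)) : RAM.Tree (Label P.A.card P.B.card m))
      Finset.univ.toList (u := u) (by simpa using h44)
    exact ⟨s', hs', .inr ⟨σ, hlt, r7⟩⟩
  · rw [improvement, dif_neg hi]
    refine ⟨s₄, rfl, .inl ⟨r4, fun σ hσ => hi ⟨letterCode hm N σ, ?_⟩⟩⟩
    rw [improves_iff]
    exact ⟨σ, rfl, hσ⟩

/-- The store represents a possible output of the correction algorithm on input `f`. -/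
def Corrected (N : Numbering P CA CB) (q : ℝ) (f : Cochain (tensorSheaf P CA CB) 0) (s : Store) :
    Prop :=
  ∃ f', Relation.ReflTransGen (LocalStep q) f f' ∧ (∀ g, IsMinimalAt q f' g) ∧ Represents N f' [] s

theorem Represents.halts_main (hm : IsBound CA CB m) (hq : 0 < q) (n : ℕ) :
    ∀ {f : Cochain (tensorSheaf P CA CB) 0} {L : List G} {s : Store}, Represents N f L s →
      (∀ g, g ∉ L → IsMinimalAt q f g) →
      L.length + (P.A.card + P.B.card + 1) * ((∑ g, defect f g) / (2 * q)) ≤ n →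
      Halts (machineTrees P.A.card P.B.card m q) (Corrected N q f) (n + 1)
        (some (true, envOf hm N)) s := by
  have hpot : ∀ f : Cochain (tensorSheaf P CA CB) 0, 0 ≤
      ((P.A.card : ℝ) + P.B.card + 1) * ((∑ g, defect f g) / (2 * q)) := fun f =>
    mul_nonneg (by positivity) (div_nonneg (Finset.sum_nonneg fun g _ => defect_nonneg f g)
      (by positivity))
  induction n with
  | zero =>
    intro f L s h hL hn
    have := hpot f
    have hl : L = [] := by
      rw [← List.length_eq_zero_iff, ← Nat.le_zero]
      exact_mod_cast (show (L.length : ℝ) ≤ (0 : ℕ) by linarith)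
    subst hl
    refine Halts.of_none (s' := s) ?_ ⟨f, .refl, fun g => hL g (by simp), h⟩
    change (mainTree q (envOf hm N)).exec s = _
    rw [mainTree, RAM.Tree.exec, if_neg (by simp [h.zero, h.sp])]
    rfl
  | succ n ih =>
    intro f L s h hL hn
    rcases List.eq_nil_or_concat' L with rfl | ⟨L, u, rfl⟩
    · refine Halts.of_none (s' := s) ?_ ⟨f, .refl, fun g => hL g (by simp), h⟩
      change (mainTree q (envOf hm N)).exec s = _
      rw [mainTree, RAM.Tree.exec, if_neg (by simp [h.zero, h.sp])]
      rfl
    · obtain ⟨s', hs', ⟨h', hmin⟩ | ⟨σ, hσ, h'⟩⟩ := h.exec_mainTree (q := q) hm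
      · refine Halts.of_some hs' (ih h' (fun g hg => ?_) ?_)
        · by_cases hgu : g = u
          · rwa [hgu]
          · exact hL g (by simp [hg, hgu])
        · push_cast [List.length_append, List.length_singleton] at hn
          linarith
      · refine Halts.of_some hs' (Halts.imp ?_ (ih h' (fun g hg => ?_) ?_))
        · rintro t ⟨f', h1, h2, h3⟩
          exact ⟨f', .head ⟨u, σ, hσ, rfl⟩ h1, h2, h3⟩
        · simp only [List.mem_append, List.mem_singleton, List.mem_map, Finset.mem_toList,
            Finset.mem_univ, true_and, not_or, not_exists] at hg
          exact (hL g (by simp [hg.1])).setLetter N σ hg.1.2 hg.2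
        · rw [sum_defect_setLetter]
          have e : (∑ g, defect f g + 2 * (vertexCost f u σ - defect f u)) / (2 * q)
              ≤ (∑ g, defect f g) / (2 * q) - 1 := by
            rw [div_sub_one (by positivity)]
            exact div_le_div_of_nonneg_right (by linarith) (by positivity)
          have := mul_le_mul_of_nonneg_left e
            (show 0 ≤ ((P.A.card : ℝ) + P.B.card + 1) by positivity)
          push_cast [List.length_append, List.length_singleton] at hn
          simp only [List.length_append, List.length_singleton, List.length_map,
            Finset.length_toList, Finset.card_univ, Fintype.card_sum, Fintype.card_fin]
          push_cast
          linarith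

theorem Represents.halts_init (hm : IsBound CA CB m) {Q : Store → Prop} {n : ℕ}
    (hmain : ∀ s, Represents N f (List.ofFn N.group.symm) s →
      Halts (machineTrees P.A.card P.B.card m q) Q n (some (true, envOf hm N)) s) (R : List G) :
    ∀ {L : List G} {s : Store}, L ++ R = List.ofFn N.group.symm → Represents N f L s →
      s.reg 3 = Fintype.card G →
      Halts (machineTrees P.A.card P.B.card m q) Q (n + 1 + R.length)
        (some (false, envOf hm N)) s := by
  induction R with
  | nil =>
    intro L s hLR h h3
    rw [List.append_nil] at hLR
    subst hLR
    refine Halts.of_some (s' := s) ?_ (hmain s h)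
    change (initTree (envOf hm N)).exec s = _
    rw [initTree, RAM.Tree.exec, if_neg (by simp [h.sp, h3])]
    rfl
  | cons v R ih =>
    intro L s hLR h h3
    have hlen : L.length < Fintype.card G := by
      have := congrArg List.length hLR
      simp at this
      omega
    have hv : s.reg 2 = N.group v := by
      have : v = (List.ofFn N.group.symm)[L.length]'(by simpa using hlen) := by
        simp [← hLR]
      rw [this, h.sp]
      simp
    have h' := h.push hv
    refine Halts.of_some (?_ : (initTree (envOf hm N)).exec s = _)
      (ih (L := L ++ [v]) (by simpa using hLR) h' (by simpa using h3))
    rw [initTree, RAM.Tree.exec, if_pos (by rw [h.sp, h3]; exact hlen)]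
    rfl

theorem halts_machineTrees (hm : IsBound CA CB m) (hq : 0 < q) (N : Numbering P CA CB)
    (f : Cochain (tensorSheaf P CA CB) 0) :
    Halts (machineTrees P.A.card P.B.card m q) (Corrected N q f)
      ((⌈((P.A.card : ℝ) + P.B.card + 1) / q⌉₊ + 5) * Fintype.card G) none
      ⟨fun _ => 0, inputOf P CA CB N f⟩ := by
  set C := ⌈((P.A.card : ℝ) + P.B.card + 1) / q⌉₊ with hC
  have hn : 0 < Fintype.card G := Fintype.card_pos
  have hmain : ∀ s, Represents N f (List.ofFn N.group.symm) s →
      Halts (machineTrees P.A.card P.B.card m q) (Corrected N q f) ((C + 1) * Fintype.card G + 1)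
        (some (true, envOf hm N)) s := by
    intro s h
    refine h.halts_main hm hq _ (fun g hg => absurd (by simpa [List.mem_ofFn] using N.group.symm.surjective g) hg) ?_
    have h1 : ∑ g, defect f g ≤ 2 * Fintype.card G :=
      (Finset.sum_le_card_nsmul Finset.univ _ 2 fun g _ => defect_le_two f g).trans
        (by simp [mul_comm])
    have h2 : ((P.A.card : ℝ) + P.B.card + 1) / q ≤ C := Nat.le_ceil _
    have h3 : ((P.A.card : ℝ) + P.B.card + 1) * ((∑ g, defect f g) / (2 * q))
        ≤ C * Fintype.card G := by
      calc ((P.A.card : ℝ) + P.B.card + 1) * ((∑ g, defect f g) / (2 * q))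
          ≤ ((P.A.card : ℝ) + P.B.card + 1) * ((2 * Fintype.card G) / (2 * q)) := by gcongr
        _ = ((P.A.card : ℝ) + P.B.card + 1) / q * Fintype.card G := by field_simp
        _ ≤ C * Fintype.card G := by gcongr
    push_cast
    rw [List.length_ofFn]
    linarith
  obtain ⟨s, hs, hmem, h2, h5⟩ := RAM.Tree.exec_read (pre := loadEnv)
    (Q := fun s => s.mem = inputOf P CA CB N f ∧ s.reg 2 = 0 ∧ s.reg 5 = 0) (val := envOf hm N)
    (fun x (t : RAM.Tree (Label P.A.card P.B.card m)) s hs => by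
      refine ⟨_, rfl, ⟨hs.1, by simpa using hs.2⟩, ?_⟩
      have := congrFun (inputOf_congr N f 0 (a := (envAddr x).1)
        (by obtain ⟨i, j, c⟩ | (i | j) | ⟨⟩ := x <;> simp [envAddr])) (envAddr x).2
      simp [hs.1, envOf, this])
    (fun e => .const 1 0 (.load 3 .size 1 (.goto (some (false, e)))))
    Finset.univ.toList (fun _ => 0) ⟨fun _ => 0, inputOf P CA CB N f⟩ ⟨rfl, rfl, rfl⟩
    (fun x => .inl (by simp))
  refine Halts.mono ?_ (Halts.of_some hs (Represents.halts_init hm hmain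
    (List.ofFn N.group.symm) (L := []) rfl ⟨?_, ?_, ?_, ?_⟩ ?_))
  · rw [List.length_ofFn]
    nlinarith
  · exact fun a _ => congrFun hmem a
  · simpa using h5
  · simpa using h2
  · exact fun k hk => absurd hk (by simp)
  · simp [hmem, inputOf]

theorem Corrected.output {s : Store} (h : Corrected N q f s) :
    ∃ f', Relation.ReflTransGen (LocalStep q) f f' ∧ (∀ g, IsMinimalAt q f' g) ∧
      ∀ g, s.mem .word (N.group g) = N.letter (letterAt P CA CB f' g) := by
  obtain ⟨f', h1, h2, h3⟩ := h
  exact ⟨f', h1, h2, fun g => by rw [h3.mem _ (by simp), inputOf_word]⟩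

/-- The machine finds a possible output of the correction algorithm in linear time. -/
theorem machine_haltsWithin (hm : IsBound CA CB m) (hq : 0 < q) {d : ℕ}
    (hd : ∀ k, (machineTrees P.A.card P.B.card m q k).depth ≤ d) (N : Numbering P CA CB)
    (f : Cochain (tensorSheaf P CA CB) 0) :
    ∃ (f' : Cochain (tensorSheaf P CA CB) 0) (output : Arr → ℕ → ℕ),
      (Relation.ReflTransGen (LocalStep q) f f' ∧ ∀ g, IsMinimalAt q f' g) ∧
      HaltsWithin (machine P.A.card P.B.card m q) (inputOf P CA CB N f)
        ((⌈((P.A.card : ℝ) + P.B.card + 1) / q⌉₊ + 5) * d * Fintype.card G) output ∧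
      ∀ g, output .word (N.group g) = N.letter (letterAt P CA CB f' g) := by
  obtain ⟨n, hn, l, s, h1, h2, h3⟩ := (halts_machineTrees hm hq N f).haltsWithin _ none hd
  obtain ⟨f', h4, h5, h6⟩ := h3.output
  refine ⟨f', s.mem, ⟨h4, h5⟩, ⟨n, hn.trans (le_of_eq (by ring)), _, h1, h2, rfl⟩, h6⟩

end Runs

/-! ## Runs of the machine and of the correction algorithm -/

section RunsCorrection

open RAM

variable {G F : Type u} [Group G] [Fintype G] [Field F] {P : CayleyPair G}
  {CA : Submodule F (P.A → F)} {CB : Submodule F (P.B → F)}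

theorem correctionReturns_of_localStep (o : PosetOrientation F (Face P))
    (ho : ∀ g, o.sign (.vertex g) .empty = 1) (hA : P.A.card ≠ 0) (hB : P.B.card ≠ 0) {q : ℝ}
    {f f' : Cochain (tensorSheaf P CA CB) 0} (h : Relation.ReflTransGen (LocalStep q) f f')
    (hmin : ∀ g, IsMinimalAt q f' g) :
    CorrectionReturns (cayleyWeight P) o (tensorSheaf P CA CB) 0 q f f' := by
  refine ⟨h.lift id fun f f' hf => (correctionStep_iff o ho hA hB q f f').2 hf, fun f'' hf => ?_⟩
  obtain ⟨u, σ, hσ, -⟩ := (correctionStep_iff o ho hA hB q f' f'').1 hf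
  exact hmin u σ hσ

variable [Fintype F]

theorem isBound_pow (CA : Submodule F (P.A → F)) (CB : Submodule F (P.B → F)) :
    IsBound CA CB (Fintype.card F ^ (P.A.card * P.B.card) + Fintype.card F + P.A.card + P.B.card) where
  card_field := by omega
  cardA := by omega
  cardB := by omega
  card_letter := by
    have h := Nat.card_le_card_of_injective (α := tensorCode CA CB) (β := P.A → P.B → F)
      (fun m => m.1) Subtype.val_injective
    have e : Nat.card (P.A → P.B → F) = Fintype.card F ^ (P.A.card * P.B.card) := by
      simp [Nat.card_eq_fintype_card, ← pow_mul, mul_comm]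
    omega

theorem runsCorrection_of_forall (o : PosetOrientation F (Face P)) {q : ℝ} (hq : 0 < q) {d m : ℕ}
    (hm : IsBound CA CB m) (hd : ∀ k, (machineTrees P.A.card P.B.card m q k).depth ≤ d)
    (h : ∀ f f' : Cochain (tensorSheaf P CA CB) 0, Relation.ReflTransGen (LocalStep q) f f' →
      (∀ g, IsMinimalAt q f' g) →
        CorrectionReturns (cayleyWeight P) o (tensorSheaf P CA CB) 0 q f f') :
    RunsCorrection P CA CB (machine P.A.card P.B.card m q)
      ((⌈((P.A.card : ℝ) + P.B.card + 1) / q⌉₊ + 5) * d * Fintype.card G) o q := by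
  intro N f
  obtain ⟨f', output, hf, h1, h2⟩ := machine_haltsWithin hm hq hd N f
  exact ⟨f', output, h f f' hf.1 hf.2, h1, h2⟩

end RunsCorrection

/-! ## The trivial group -/

section Trivial

variable {G F : Type u} [Group G] {P : CayleyPair G}

theorem card_eq_zero_of_card_eq_zero (h : P.A.card = 0 ∨ P.B.card = 0) :
    P.A.card = 0 ∧ P.B.card = 0 := by
  have hG : ∀ g : G, g = 1 := by
    intro g
    have hg : g ∈ (⊤ : Subgroup G) := Subgroup.mem_top g
    rcases h with h | h
    · rw [← P.closure_A, Finset.card_eq_zero.1 h] at hg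
      simpa using hg
    · rw [← P.closure_B, Finset.card_eq_zero.1 h] at hg
      simpa using hg
  exact ⟨Finset.card_eq_zero.2 (Finset.eq_empty_of_forall_notMem fun a ha =>
      P.one_notMem_A (hG a ▸ ha)),
    Finset.card_eq_zero.2 (Finset.eq_empty_of_forall_notMem fun b hb => P.one_notMem_B (hG b ▸ hb))⟩

variable [Field F] {CA : Submodule F (P.A → F)} {CB : Submodule F (P.B → F)}

theorem subsingleton_cochain (hA : P.A.card = 0) :
    Subsingleton (Cochain (tensorSheaf P CA CB) 0) := by
  have : IsEmpty P.A := Fintype.card_eq_zero_iff.1 (by simpa using hA)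
  exact ⟨fun f f' => cochain_ext fun g => Subtype.ext (funext fun a => isEmptyElim a)⟩

variable [Fintype G]

theorem cayleyWeight_nonneg (P : CayleyPair G) (x : Face P) : 0 ≤ cayleyWeight P x :=
  mul_nonneg (by positivity) (Finset.sum_nonneg fun _ _ => by split_ifs <;> positivity)

theorem not_correctionStep_of_card_eq_zero (hA : P.A.card = 0) (o : PosetOrientation F (Face P)) {q : ℝ}
    (hq : 0 ≤ q) (f f' : Cochain (tensorSheaf P CA CB) 0) :
    ¬ CorrectionStep (cayleyWeight P) o (tensorSheaf P CA CB) 0 q f f' := by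
  have := subsingleton_cochain (CA := CA) (CB := CB) hA
  rintro ⟨u, h, -, -, -, hlt, -⟩
  rw [Subsingleton.elim h 0, map_zero, add_zero] at hlt
  linarith [mul_nonneg hq (cayleyWeight_nonneg P u)]

theorem correctionReturns_of_card_eq_zero (hA : P.A.card = 0) (o : PosetOrientation F (Face P)) {q : ℝ}
    (hq : 0 ≤ q) (f f' : Cochain (tensorSheaf P CA CB) 0) :
    CorrectionReturns (cayleyWeight P) o (tensorSheaf P CA CB) 0 q f f' := by
  have := subsingleton_cochain (CA := CA) (CB := CB) hA
  rw [Subsingleton.elim f' f]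
  exact ⟨.refl, not_correctionStep_of_card_eq_zero hA o hq f⟩

theorem correctionDecodes_of_card_eq_zero (hA : P.A.card = 0) (o : PosetOrientation F (Face P)) {q η : ℝ}
    (hq : 0 ≤ q) (hη : 0 < η) :
    CorrectionDecodes (cayleyWeight P) o (tensorSheaf P CA CB) 0 q η := by
  have := subsingleton_cochain (CA := CA) (CB := CB) hA
  intro f _
  refine ⟨⟨f, fun f' h => absurd h (not_correctionStep_of_card_eq_zero hA o hq f f')⟩, f, ?_, ?_,
    fun _ _ _ => Subsingleton.elim _ _, fun _ _ => Subsingleton.elim _ _⟩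
  · rw [Subsingleton.elim f 0]
    exact Submodule.zero_mem (cocycles o (tensorSheaf P CA CB) 0)
  · rwa [ndist_self]

theorem rate_eq_zero_of_subsingleton {ι : Type*} [Fintype ι] {α : ι → Type*}
    [Subsingleton (∀ i, α i)] (C : Set (∀ i, α i)) : rate C = 0 := by
  have h : Nat.card (∀ i, α i) ≤ 1 := Finite.card_le_one_iff_subsingleton.2 inferInstance
  rw [rate]
  interval_cases Nat.card (∀ i, α i) <;> simp

theorem le_rate_of_card_eq_zero (hA : P.A.card = 0) (o : PosetOrientation F (Face P)) :
    (4 * rate (CA : Set (P.A → F)) * rate (CB : Set (P.B → F)) - 3)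
        / (4 * rate (CA : Set (P.A → F)) * rate (CB : Set (P.B → F)))
      ≤ rate (cocycleCode o (tensorSheaf P CA CB) 0) := by
  have := subsingleton_cochain (CA := CA) (CB := CB) hA
  have : IsEmpty P.A := Fintype.card_eq_zero_iff.1 (by simpa using hA)
  rw [rate_eq_zero_of_subsingleton (CA : Set (P.A → F)),
    rate_eq_zero_of_subsingleton (cocycleCode o (tensorSheaf P CA CB) 0)]
  simp

end Trivial

end SheafCode

end

theorem mainTheorem4 (ε : ℝ) (hε₀ : 0 < ε) (hε₁ : ε ≤ 1) (dA dB p : ℕ) :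
    ∃ (M : RAM.Program) (K : ℕ),
      ∀ {G F : Type u} [Group G] [Fintype G] [Field F] [Fintype F] (P : CayleyPair G)
        (CA : Submodule F (P.A → F)) (CB : Submodule F (P.B → F))
        (o : PosetOrientation F (Face P)),
        P.A.card = dA → P.B.card = dB → Fintype.card F = p →
        (∀ g, o.sign (.vertex g) .empty = 1) →
        (ε : EReal) ≤ relDist (CA : Set (P.A → F)) →
        (ε : EReal) ≤ relDist (CB : Set (P.B → F)) →
        IsAgreementTestable CA CB ε →
        IsExpander (leftCayley (P.A : Set G)) (ε ^ 2 / 2500) →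
        IsExpander (rightCayley (P.B : Set G)) (ε ^ 2 / 2500) →
        -- the distance of the code
        ((0.9996 * ε : ℝ) : EReal) ≤ relDist (cocycleCode o (tensorSheaf P CA CB) 0) ∧
        -- the rate of the code
        (4 * rate (CA : Set (P.A → F)) * rate (CB : Set (P.B → F)) - 3)
            / (4 * rate (CA : Set (P.A → F)) * rate (CB : Set (P.B → F)))
          ≤ rate (cocycleCode o (tensorSheaf P CA CB) 0) ∧
        -- the natural tester
        (naturalTester o (tensorSheaf P CA CB) 0).IsTesterFor 2
          (cocycleCode o (tensorSheaf P CA CB) 0) ∧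
        (naturalTester o (tensorSheaf P CA CB) 0).HasSoundness
          (cocycleCode o (tensorSheaf P CA CB) 0)
          (1 / (max ((dA : ℝ) / dB) ((dB : ℝ) / dA)
            * (250000 * ε⁻¹ ^ 3 + 4800 * (max dA dB : ℕ) * ε⁻¹))) ∧
        -- the correction algorithm
        CorrectionDecodes (cayleyWeight P) o (tensorSheaf P CA CB) 0 (ε / 100)
          (1 / (250000 * ε⁻¹ ^ 3 + 4800 * (max dA dB : ℕ) * ε⁻¹)) ∧
        -- its linear running time
        RunsCorrection P CA CB M (K * Fintype.card G) o (ε / 100) := by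
  have hq : 0 < ε / 100 := by positivity
  obtain ⟨d, hd⟩ := RAM.exists_depth_bound
    (RAM.machineTrees dA dB (p ^ (dA * dB) + p + dA + dB) (ε / 100))
  refine ⟨RAM.machine dA dB (p ^ (dA * dB) + p + dA + dB) (ε / 100),
    (⌈((dA : ℝ) + dB + 1) / (ε / 100)⌉₊ + 5) * d, ?_⟩
  intro G F _ _ _ _ P CA CB o hdA hdB hp ho hCA hCB hagr hexpA hexpB
  subst hdA hdB hp
  refine ⟨le_relDist_cocycleCode o ho hε₀ hε₁ hCA hexpA, ?_⟩
  by_cases hdeg : P.A.card = 0 ∨ P.B.card = 0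
  · obtain ⟨hA, hB⟩ := card_eq_zero_of_card_eq_zero hdeg
    refine ⟨le_rate_of_card_eq_zero hA o, isTesterFor_naturalTester o, fun f => ?_,
      correctionDecodes_of_card_eq_zero hA o hq.le (radius_pos hε₀ _ _),
      runsCorrection_of_forall o hq (isBound_pow CA CB) hd fun f f' _ _ =>
        correctionReturns_of_card_eq_zero hA o hq.le f f'⟩
    simp only [hA, hB, Nat.cast_zero, div_zero, max_self, zero_mul]
    exact div_nonneg (Nat.cast_nonneg _) (Nat.cast_nonneg _)
  · obtain ⟨hA, hB⟩ := not_or.1 hdeg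
    have H : GoodPair P CA CB ε := ⟨hε₀, hε₁, hA, hB, hCA, hCB, hagr, hexpA, hexpB⟩
    exact ⟨le_rate_cocycleCode hA hB o ho, isTesterFor_naturalTester o,
      hasSoundness_naturalTester H o ho, correctionDecodes H o ho,
      runsCorrection_of_forall o hq (isBound_pow CA CB) hd fun f f' h hmin =>
        correctionReturns_of_localStep o ho hA hB h hmin⟩
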